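/- Let $G$ be a compact semisimple Lie group with Lie algebra $\mathfrak g$ and $K\subseteq G$ a closed subgroup with Lie algebra $\mathfrak k$. Let $\mathfrak m$ be the orthogonal complement of $\mathfrak k$ in $\mathfrak g$ for the Killing form; it is invariant under $\mathrm{Ad}_s$ for $s\in K$. Let $G/K$ be homogeneous almost Hermitian: $g_0$ is an inner product on $\mathfrak m$ and $J$ a $g_0$-orthogonal linear map of $\mathfrak m$ with $J^2=-1$, where $g_0$ is invariant under $\mathrm{Ad}|_K$ and $J$ commutes with it. Let $\chi:K\to U(1)$ be a character (a continuous homomorphism). Let $A=\{f\in C^\infty(G,\mathbb R): f(xs)=f(x)\text{ for } s\in K\}=C^\infty(G/K)$, and let $\mathcal T$ be the $A$-module of vector fields on $G/K$, \[\mathcal T=\{V\in C^\infty(G,\mathfrak m): V(xs)=\mathrm{Ad}_s^{-1}V(x) \text{ for } x\in G,\ s\in K\}.\] For a smooth function $f$ on $G$ with values in a finite-dimensional vector space and $V\in\mathcal T$ put $(\partial_Vf)(x)=\frac{d}{dt}\big|_{t=0}f(x\exp(tV(x)))$. On $\mathcal T$ and on spinor fields, $\nabla^c_V=\partial_V$ is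 the canonical connection. For $V,W\in\mathcal T$ let $[V,W]\in\mathcal T$ be the unique element with $\partial_{[V,W]}f=\partial_V\partial_Wf-\partial_W\partial_Vf$ for all $f\in A$. A standard module frame is a finite family $(W_j)$ in $\mathcal T$ with $V=\sum_j g_0(W_j,V)\,W_j$ for all $V\in\mathcal T$; such frames exist. Let $\nabla$ be a connection on $\mathcal T$ (so $\nabla_VW$ is $A$-linear in $V$, additive in $W$, and $\nabla_V(fW)=f\nabla_VW+(\partial_Vf)W$ for $f\in A$) that is invariant under the action of $G$ by left translation, compatible with $g_0$, i.e. $\partial_U g_0(V,W)=g_0(\nabla_UV,W)+g_0(V,\nabla_UW)$, and commutes with $J$, i.e. $\nabla_V(JW)=J\nabla_VW$. Its torsion is $T_\nabla(V,W)=\nabla_VW-\nabla_WV-[V,W]$, and for $U\in\mathcal T$ put $\mathrm{trace}(T_\nabla^U)=\sum_jg_0(T_\nabla(U,W_j),W_j)\in A$ for any standard module frame $(W_j)$. Let $\mathfrak m_J$ be $\mathfrak m$ with the complex structure $J$ and the inner product $\langle X,Y\rangle_J=g_0(X,Y)+ig_0(JX,Y)$, let $\mathcal S=\bigwedge^*\mathfrak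 m_J$ with the inner product $\langle X_1\wedge\dots\wedge X_p,Y_1\wedge\dots\wedge Y_q\rangle=\delta_{pq}\det[\langle X_k,Y_l\rangle_J]$, and let $\kappa$ be the representation on $\mathcal S$ of the complex Clifford algebra of $(\mathfrak m,g_0)$ (with $XY+YX=-2g_0(X,Y)$) given for $X\in\mathfrak m$ by $\kappa(X)=i(a(X)+a^\dagger(X))$, where $a^\dagger(X)\psi=X\wedge\psi$ and $a(X)(X_1\wedge\dots\wedge X_p)=\sum_j(-1)^{j-1}\langle X,X_j\rangle_J\,X_1\wedge\dots\widehat{X_j}\dots\wedge X_p$. Let $\widetilde{\mathrm{Ad}}_s$ be the extension of $\mathrm{Ad}_s$ to an automorphism of $\mathcal S$, and let \[\mathcal S(G/K,\chi)=\{\psi\in C^\infty(G,\mathcal S): \psi(xs)=\overline{\chi(s)}\,\widetilde{\mathrm{Ad}}{}_s^{-1}\psi(x) \text{ for } x\in G,\ s\in K\}.\] For $V\in\mathcal T$ and $x\in G$ there is a unique complex linear endomorphism $L_V(x)$ of $\mathfrak m_J$ with $(\nabla_VW-\nabla^c_VW)(x)=L_V(x)W(x)$ for all $W\in\mathcal T$;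 let $L_V^{\mathcal S}(x)$ be the derivation of the exterior algebra $\mathcal S$ that extends it. Put $\nabla^{\mathcal S}_V\psi=\nabla^c_V\psi+L_V^{\mathcal S}\psi$. The Dirac operator is \[D^\nabla\psi=\sum_j\kappa(W_j)\big(\nabla^{\mathcal S}_{W_j}\psi\big),\qquad \psi\in\mathcal S(G/K,\chi),\] for any standard module frame $(W_j)$. Then $D^\nabla$ is formally self-adjoint, i.e. \[\int_G\langle (D^\nabla\psi)(x),\varphi(x)\rangle\,dx=\int_G\langle\psi(x),(D^\nabla\varphi)(x)\rangle\,dx\quad\text{for all }\psi,\varphi\in\mathcal S(G/K,\chi)\] ($dx$ a Haar measure on $G$), if and only if $\mathrm{trace}(T_\nabla^U)=0$ for every $U\in\mathcal T$. -/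

import Mathlib

open scoped Manifold ContDiff TensorProduct

noncomputable section

namespace HomDirac

/-! ## Linear algebra: the Fock space of a Hermitian structure -/

/-- An inner product `g₀` on a real vector space `M` with a `g₀`-orthogonal complex structure `J`. -/
structure HermitianStructure (M : Type*) [AddCommGroup M] [Module ℝ M] where
  g₀ : LinearMap.BilinForm ℝ M
  g₀_symm : ∀ X Y, g₀ X Y = g₀ Y X
  g₀_pos : ∀ X, X ≠ 0 → 0 < g₀ X X
  J : M →ₗ[ℝ] M
  J_sq : ∀ X, J (J X) = -X
  J_orth : ∀ X Y, g₀ (J X) (J Y) = g₀ X Y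

namespace HermitianStructure

variable {M : Type*} [AddCommGroup M] [Module ℝ M] (h : HermitianStructure M)

/-- The space `M` regarded as a complex vector space `M_J` by means of `i X = J X`. -/
def MJ (_ : HermitianStructure M) : Type _ := M

instance : AddCommGroup h.MJ := inferInstanceAs (AddCommGroup M)

/-- The identity map `M → M_J`. -/
def toJ : M ≃+ h.MJ := AddEquiv.refl M

/-- The action of complex scalars, `(a + i b) X = a X + b J X`. -/
def csmul (z : ℂ) (X : M) : M := z.re • X + z.im • h.J X

instance : Module ℂ h.MJ where
  smul z X := h.toJ (h.csmul z (h.toJ.symm X))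
  one_smul X := show h.csmul 1 (h.toJ.symm X) = h.toJ.symm X by simp [csmul]
  mul_smul z w X := show h.csmul (z * w) _ = h.csmul z (h.csmul w _) by
    simp only [csmul, map_add, map_smul, h.J_sq, Complex.mul_re, Complex.mul_im]; module
  smul_zero z := show h.csmul z 0 = 0 by simp [csmul]
  smul_add z X Y := show h.csmul z (h.toJ.symm X + h.toJ.symm Y) =
      h.csmul z (h.toJ.symm X) + h.csmul z (h.toJ.symm Y) by
    simp only [csmul, map_add]; module
  add_smul z w X := show h.csmul (z + w) _ = h.csmul z _ + h.csmul w _ by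
    simp only [csmul, Complex.add_re, Complex.add_im]; module
  zero_smul X := show h.csmul 0 _ = 0 by simp [csmul]

theorem smul_toJ (z : ℂ) (X : M) : z • h.toJ X = h.toJ (z.re • X + z.im • h.J X) := rfl

theorem toJ_smul (r : ℝ) (X : M) : h.toJ (r • X) = r • h.toJ X := by
  rw [← Complex.coe_smul, smul_toJ]; simp

/-- The complex inner product `⟨X, Y⟩_J = g₀(X, Y) + i g₀(J X, Y)`, linear in `Y`. -/
def hermForm (X : M) : h.MJ →ₗ[ℂ] ℂ where
  toFun Y := (h.g₀ X (h.toJ.symm Y) : ℂ) + Complex.I * (h.g₀ (h.J X) (h.toJ.symm Y) : ℂ)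
  map_add' Y Z := by simp; ring
  map_smul' z Y := by
    obtain ⟨Y, rfl⟩ := h.toJ.surjective Y
    have h1 : h.g₀ X (h.J Y) = - h.g₀ (h.J X) Y := by
      rw [← h.J_orth X, h.J_sq, map_neg]
    have h2 : h.g₀ (h.J X) (h.J Y) = h.g₀ X Y := h.J_orth X Y
    simp only [smul_toJ, AddEquiv.symm_apply_apply, map_add, map_smul, smul_eq_mul, h1, h2,
      RingHom.id_apply]
    apply Complex.ext <;> simp; ring

/-- A real endomorphism of `M` that commutes with `J`, as a complex endomorphism of `M_J`. -/
def liftJ (A : M →ₗ[ℝ] M) (hA : ∀ X, A (h.J X) = h.J (A X)) : h.MJ →ₗ[ℂ] h.MJ where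
  toFun X := h.toJ (A (h.toJ.symm X))
  map_add' X Y := by simp
  map_smul' z X := by
    obtain ⟨X, rfl⟩ := h.toJ.surjective X
    simp [smul_toJ, hA]

/-- The space of spinors `S = F(M_J)`: the complex exterior algebra of `M_J`. -/
def Spinor : Type _ := ExteriorAlgebra ℂ h.MJ

instance : Ring h.Spinor := inferInstanceAs (Ring (ExteriorAlgebra ℂ h.MJ))

instance : Algebra ℂ h.Spinor := inferInstanceAs (Algebra ℂ (ExteriorAlgebra ℂ h.MJ))

/-- The inclusion of `M_J` in its exterior algebra. -/
def ι : h.MJ →ₗ[ℂ] h.Spinor := ExteriorAlgebra.ι ℂ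

/-- The creation operator `X ∧ ·`. -/
def creation (X : M) : Module.End ℂ h.Spinor := LinearMap.mulLeft ℂ (h.ι (h.toJ X))

/-- The annihilation operator: contraction with the functional `⟨X, ·⟩_J`
(see `annihilation_wedge` for the explicit formula). -/
def annihilation (X : M) : Module.End ℂ h.Spinor :=
  CliffordAlgebra.contractLeft (Q := (0 : QuadraticForm ℂ h.MJ)) (h.hermForm X)

theorem annihilation_ι_mul (X : M) (Y : h.MJ) (η : h.Spinor) :
    h.annihilation X (h.ι Y * η) = h.hermForm X Y • η - h.ι Y * h.annihilation X η :=
  CliffordAlgebra.contractLeft_ι_mul (Q := (0 : QuadraticForm ℂ h.MJ)) (d := h.hermForm X) Y η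

theorem annihilation_one (X : M) : h.annihilation X 1 = 0 :=
  CliffordAlgebra.contractLeft_one (Q := (0 : QuadraticForm ℂ h.MJ)) (d := h.hermForm X)

theorem annihilation_annihilation (X : M) (η : h.Spinor) :
    h.annihilation X (h.annihilation X η) = 0 :=
  CliffordAlgebra.contractLeft_contractLeft (Q := (0 : QuadraticForm ℂ h.MJ))
    (d := h.hermForm X) η

theorem ι_mul_ι_self (X : h.MJ) : h.ι X * h.ι X = 0 := ExteriorAlgebra.ι_sq_zero X

theorem hermForm_add (X Y : M) : h.hermForm (X + Y) = h.hermForm X + h.hermForm Y := by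
  ext Z; simp [hermForm]; ring

theorem hermForm_smul (r : ℝ) (X : M) : h.hermForm (r • X) = r • h.hermForm X := by
  ext Z; simp [hermForm]; ring

theorem hermForm_smul_complex (z : ℂ) (X : h.MJ) :
    h.hermForm (h.toJ.symm (z • X)) = (starRingEnd ℂ z) • h.hermForm (h.toJ.symm X) := by
  obtain ⟨X, rfl⟩ := h.toJ.surjective X
  ext Z
  simp only [hermForm, smul_toJ, AddEquiv.symm_apply_apply, map_add, map_smul, h.J_sq,
    LinearMap.coe_mk, AddHom.coe_mk, LinearMap.smul_apply, LinearMap.add_apply, map_neg,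
    LinearMap.neg_apply]
  apply Complex.ext <;> simp

theorem annihilation_add (X Y : M) :
    h.annihilation (X + Y) = h.annihilation X + h.annihilation Y := by
  simp only [annihilation, hermForm_add]; exact map_add _ _ _

theorem annihilation_smul (r : ℝ) (X : M) : h.annihilation (r • X) = r • h.annihilation X := by
  have : h.hermForm (r • X) = (r : ℂ) • h.hermForm X := h.hermForm_smul r X
  simp only [annihilation, this]
  exact map_smul (CliffordAlgebra.contractLeft (Q := (0 : QuadraticForm ℂ h.MJ))) (r : ℂ)
    (h.hermForm X)

theorem creation_add (X Y : M) : h.creation (X + Y) = h.creation X + h.creation Y := by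
  ext η; simp [creation, add_mul]

theorem creation_smul (r : ℝ) (X : M) : h.creation (r • X) = r • h.creation X := by
  ext η
  simp only [creation, toJ_smul, LinearMap.mulLeft_apply, LinearMap.smul_apply]
  rw [← Complex.coe_smul r (h.toJ X), ← Complex.coe_smul r (_ * η), map_smul, smul_mul_assoc]

/-- Clifford multiplication by vectors, `κ(X) = i (a(X) + a†(X))`. -/
def kappaVec : M →ₗ[ℝ] Module.End ℂ h.Spinor where
  toFun X := Complex.I • (h.annihilation X + h.creation X)
  map_add' X Y := by
    rw [annihilation_add, creation_add]; module
  map_smul' r X := by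
    rw [annihilation_smul, creation_smul, ← smul_add, smul_comm, RingHom.id_apply]

/-- The quadratic form `X ↦ -g₀(X, X)`; its Clifford algebra has the defining relation
`X Y + Y X = -2 g₀(X, Y)`. -/
def cliffordForm : QuadraticForm ℝ M := -(LinearMap.BilinMap.toQuadraticMap h.g₀)

theorem kappaVec_sq (X : M) :
    h.kappaVec X * h.kappaVec X = algebraMap ℝ _ (h.cliffordForm X) := by
  ext η
  have h0 : h.hermForm X (h.toJ X) = (h.g₀ X X : ℂ) := by
    have : h.g₀ (h.J X) X = 0 := by
      have h1 := h.J_orth X (h.J X)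
      rw [h.J_sq, map_neg, h.g₀_symm X] at h1
      linarith
    simp [hermForm, this]
  have h2 : h.ι (h.toJ X) * (h.ι (h.toJ X) * η) = 0 := by
    rw [← mul_assoc, ι_mul_ι_self, zero_mul]
  simp only [kappaVec, LinearMap.coe_mk, AddHom.coe_mk, Module.End.mul_apply, LinearMap.smul_apply,
    LinearMap.add_apply, creation, LinearMap.mulLeft_apply, map_smul, map_add,
    annihilation_annihilation, annihilation_ι_mul, h0, mul_add, mul_smul_comm, h2,
    Module.algebraMap_end_apply, cliffordForm]
  rw [← smul_add, smul_smul, Complex.I_mul_I, ← Complex.coe_smul]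
  simp

/-- The complex Clifford algebra of `(M, g₀)`. -/
abbrev ComplexClifford : Type _ := ℂ ⊗[ℝ] CliffordAlgebra h.cliffordForm

theorem kappa_commute (z : ℂ) (c : CliffordAlgebra h.cliffordForm) :
    Commute (Algebra.ofId ℂ (Module.End ℂ h.Spinor) z)
      (CliffordAlgebra.lift h.cliffordForm ⟨h.kappaVec, h.kappaVec_sq⟩ c) :=
  Algebra.commutes z _

/-- The spinor representation `κ` of the complex Clifford algebra on the Fock space. -/
def kappa : h.ComplexClifford →ₐ[ℂ] Module.End ℂ h.Spinor :=
  Algebra.TensorProduct.lift (Algebra.ofId ℂ _)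
    (CliffordAlgebra.lift h.cliffordForm ⟨h.kappaVec, h.kappaVec_sq⟩) h.kappa_commute

/-- The inclusion of `M` in the complex Clifford algebra. -/
def cliffordVec (X : M) : h.ComplexClifford := 1 ⊗ₜ CliffordAlgebra.ι h.cliffordForm X

theorem kappa_cliffordVec (X : M) :
    h.kappa (h.cliffordVec X) = Complex.I • (h.annihilation X + h.creation X) := by
  rw [kappa, cliffordVec, Algebra.TensorProduct.lift_tmul, map_one, one_mul,
    CliffordAlgebra.lift_ι_apply]
  rfl

/-! ### The inner product of spinors -/

/-- The opposite of the algebra of endomorphisms of `S`, with the conjugate complex structure. -/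
def ConjEnd : Type _ := (Module.End ℂ h.Spinor)ᵐᵒᵖ

instance : Ring h.ConjEnd := inferInstanceAs (Ring (Module.End ℂ h.Spinor)ᵐᵒᵖ)

instance : Algebra ℂ h.ConjEnd :=
  Algebra.compHom (Module.End ℂ h.Spinor)ᵐᵒᵖ (starRingEnd ℂ)

/-- The annihilation operators, as a complex linear map into `ConjEnd`. -/
def annihilationOp : h.MJ →ₗ[ℂ] h.ConjEnd where
  toFun X := MulOpposite.op (h.annihilation (h.toJ.symm X))
  map_add' X Y := congrArg MulOpposite.op
    (show h.annihilation (h.toJ.symm (X + Y)) =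
      h.annihilation (h.toJ.symm X) + h.annihilation (h.toJ.symm Y) by
      rw [map_add, annihilation_add])
  map_smul' z X := congrArg MulOpposite.op (by
    change h.annihilation _ = (starRingEnd ℂ z) • h.annihilation _
    simp only [annihilation, hermForm_smul_complex]
    exact map_smul (CliffordAlgebra.contractLeft (Q := (0 : QuadraticForm ℂ h.MJ))) _ _)

/-- The conjugate linear antihomomorphism `X₁ ∧ … ∧ X_p ↦ a(X_p) ⋯ a(X₁)`. -/
def adjointAction : h.Spinor →ₐ[ℂ] h.ConjEnd :=
  ExteriorAlgebra.lift ℂ ⟨h.annihilationOp, fun _ =>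
    congrArg MulOpposite.op (LinearMap.ext fun η => h.annihilation_annihilation _ η)⟩

/-- The component of degree zero. -/
def scalarPart : h.Spinor →ₐ[ℂ] ℂ := ExteriorAlgebra.algebraMapInv

/-- The inner product of spinors, conjugate linear in the first variable. It is determined by
`⟨X₁ ∧ … ∧ X_p, Y₁ ∧ … ∧ Y_q⟩ = δ_{pq} det ⟨X_k, Y_l⟩_J`; see `innerS_wedge` and
`innerS_wedge_of_ne`. -/
def innerS (φ ψ : h.Spinor) : ℂ := h.scalarPart ((MulOpposite.unop (h.adjointAction φ)) ψ)

theorem innerS_ι_mul (X : M) (φ ψ : h.Spinor) :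
    h.innerS (h.ι (h.toJ X) * φ) ψ = h.innerS φ (h.annihilation X ψ) := by
  have : h.adjointAction (h.ι (h.toJ X)) = MulOpposite.op (h.annihilation X) :=
    ExteriorAlgebra.lift_ι_apply ℂ _ _ _
  simp only [innerS, map_mul, this]
  rfl

theorem innerS_one (ψ : h.Spinor) : h.innerS 1 ψ = h.scalarPart ψ := by
  simp only [innerS, map_one]; rfl

/-- The product `X₁ ∧ … ∧ X_p`. -/
def wedge {p : ℕ} (X : Fin p → M) : h.Spinor := (List.ofFn fun k => h.ι (h.toJ (X k))).prod

theorem wedge_succ {p : ℕ} (X : Fin (p + 1) → M) :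
    h.wedge X = h.ι (h.toJ (X 0)) * h.wedge (fun k => X k.succ) := by
  simp [wedge, List.ofFn_succ]

theorem wedge_zero (X : Fin 0 → M) : h.wedge X = 1 := by
  simp [wedge]

theorem annihilation_wedge {q : ℕ} (X : M) (Y : Fin (q + 1) → M) :
    h.annihilation X (h.wedge Y) =
      ∑ j : Fin (q + 1), ((-1) ^ (j : ℕ) * h.hermForm X (h.toJ (Y j))) •
        h.wedge (fun k => Y (j.succAbove k)) := by
  induction q with
  | zero =>
    rw [wedge_succ, annihilation_ι_mul, wedge_zero, annihilation_one]
    simp [wedge_zero]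
  | succ q ih =>
    rw [wedge_succ, annihilation_ι_mul, ih, sub_eq_add_neg, Finset.mul_sum,
      ← Finset.sum_neg_distrib, Fin.sum_univ_succ (n := q + 1)]
    congr 1
    · simp
    · refine Finset.sum_congr rfl fun j _ => ?_
      rw [h.wedge_succ (fun k => Y (j.succ.succAbove k))]
      simp [pow_succ]

theorem innerS_smul_right (z : ℂ) (φ ψ : h.Spinor) : h.innerS φ (z • ψ) = z * h.innerS φ ψ := by
  simp [innerS]

theorem innerS_sum_right {α : Type*} (s : Finset α) (φ : h.Spinor) (ψ : α → h.Spinor) :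
    h.innerS φ (∑ j ∈ s, ψ j) = ∑ j ∈ s, h.innerS φ (ψ j) := by
  simp [innerS]

theorem scalarPart_ι_mul (X : h.MJ) (η : h.Spinor) : h.scalarPart (h.ι X * η) = 0 := by
  have : h.scalarPart (h.ι X) = 0 := by
    simp only [scalarPart, ι, ExteriorAlgebra.algebraMapInv]
    exact ExteriorAlgebra.lift_ι_apply ℂ _ _ _
  rw [map_mul, this, zero_mul]

theorem innerS_wedge {p : ℕ} (X Y : Fin p → M) :
    h.innerS (h.wedge X) (h.wedge Y) =
      Matrix.det (Matrix.of fun k l => h.hermForm (X k) (h.toJ (Y l))) := by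
  induction p with
  | zero => simp [wedge_zero, innerS_one]
  | succ p ih =>
    rw [h.wedge_succ X, innerS_ι_mul, annihilation_wedge, innerS_sum_right,
      Matrix.det_succ_row_zero]
    refine Finset.sum_congr rfl fun j _ => ?_
    rw [innerS_smul_right, ih]
    rfl

theorem innerS_wedge_of_ne {p q : ℕ} (hpq : p ≠ q) (X : Fin p → M) (Y : Fin q → M) :
    h.innerS (h.wedge X) (h.wedge Y) = 0 := by
  induction p generalizing q with
  | zero =>
    obtain ⟨q, rfl⟩ := Nat.exists_eq_succ_of_ne_zero (Ne.symm hpq)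
    rw [wedge_zero, innerS_one, wedge_succ, scalarPart_ι_mul]
  | succ p ih =>
    rw [h.wedge_succ X, innerS_ι_mul]
    cases q with
    | zero => rw [wedge_zero, annihilation_one, innerS]; simp
    | succ q =>
      rw [annihilation_wedge, innerS_sum_right]
      refine Finset.sum_eq_zero fun j _ => ?_
      rw [innerS_smul_right, ih (by omega), mul_zero]

/-! ### Automorphisms and derivations of the exterior algebra -/

/-- The exterior-algebra endomorphism that extends a linear map of `M_J`. -/
def mapExt (A : h.MJ →ₗ[ℂ] h.MJ) : h.Spinor →ₐ[ℂ] h.Spinor := ExteriorAlgebra.map A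

/-- The homomorphism `η ↦ η + ε L(η)` into the dual numbers over `S` that is given by
`X ↦ X + ε L(X)` on `M_J`. -/
def derivationHom (L : h.MJ →ₗ[ℂ] h.MJ) : h.Spinor →ₐ[ℂ] TrivSqZeroExt h.Spinor h.Spinor :=
  ExteriorAlgebra.lift ℂ
    ⟨{ toFun := fun X => (h.ι X, h.ι (L X))
       map_add' := fun X Y => by rw [map_add, map_add, map_add]; rfl
       map_smul' := fun z X => by rw [map_smul, map_smul, map_smul]; rfl },
      fun X => TrivSqZeroExt.ext (h.ι_mul_ι_self X)
        (show h.ι X * h.ι (L X) + h.ι (L X) * h.ι X = 0 from ExteriorAlgebra.ι_add_mul_swap _ _)⟩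

/-- The derivation of the exterior algebra that extends an endomorphism `L` of `M_J`;
see `derivationExt_ι` and `derivationExt_mul`. -/
def derivationExt (L : h.MJ →ₗ[ℂ] h.MJ) : h.Spinor →ₗ[ℂ] h.Spinor :=
  (TrivSqZeroExt.sndHom h.Spinor h.Spinor).restrictScalars ℂ ∘ₗ (h.derivationHom L).toLinearMap

theorem derivationHom_fst (L : h.MJ →ₗ[ℂ] h.MJ) (η : h.Spinor) :
    (h.derivationHom L η).fst = η := by
  have : (TrivSqZeroExt.fstHom ℂ h.Spinor h.Spinor).comp (h.derivationHom L) =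
      AlgHom.id ℂ h.Spinor := by
    refine ExteriorAlgebra.hom_ext ?_
    ext X
    change (h.derivationHom L (h.ι X)).fst = h.ι X
    have : h.derivationHom L (h.ι X) = (h.ι X, h.ι (L X)) := ExteriorAlgebra.lift_ι_apply ℂ _ _ _
    rw [this]; rfl
  exact DFunLike.congr_fun this η

theorem derivationExt_mul (L : h.MJ →ₗ[ℂ] h.MJ) (η θ : h.Spinor) :
    h.derivationExt L (η * θ) = h.derivationExt L η * θ + η * h.derivationExt L θ := by
  change (h.derivationHom L (η * θ)).snd =
    (h.derivationHom L η).snd * θ + η * (h.derivationHom L θ).snd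
  rw [map_mul, TrivSqZeroExt.snd_mul, derivationHom_fst, derivationHom_fst]
  simp [add_comm]

theorem derivationExt_ι (L : h.MJ →ₗ[ℂ] h.MJ) (X : h.MJ) :
    h.derivationExt L (h.ι X) = h.ι (L X) :=
  congrArg TrivSqZeroExt.snd
    (ExteriorAlgebra.lift_ι_apply ℂ _ _ _ : h.derivationHom L (h.ι X) = _)

/-! ### The topology of the space of spinors -/

section norm

variable [FiniteDimensional ℝ M]

instance : Module.Finite ℂ h.MJ :=
  haveI : Module.Finite ℝ h.MJ :=
    Module.Finite.equiv ({ h.toJ with map_smul' := h.toJ_smul } : M ≃ₗ[ℝ] h.MJ)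
  Module.Finite.of_restrictScalars_finite ℝ ℂ h.MJ

instance : Module.Finite ℂ h.Spinor :=
  Module.Finite.of_basis (Module.finBasis ℂ h.MJ).ExteriorAlgebra

/- A norm on the finite-dimensional space `S`, needed only to speak of smooth maps into `S` and
their derivatives, which do not depend on the choice of the norm. -/
instance : NormedAddCommGroup h.Spinor :=
  NormedAddCommGroup.induced h.Spinor _ (Module.finBasis ℂ h.Spinor).equivFun
    (LinearEquiv.injective _)

instance : NormedSpace ℂ h.Spinor :=
  NormedSpace.induced ℂ h.Spinor _ (Module.finBasis ℂ h.Spinor).equivFun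

end norm

end HermitianStructure

/-! ## The adjoint representation -/

section AdjointRepresentation

variable {E : Type*} [NormedAddCommGroup E] [NormedSpace ℝ E]
  {G : Type*} [TopologicalSpace G] [ChartedSpace E G] [Group G]

instance instLieGroupMinSmoothness [LieGroup 𝓘(ℝ, E) ∞ G] :
    LieGroup 𝓘(ℝ, E) (minSmoothness ℝ 3) G :=
  LieGroup.of_le (n := ∞) (by
    rw [minSmoothness_of_isRCLikeNormedField]; exact ENat.LEInfty.out)

variable (E G) in
/-- The Lie algebra of a Lie group `G` modelled on `E`. -/
abbrev LieAlg : Type _ := GroupLieAlgebra 𝓘(ℝ, E) G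

/-- `Ad_g`, the derivative at the identity of `x ↦ g x g⁻¹`. -/
def Ad (g : G) : LieAlg E G →ₗ[ℝ] LieAlg E G :=
  (mfderiv 𝓘(ℝ, E) 𝓘(ℝ, E) (fun x : G => g * x * g⁻¹) 1 : E →L[ℝ] E).toLinearMap

theorem Ad_one : Ad (E := E) (1 : G) = LinearMap.id := by
  ext X
  have : (fun x : G => 1 * x * 1⁻¹) = id := by ext; simp
  have h : (mfderiv 𝓘(ℝ, E) 𝓘(ℝ, E) (fun x : G => 1 * x * 1⁻¹) 1 : E →L[ℝ] E)
    = ContinuousLinearMap.id ℝ E := by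
    rw [this]; exact mfderiv_id
  change (mfderiv 𝓘(ℝ, E) 𝓘(ℝ, E) (fun x : G => 1 * x * 1⁻¹) 1 : E →L[ℝ] E) X = X
  rw [h]; rfl

theorem mulInvariant_one (X : LieAlg E G) : mulInvariantVectorField X (1 : G) = X := by
  have : (fun x : G => 1 * x) = id := by ext; simp
  have h : (mfderiv 𝓘(ℝ, E) 𝓘(ℝ, E) (fun x : G => 1 * x) 1 : E →L[ℝ] E)
    = ContinuousLinearMap.id ℝ E := by
    rw [this]; exact mfderiv_id
  change (mfderiv 𝓘(ℝ, E) 𝓘(ℝ, E) (fun x : G => 1 * x) 1 : E →L[ℝ] E) X = X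
  rw [h]; rfl

variable [LieGroup 𝓘(ℝ, E) ∞ G]

theorem contMDiff_conj (g : G) : ContMDiff 𝓘(ℝ, E) 𝓘(ℝ, E) ∞ (fun x : G => g * x * g⁻¹) := by
  have h1 : ContMDiff 𝓘(ℝ, E) 𝓘(ℝ, E) ∞ (fun x : G => g * x) := contMDiff_mul_left
  have h2 : ContMDiff 𝓘(ℝ, E) 𝓘(ℝ, E) ∞ (fun x : G => x * g⁻¹) := contMDiff_mul_right
  exact h2.comp h1

theorem mdifferentiableAt_conj (g x : G) :
    MDifferentiableAt 𝓘(ℝ, E) 𝓘(ℝ, E) (fun x : G => g * x * g⁻¹) x :=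
  (contMDiff_conj g).mdifferentiableAt (by simp)

theorem mdifferentiableAt_lmul (g x : G) :
    MDifferentiableAt 𝓘(ℝ, E) 𝓘(ℝ, E) (fun x : G => g * x) x :=
  (contMDiff_mul_left (I := 𝓘(ℝ, E)) (n := ∞)).mdifferentiableAt (by simp)

theorem mfderiv_conj_mulInvariant (g y : G) (X : LieAlg E G) :
    mfderiv 𝓘(ℝ, E) 𝓘(ℝ, E) (fun x : G => g * x * g⁻¹) y (mulInvariantVectorField X y)
      = (mulInvariantVectorField (Ad g X) (g * y * g⁻¹) :
          TangentSpace 𝓘(ℝ, E) (g * y * g⁻¹)) := by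
  have h1 : (fun x : G => g * x * g⁻¹) ∘ (fun x => y * x) =
      (fun x => g * y * g⁻¹ * x) ∘ (fun x : G => g * x * g⁻¹) := by
    ext x; simp [mul_assoc]
  have h2 := mfderiv_comp (I := 𝓘(ℝ, E)) (I' := 𝓘(ℝ, E)) (I'' := 𝓘(ℝ, E)) (1 : G)
    (g := (fun x : G => g * x * g⁻¹)) (f := (fun x => y * x))
    (mdifferentiableAt_conj g _) (mdifferentiableAt_lmul y 1)
  have h3 := mfderiv_comp (I := 𝓘(ℝ, E)) (I' := 𝓘(ℝ, E)) (I'' := 𝓘(ℝ, E)) (1 : G)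
    (g := (fun x => g * y * g⁻¹ * x)) (f := (fun x : G => g * x * g⁻¹))
    (mdifferentiableAt_lmul _ _) (mdifferentiableAt_conj g 1)
  rw [h1] at h2
  have h4 := h2.symm.trans h3
  have h5 := congrArg (fun T : E →L[ℝ] E => T X) h4
  simp only [mulInvariantVectorField]
  have e1 : y * 1 = y := mul_one y
  have e2 : g * 1 * g⁻¹ = 1 := by simp
  have aux1 : ∀ z, z = y →
      (mfderiv 𝓘(ℝ, E) 𝓘(ℝ, E) (fun x : G => g * x * g⁻¹) z : E →L[ℝ] E) =
        mfderiv 𝓘(ℝ, E) 𝓘(ℝ, E) (fun x : G => g * x * g⁻¹) y := by rintro _ rfl; rfl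
  have aux2 : ∀ z, z = (1 : G) →
      (mfderiv 𝓘(ℝ, E) 𝓘(ℝ, E) (fun x : G => g * y * g⁻¹ * x) z : E →L[ℝ] E) =
        mfderiv 𝓘(ℝ, E) 𝓘(ℝ, E) (fun x : G => g * y * g⁻¹ * x) 1 := by rintro _ rfl; rfl
  have h6 : (mfderiv 𝓘(ℝ, E) 𝓘(ℝ, E) (fun x : G => g * x * g⁻¹) (y * 1) : E →L[ℝ] E)
      ((mfderiv 𝓘(ℝ, E) 𝓘(ℝ, E) (fun x : G => y * x) 1 : E →L[ℝ] E) X) =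
      (mfderiv 𝓘(ℝ, E) 𝓘(ℝ, E) (fun x : G => g * y * g⁻¹ * x) (g * 1 * g⁻¹) : E →L[ℝ] E)
      ((mfderiv 𝓘(ℝ, E) 𝓘(ℝ, E) (fun x : G => g * x * g⁻¹) 1 : E →L[ℝ] E) X) := h5
  rw [aux1 _ e1, aux2 _ e2] at h6
  exact h6

theorem Ad_mul (g h : G) : Ad (E := E) (g * h) = Ad g ∘ₗ Ad h := by
  have h1 : (fun x : G => g * h * x * (g * h)⁻¹) =
      (fun x : G => g * x * g⁻¹) ∘ (fun x : G => h * x * h⁻¹) := by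
    ext x; simp [mul_assoc]
  have h2 := mfderiv_comp (I := 𝓘(ℝ, E)) (I' := 𝓘(ℝ, E)) (I'' := 𝓘(ℝ, E)) (1 : G)
    (g := (fun x : G => g * x * g⁻¹)) (f := (fun x => h * x * h⁻¹))
    (mdifferentiableAt_conj g _) (mdifferentiableAt_conj h 1)
  rw [← h1] at h2
  have aux1 : ∀ z, z = (1 : G) →
      (mfderiv 𝓘(ℝ, E) 𝓘(ℝ, E) (fun x : G => g * x * g⁻¹) z : E →L[ℝ] E) =
        mfderiv 𝓘(ℝ, E) 𝓘(ℝ, E) (fun x : G => g * x * g⁻¹) 1 := by rintro _ rfl; rfl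
  ext X
  have h5 := congrArg (fun T : E →L[ℝ] E => T X) h2
  have h6 : (mfderiv 𝓘(ℝ, E) 𝓘(ℝ, E) (fun x : G => g * h * x * (g * h)⁻¹) 1 : E →L[ℝ] E) X =
      (mfderiv 𝓘(ℝ, E) 𝓘(ℝ, E) (fun x : G => g * x * g⁻¹) (h * 1 * h⁻¹) : E →L[ℝ] E)
      ((mfderiv 𝓘(ℝ, E) 𝓘(ℝ, E) (fun x : G => h * x * h⁻¹) 1 : E →L[ℝ] E) X) := h5
  rw [aux1 _ (by simp)] at h6
  exact h6

theorem Ad_comp_inv (g : G) (X : LieAlg E G) : Ad g (Ad g⁻¹ X) = X := by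
  have := Ad_mul (E := E) g g⁻¹
  rw [mul_inv_cancel, Ad_one] at this
  exact (LinearMap.congr_fun this X).symm

theorem Ad_inv_comp (g : G) (X : LieAlg E G) : Ad g⁻¹ (Ad g X) = X := by
  simpa using Ad_comp_inv g⁻¹ X

open VectorField in
theorem mpullback_conj (g : G) (X : LieAlg E G) :
    mpullback 𝓘(ℝ, E) 𝓘(ℝ, E) (fun x : G => g * x * g⁻¹) (mulInvariantVectorField (Ad g X)) =
      mulInvariantVectorField X := by
  ext y
  have hinv : (mfderiv 𝓘(ℝ, E) 𝓘(ℝ, E) (fun x : G => g * x * g⁻¹) y).IsInvertible := by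
    have h1 : (fun x : G => g⁻¹ * x * g⁻¹⁻¹) ∘ (fun x : G => g * x * g⁻¹) = id := by
      ext x; simp [mul_assoc]
    have h1' : (fun x : G => g * x * g⁻¹) ∘ (fun x : G => g⁻¹ * x * g⁻¹⁻¹) = id := by
      ext x; simp [mul_assoc]
    have h2 := mfderiv_comp (I := 𝓘(ℝ, E)) (I' := 𝓘(ℝ, E)) (I'' := 𝓘(ℝ, E)) y
      (g := (fun x : G => g⁻¹ * x * g⁻¹⁻¹)) (f := (fun x => g * x * g⁻¹))
      (mdifferentiableAt_conj g⁻¹ _) (mdifferentiableAt_conj g y)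
    have h3 := mfderiv_comp (I := 𝓘(ℝ, E)) (I' := 𝓘(ℝ, E)) (I'' := 𝓘(ℝ, E)) (g * y * g⁻¹)
      (f := (fun x : G => g⁻¹ * x * g⁻¹⁻¹)) (g := (fun x => g * x * g⁻¹))
      (mdifferentiableAt_conj g _) (mdifferentiableAt_conj g⁻¹ (g * y * g⁻¹))
    rw [h1, mfderiv_id] at h2
    rw [h1', mfderiv_id] at h3
    have e : g⁻¹ * (g * y * g⁻¹) * g⁻¹⁻¹ = y := by simp [mul_assoc]
    have aux1 : ∀ z, z = y →
        (mfderiv 𝓘(ℝ, E) 𝓘(ℝ, E) (fun x : G => g * x * g⁻¹) z : E →L[ℝ] E) =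
          mfderiv 𝓘(ℝ, E) 𝓘(ℝ, E) (fun x : G => g * x * g⁻¹) y := by rintro _ rfl; rfl
    let A : E →L[ℝ] E := mfderiv 𝓘(ℝ, E) 𝓘(ℝ, E) (fun x : G => g * x * g⁻¹) y
    let B : E →L[ℝ] E := mfderiv 𝓘(ℝ, E) 𝓘(ℝ, E) (fun x : G => g⁻¹ * x * g⁻¹⁻¹) (g * y * g⁻¹)
    have hBA : B.comp A = ContinuousLinearMap.id ℝ E := h2.symm
    have hAB : A.comp B = ContinuousLinearMap.id ℝ E := by
      have : ContinuousLinearMap.id ℝ E = ContinuousLinearMap.comp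
        (mfderiv 𝓘(ℝ, E) 𝓘(ℝ, E) (fun x : G => g * x * g⁻¹)
          (g⁻¹ * (g * y * g⁻¹) * g⁻¹⁻¹) : E →L[ℝ] E) B := h3
      rw [aux1 _ e] at this
      exact this.symm
    exact ⟨ContinuousLinearEquiv.equivOfInverse A B
      (fun v => congrArg (fun T : E →L[ℝ] E => T v) hBA)
      (fun v => congrArg (fun T : E →L[ℝ] E => T v) hAB), rfl⟩
  rw [mpullback_apply, ← mfderiv_conj_mulInvariant]
  exact hinv.inverse_apply_self _

variable (E) in
/-- The Lie algebra of a closed subgroup `K`: the vectors `X` such that `exp(t X) ∈ K` for all `t`.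
Here `t ↦ exp(t X)` is the integral curve through `1` of the left-invariant field of `X`. -/
def lieAlgebraOf (K : Subgroup G) : Set (LieAlg E G) :=
  {X | ∃ γ : ℝ → G, γ 0 = 1 ∧
    IsMIntegralCurve γ (mulInvariantVectorField X : (x : G) → TangentSpace 𝓘(ℝ, E) x) ∧
    ∀ t, γ t ∈ K}

theorem Ad_mem_lieAlgebraOf {K : Subgroup G} {s : G} (hs : s ∈ K) {X : LieAlg E G}
    (hX : X ∈ lieAlgebraOf E K) : Ad s X ∈ lieAlgebraOf E K := by
  obtain ⟨γ, h0, hγ, hK⟩ := hX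
  refine ⟨fun t => s * γ t * s⁻¹, by simp [h0], fun t => ?_,
    fun t => K.mul_mem (K.mul_mem hs (hK t)) (K.inv_mem hs)⟩
  have h := (mdifferentiableAt_conj (E := E) s (γ t)).hasMFDerivAt.comp t (hγ t)
  have e : (ContinuousLinearMap.smulRight (1 : ℝ →L[ℝ] ℝ)
        (mulInvariantVectorField (Ad s X) (s * γ t * s⁻¹) : E) : ℝ →L[ℝ] E) =
      ContinuousLinearMap.comp
        (mfderiv 𝓘(ℝ, E) 𝓘(ℝ, E) (fun x : G => s * x * s⁻¹) (γ t) : E →L[ℝ] E)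
        (ContinuousLinearMap.smulRight (1 : ℝ →L[ℝ] ℝ) (mulInvariantVectorField X (γ t) : E)) := by
    refine ContinuousLinearMap.ext fun r => ?_
    have h' : (mfderiv 𝓘(ℝ, E) 𝓘(ℝ, E) (fun x : G => s * x * s⁻¹) (γ t) : E →L[ℝ] E)
        (mulInvariantVectorField X (γ t) : E) =
        (mulInvariantVectorField (Ad s X) (s * γ t * s⁻¹) : E) :=
      mfderiv_conj_mulInvariant s (γ t) X
    exact (congrArg (fun v : E => r • v) h').symm.trans
      (map_smul (mfderiv 𝓘(ℝ, E) 𝓘(ℝ, E) (fun x : G => s * x * s⁻¹) (γ t) : E →L[ℝ] E) r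
        (mulInvariantVectorField X (γ t) : E)).symm
  exact e ▸ h

variable [CompleteSpace E]

open VectorField in
theorem Ad_lie (g : G) (X Y : LieAlg E G) : Ad g ⁅X, Y⁆ = ⁅Ad g X, Ad g Y⁆ := by
  have h := mpullback_mlieBracket (I := 𝓘(ℝ, E)) (I' := 𝓘(ℝ, E)) (n := ∞) (x₀ := (1 : G))
    (f := fun x : G => g * x * g⁻¹)
    (V := mulInvariantVectorField (Ad g X)) (W := mulInvariantVectorField (Ad g Y))
    (mdifferentiableAt_mulInvariantVectorField _) (mdifferentiableAt_mulInvariantVectorField _)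
    (contMDiff_conj g).contMDiffAt
    (by rw [minSmoothness_of_isRCLikeNormedField]; exact ENat.LEInfty.out)
  rw [mpullback_conj, mpullback_conj, ← mulInvariantVector_mlieBracket,
    ← GroupLieAlgebra.bracket_def, ← GroupLieAlgebra.bracket_def,
    ← Ad_comp_inv g ⁅Ad g X, Ad g Y⁆, mpullback_conj, mulInvariant_one] at h
  rw [← h, Ad_comp_inv]

/-- `Ad_g` as an automorphism of the Lie algebra. -/
def AdEquiv (g : G) : LieAlg E G ≃ₗ⁅ℝ⁆ LieAlg E G where
  toFun := Ad g
  map_add' := map_add _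
  map_smul' := map_smul _
  map_lie' := Ad_lie g _ _
  invFun := Ad g⁻¹
  left_inv := Ad_inv_comp g
  right_inv := Ad_comp_inv g

theorem killingForm_Ad (g : G) (X Y : LieAlg E G) :
    killingForm ℝ (LieAlg E G) (Ad g X) (Ad g Y) = killingForm ℝ (LieAlg E G) X Y :=
  LieAlgebra.killingForm_of_equiv_apply (AdEquiv g) X Y

variable (E) in
/-- The orthogonal complement `𝔪` of the Lie algebra of `K` for the Killing form. -/
def tangentSubspace (K : Subgroup G) : Submodule ℝ (LieAlg E G) where
  carrier := {Y | ∀ X ∈ lieAlgebraOf E K, killingForm ℝ (LieAlg E G) X Y = 0}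
  add_mem' hY hZ X hX := by rw [map_add, hY X hX, hZ X hX, add_zero]
  zero_mem' X _ := map_zero _
  smul_mem' c Y hY X hX := by rw [map_smul, hY X hX, smul_zero]

theorem Ad_mem_tangentSubspace {K : Subgroup G} {s : G} (hs : s ∈ K) {Y : LieAlg E G}
    (hY : Y ∈ tangentSubspace E K) : Ad s Y ∈ tangentSubspace E K := by
  intro X hX
  rw [← Ad_comp_inv s X, killingForm_Ad]
  exact hY _ (Ad_mem_lieAlgebraOf (K.inv_mem hs) hX)

variable (E) in
/-- The space `𝔪`, which is the tangent space of `G / K` at the coset `K`, as a normed space. The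
norm is that of the model space `E`; only its topology matters. -/
def TangentModel (K : Subgroup G) : Type _ := tangentSubspace E K

instance (K : Subgroup G) : AddCommGroup (TangentModel E K) :=
  inferInstanceAs (AddCommGroup (tangentSubspace E K))

instance (K : Subgroup G) : Module ℝ (TangentModel E K) :=
  inferInstanceAs (Module ℝ (tangentSubspace E K))

/-- The inclusion of `𝔪` in the Lie algebra. -/
def incl (K : Subgroup G) : TangentModel E K →ₗ[ℝ] LieAlg E G := (tangentSubspace E K).subtype

/-- The inclusion of `𝔪` in the model space. -/
def inclModel (K : Subgroup G) : TangentModel E K →ₗ[ℝ] E := incl K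

instance (K : Subgroup G) : NormedAddCommGroup (TangentModel E K) :=
  NormedAddCommGroup.induced (TangentModel E K) E (inclModel K) Subtype.val_injective

instance (K : Subgroup G) : NormedSpace ℝ (TangentModel E K) :=
  NormedSpace.induced ℝ (TangentModel E K) E (inclModel K)

instance (K : Subgroup G) [FiniteDimensional ℝ E] : FiniteDimensional ℝ (TangentModel E K) :=
  Module.Finite.of_injective (inclModel K) Subtype.val_injective

/-- The action of `K` on `𝔪` by the restriction of `Ad`. -/
def AdM {K : Subgroup G} (s : K) : TangentModel E K →ₗ[ℝ] TangentModel E K :=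
  (Ad (s : G)).restrict fun _ hY => Ad_mem_tangentSubspace s.2 hY

end AdjointRepresentation

/-! ## Homogeneous almost-Hermitian spaces -/

/-- A homogeneous almost-Hermitian structure on `G / K`: an inner product `g₀` and an orthogonal
complex structure `J` on `𝔪`, both invariant for the action of `K`. -/
structure AlmostHermitian (E : Type*) [NormedAddCommGroup E] [NormedSpace ℝ E] [CompleteSpace E]
    {G : Type*} [TopologicalSpace G] [ChartedSpace E G] [Group G] [LieGroup 𝓘(ℝ, E) ∞ G]
    (K : Subgroup G) extends HermitianStructure (TangentModel E K) where
  g₀_Ad : ∀ (s : K) (X Y : TangentModel E K), g₀ (AdM s X) (AdM s Y) = g₀ X Y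
  J_Ad : ∀ (s : K) (X : TangentModel E K), AdM s (J X) = J (AdM s X)

section HomogeneousSpace

variable {E : Type*} [NormedAddCommGroup E] [NormedSpace ℝ E] [CompleteSpace E]
  {G : Type*} [TopologicalSpace G] [ChartedSpace E G] [Group G] [LieGroup 𝓘(ℝ, E) ∞ G]
  {K : Subgroup G}

variable (E K) in
/-- The algebra `A` of smooth real functions on `G / K`, viewed as functions on `G`. -/
def FunctionAlgebra : Subalgebra ℝ (G → ℝ) where
  carrier := {f | ContMDiff 𝓘(ℝ, E) 𝓘(ℝ, ℝ) ∞ f ∧ ∀ (x : G) (s : K), f (x * s) = f x}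
  mul_mem' hf hg := ⟨hf.1.mul hg.1, fun x s => by simp [hf.2, hg.2]⟩
  add_mem' hf hg := ⟨hf.1.add hg.1, fun x s => by simp [hf.2, hg.2]⟩
  algebraMap_mem' r := ⟨contMDiff_const, fun _ _ => rfl⟩

variable (E K) in
/-- The `A`-module `T(G/K)` of smooth vector fields on `G / K`: the smooth functions
`V : G → 𝔪` with `V(x s) = Ad_s⁻¹ (V(x))` for `s ∈ K`. -/
def TangentModule : Submodule (FunctionAlgebra E K) (G → TangentModel E K) where
  carrier := {V | ContMDiff 𝓘(ℝ, E) 𝓘(ℝ, TangentModel E K) ∞ V ∧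
    ∀ (x : G) (s : K), V (x * s) = AdM s⁻¹ (V x)}
  add_mem' hV hW := ⟨hV.1.add hW.1, fun x s => by simp [hV.2, hW.2]⟩
  zero_mem' := ⟨contMDiff_const, fun _ _ => by simp⟩
  smul_mem' f V hV := ⟨f.2.1.smul hV.1, fun x s =>
    show f.1 (x * s) • V (x * s) = AdM s⁻¹ (f.1 x • V x) by rw [f.2.2, hV.2, map_smul]⟩

instance : CoeFun (TangentModule E K) fun _ => G → TangentModel E K := ⟨Subtype.val⟩

instance instModuleTangentModule : Module (FunctionAlgebra E K) (TangentModule E K) :=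
  (TangentModule E K).module

instance instSMulTangentModule : SMul (FunctionAlgebra E K) (TangentModule E K) :=
  instModuleTangentModule.toDistribMulAction.toMulAction.toSMul

theorem smul_tangent_apply (f : FunctionAlgebra E K) (V : TangentModule E K) (x : G) :
    (f • V) x = f.1 x • V x := rfl

/-- The derivative `(∂_V f)(x)`, that is, the derivative at `t = 0` of `f(x exp(t V(x)))`, of a
function on `G` with values in a normed space: the derivative of `f` at `x` along the value at `x`
of the left-invariant vector field of `V(x)`. For real-valued `f` this is the derivation of `A`
given by `V`; for sections of an induced bundle it is the canonical connection. -/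
def along {F : Type*} [NormedAddCommGroup F] [NormedSpace ℝ F]
    (V : TangentModule E K) (f : G → F) (x : G) : F :=
  mfderiv 𝓘(ℝ, E) 𝓘(ℝ, F) f x (mulInvariantVectorField (incl K (V x)) x)

/-- The action of `G` on vector fields by translation. -/
def translateField (y : G) (V : TangentModule E K) : TangentModule E K :=
  ⟨fun x => V (y⁻¹ * x), V.2.1.comp contMDiff_mul_left, fun x s =>
    show V (y⁻¹ * (x * s)) = AdM s⁻¹ (V (y⁻¹ * x)) by rw [← mul_assoc]; exact V.2.2 _ s⟩

/-- The complex structure on vector fields. -/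
def AlmostHermitian.mapJ [FiniteDimensional ℝ E] (h : AlmostHermitian E K)
    (V : TangentModule E K) : TangentModule E K :=
  ⟨fun x => h.J (V x), (LinearMap.toContinuousLinearMap h.J).contMDiff.comp V.2.1,
    fun x s => show h.J (V (x * s)) = AdM s⁻¹ (h.J (V x)) by rw [V.2.2 x s, h.J_Ad]⟩

/-! ### Connections and torsion -/

variable (E K) in
/-- A connection on the `A`-module `T(G/K)`. -/
structure Connection where
  toFun : TangentModule E K → TangentModule E K → TangentModule E K
  add_left : ∀ V V' W, toFun (V + V') W = toFun V W + toFun V' W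
  smul_left : ∀ (f : FunctionAlgebra E K) (V W : TangentModule E K),
    toFun (f • V) W = f • toFun V W
  add_right : ∀ V W W', toFun V (W + W') = toFun V W + toFun V W'
  leibniz : ∀ (V : TangentModule E K) (f : FunctionAlgebra E K) (W : TangentModule E K) (x : G),
    toFun V (f • W) x = f.1 x • toFun V W x + along V f.1 x • W x

namespace Connection

instance : CoeFun (Connection E K)
    fun _ => TangentModule E K → TangentModule E K → TangentModule E K := ⟨toFun⟩

variable (D : Connection E K)

/-- Invariance under the action of `G` by translation. -/
def IsInvariant : Prop :=
  ∀ (y : G) (V W : TangentModule E K),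
    translateField y (D V W) = D (translateField y V) (translateField y W)

/-- Compatibility with the Riemannian metric `g₀`. -/
def IsCompatible (h : AlmostHermitian E K) : Prop :=
  ∀ (U V W : TangentModule E K) (x : G),
    along U (fun y => h.g₀ (V y) (W y)) x = h.g₀ (D U V x) (W x) + h.g₀ (V x) (D U W x)

/-- Each `∇_V` commutes with `J`. -/
def CommutesWithJ [FiniteDimensional ℝ E] (h : AlmostHermitian E K) : Prop :=
  ∀ V W : TangentModule E K, D V (h.mapJ W) = h.mapJ (D V W)

end Connection

/-- `Z` represents the commutator of the derivations of `A` given by `V` and `W`. -/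
def IsBracket (V W Z : TangentModule E K) : Prop :=
  ∀ (f : FunctionAlgebra E K) (x : G),
    along Z f.1 x = along V (along W f.1) x - along W (along V f.1) x

/-- The Lie bracket of vector fields: the (unique) vector field that represents the commutator of
the derivations of `A` given by `V` and `W`. -/
def bracket (V W : TangentModule E K) : TangentModule E K := Classical.epsilon (IsBracket V W)

/-- The torsion `T_∇(V, W) = ∇_V W - ∇_W V - [V, W]`. -/
def Connection.torsion (D : Connection E K) (V W : TangentModule E K) : TangentModule E K :=
  D V W - D W V - bracket V W

namespace AlmostHermitian

variable (h : AlmostHermitian E K)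

/-- Standard module frames for `T(G/K)` and `g₀`. -/
def IsStandardFrame {n : ℕ} (W : Fin n → TangentModule E K) : Prop :=
  ∀ (V : TangentModule E K) (x : G), V x = ∑ j, h.g₀ (W j x) (V x) • W j x

/-- The trace of `T_∇^U = T_∇(U, ·)`, computed by means of a standard module frame. -/
def traceTorsion (D : Connection E K) {n : ℕ} (W : Fin n → TangentModule E K)
    (U : TangentModule E K) (x : G) : ℝ := ∑ j, h.g₀ (D.torsion U (W j) x) (W j x)

/-! ### The Dirac operator -/

/-- `L` is the endomorphism by which `∇_V - ∇^c_V` acts at `x`, where `∇^c` is the canonical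
connection on `T(G/K)`. -/
def IsConnectionForm (D : Connection E K) (V : TangentModule E K) (x : G)
    (L : h.MJ →ₗ[ℂ] h.MJ) : Prop :=
  ∀ W : TangentModule E K, h.toJ (D V W x - along V W x) = L (h.toJ (W x))

/-- The (unique) endomorphism `L_V(x)` of `𝔪_J` with
`(∇_V W - ∇^c_V W)(x) = L_V(x) (W(x))` for all `W`. -/
def connectionForm (D : Connection E K) (V : TangentModule E K) (x : G) : h.MJ →ₗ[ℂ] h.MJ :=
  Classical.epsilon (h.IsConnectionForm D V x)

/-- The action of `K` on spinors by exterior-algebra automorphisms. -/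
def spinAction (s : K) : h.Spinor →ₐ[ℂ] h.Spinor := h.mapExt (h.liftJ (AdM s) (h.J_Ad s))

variable [FiniteDimensional ℝ E]

/-- The module `S(G/K, χ)` of smooth functions `ψ : G → S` such that
`ψ(x s) = conj(χ(s)) Ad_s⁻¹ (ψ(x))` for `s ∈ K`. -/
def SpinorModule (χ : K →ₜ* Circle) : Submodule ℂ (G → h.Spinor) where
  carrier := {ψ | ContMDiff 𝓘(ℝ, E) 𝓘(ℝ, h.Spinor) ∞ ψ ∧
    ∀ (x : G) (s : K), ψ (x * s) = starRingEnd ℂ (χ s) • h.spinAction s⁻¹ (ψ x)}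
  add_mem' hψ hφ := ⟨hψ.1.add hφ.1, fun x s => by simp [hψ.2, hφ.2]⟩
  zero_mem' := ⟨contMDiff_const, fun _ _ => by simp⟩
  smul_mem' z ψ hψ := by
    refine ⟨?_, fun x s => ?_⟩
    · exact (z • ContinuousLinearMap.id ℝ h.Spinor).contMDiff.comp hψ.1
    · simp only [Pi.smul_apply, hψ.2, map_smul]; rw [smul_comm]

/-- The connection `∇^S_V = ∇^c_V + L^S_V` on spinor fields, where `L^S_V(x)` is the derivation of
the exterior algebra that extends `L_V(x)`. -/
def spinConnection (D : Connection E K) (V : TangentModule E K) (ψ : G → h.Spinor) (x : G) :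
    h.Spinor :=
  along V ψ x + h.derivationExt (h.connectionForm D V x) (ψ x)

/-- The Dirac operator `D^∇ ψ = ∑_j κ(W_j) (∇^S_{W_j} ψ)`, computed by means of a standard module
frame `W`. -/
def dirac (D : Connection E K) {n : ℕ} (W : Fin n → TangentModule E K) (ψ : G → h.Spinor)
    (x : G) : h.Spinor :=
  ∑ j, h.kappa (h.cliffordVec (W j x)) (h.spinConnection D (W j) ψ x)

/-- An operator on spinor fields is formally self-adjoint on `S(G/K, χ)` for the inner product
`∫_G ⟨ψ(x), φ(x)⟩ dμ(x)`. -/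
def FormallySelfAdjoint [MeasurableSpace G] (μ : MeasureTheory.Measure G) (χ : K →ₜ* Circle)
    (T : (G → h.Spinor) → G → h.Spinor) : Prop :=
  ∀ ψ ∈ h.SpinorModule χ, ∀ φ ∈ h.SpinorModule χ,
    ∫ x, h.innerS (T ψ x) (φ x) ∂μ = ∫ x, h.innerS (ψ x) (T φ x) ∂μ

end AlmostHermitian

end HomogeneousSpace

end HomDirac

end

open HomDirac

noncomputable section

namespace HomDirac

/-! ## Algebra of the Fock space -/

namespace HermitianStructure

variable {M : Type*} [AddCommGroup M] [Module ℝ M] (h : HermitianStructure M)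

/-! Everything is computed on `G`, with left-invariant fields. An invariant connection differs from
the canonical one by a constant tensor `Λ : 𝔪 → 𝔪 → 𝔪`: the Leibniz terms cancel, so the difference
is tensorial, and translation invariance makes it independent of the point
(`exists_connectionTensor`). Compatibility makes each `Λ X` skew for `g₀`, and commutation with `J`
makes it complex linear. The Dirac operator is a sum of a bilinear expression over a frame. Such a
sum is the same for all frames of `𝔪`, so at every point the frame may be replaced by one constant
family `u`, and the operator becomes `∑ κ(u_j) (u_j + Λ^S(u_j))`, where `u_j` differentiates along a
left-invariant field (`dirac_eq_constDirac`).

Now `κ(X)` and `Λ^S(X)` are skew-adjoint, `[Λ^S(X), κ(X)] = κ(Λ X X)`, and derivatives along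
left-invariant fields integrate to zero. Hence the defect of self-adjointness is `∫ ⟨ψ, κ(τ) φ⟩`
with `τ = ∑ Λ(u_j) u_j` (`integral_constDirac`). On the other side the torsion is `Λ U V - Λ V U -
[U, V]_𝔪`. The trace over `V` of the first term vanishes by skewness, that of the bracket by
invariance of the Killing form, and the middle term contributes `g₀(U, τ)` (`traceTorsion_eq`). So
both conditions should mean `τ = 0`.

The one point left is that a vanishing defect forces `τ = 0`. The vector `τ` is fixed by `K`, so
`κ(τ)` preserves the spinor module. Averaging a bump function over `K` gives a function `c` of the
type prescribed by `χ` with `c 1 ≠ 0`; for `φ = c · 1` and `ψ = κ(τ) φ` the defect is `g₀(τ, τ) ∫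
|c|²` (`eq_zero_of_integral_eq_zero`).

The remaining work is the geometry behind this: the Killing form is negative definite (by an
averaged inner product), which gives `𝔤 = 𝔨 ⊕ 𝔪`, the existence of frames, and the formula for the
bracket of vector fields. -/

theorem g₀_J_left (X Y : M) : h.g₀ (h.J X) Y = -h.g₀ X (h.J Y) := by
  rw [← h.J_orth X, h.J_sq, map_neg, neg_neg]

theorem hermForm_apply (X Y : M) :
    h.hermForm X (h.toJ Y) = (h.g₀ X Y : ℂ) + Complex.I * (h.g₀ (h.J X) Y : ℂ) := rfl

theorem hermForm_conj (X Y : M) :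
    starRingEnd ℂ (h.hermForm X (h.toJ Y)) = h.hermForm Y (h.toJ X) := by
  rw [hermForm_apply, hermForm_apply, h.g₀_symm Y X, h.g₀_J_left Y X, h.g₀_symm Y (h.J X)]
  simp

/-- Induction for spinors: a property that is additive and passes to scalar multiples and to
products with a vector holds for all spinors if it holds for `1`. -/
theorem spinor_induction {p : h.Spinor → Prop} (one : p 1)
    (ι_mul : ∀ (X : M) η, p η → p (h.ι (h.toJ X) * η)) (add : ∀ η θ, p η → p θ → p (η + θ))
    (smul : ∀ (z : ℂ) η, p η → p (z • η)) (η : h.Spinor) : p η := by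
  -- The induction principle of the exterior algebra has a case for products, which `p` itself need
  -- not satisfy. Stability of `p` under left multiplication by `η` does pass to products.
  have key : ∀ η : h.Spinor, ∀ θ, p θ → p (η * θ) := by
    intro η
    refine ExteriorAlgebra.induction (C := fun η : h.Spinor => ∀ θ, p θ → p (η * θ))
      (fun r θ hθ => ?_) (fun X θ hθ => ?_) (fun a b ha hb θ hθ => ?_)
      (fun a b ha hb θ hθ => ?_) η
    · have := smul r θ hθ
      rwa [Algebra.smul_def] at this
    · exact ι_mul (h.toJ.symm X) θ hθ
    · have := ha _ (hb _ hθ)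
      exact (mul_assoc (G := h.Spinor) a b θ) ▸ this
    · have := add _ _ (ha _ hθ) (hb _ hθ)
      exact (add_mul (R := h.Spinor) a b θ) ▸ this
  simpa using key η 1 one

theorem innerS_add_right (φ ψ θ : h.Spinor) :
    h.innerS φ (ψ + θ) = h.innerS φ ψ + h.innerS φ θ := by
  simp [innerS]

theorem innerS_add_left (φ ψ θ : h.Spinor) :
    h.innerS (φ + ψ) θ = h.innerS φ θ + h.innerS ψ θ := by
  simp only [innerS, map_add]
  exact map_add h.scalarPart _ _

theorem innerS_smul_left (z : ℂ) (φ ψ : h.Spinor) :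
    h.innerS (z • φ) ψ = starRingEnd ℂ z * h.innerS φ ψ := by
  simp only [innerS, map_smul]
  exact map_smul h.scalarPart (starRingEnd ℂ z) _

/-- Creation and annihilation operators are adjoint to each other, on the other side. -/
theorem innerS_ι_mul_right (X : M) (φ ψ : h.Spinor) :
    h.innerS φ (h.ι (h.toJ X) * ψ) = h.innerS (h.annihilation X φ) ψ := by
  induction φ using h.spinor_induction generalizing ψ with
  | one => rw [innerS_one, scalarPart_ι_mul, annihilation_one, innerS, map_zero]
           exact (map_zero h.scalarPart).symm
  | ι_mul Y η ih =>
    rw [innerS_ι_mul, annihilation_ι_mul, annihilation_ι_mul, sub_eq_add_neg, sub_eq_add_neg,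
      innerS_add_right, innerS_add_left, ← neg_one_smul ℂ (_ * _),
      ← neg_one_smul ℂ (h.ι (h.toJ Y) * _), innerS_smul_right, innerS_smul_left,
      innerS_smul_right, innerS_smul_left, ih, innerS_ι_mul, hermForm_conj]
    simp
  | add η θ hη hθ => rw [innerS_add_left, hη, hθ, map_add, innerS_add_left]
  | smul z η hη => rw [innerS_smul_left, hη, map_smul, innerS_smul_left]

/-- Clifford multiplication by a vector is skew-adjoint. -/
theorem innerS_kappaVec (X : M) (φ ψ : h.Spinor) :
    h.innerS (h.kappaVec X φ) ψ = -h.innerS φ (h.kappaVec X ψ) := by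
  have e : ∀ η, h.kappaVec X η = Complex.I • (h.annihilation X η + h.ι (h.toJ X) * η) :=
    fun _ => rfl
  rw [e, e, innerS_smul_left, innerS_smul_right, innerS_add_left, innerS_add_right,
    innerS_ι_mul, innerS_ι_mul_right, Complex.conj_I]
  ring

theorem derivationExt_one (L : h.MJ →ₗ[ℂ] h.MJ) : h.derivationExt L 1 = 0 := by
  simpa using h.derivationExt_mul L 1 1

/-- The derivation preserves the degree and kills the scalars. -/
theorem scalarPart_derivationExt (L : h.MJ →ₗ[ℂ] h.MJ) (η : h.Spinor) :
    h.scalarPart (h.derivationExt L η) = 0 := by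
  induction η using h.spinor_induction with
  | one => rw [derivationExt_one, map_zero]
  | ι_mul Y η ih =>
    rw [derivationExt_mul, derivationExt_ι, map_add, scalarPart_ι_mul, scalarPart_ι_mul, add_zero]
  | add η θ hη hθ => rw [map_add, map_add, hη, hθ, add_zero]
  | smul z η hη => rw [map_smul, map_smul, hη, smul_zero]

variable {h} in
/-- A complex endomorphism of `M_J` that is skew for `g₀`. -/
def IsSkew (L : h.MJ →ₗ[ℂ] h.MJ) : Prop :=
  ∀ X Y : M, h.hermForm (h.toJ.symm (L (h.toJ X))) (h.toJ Y) = -h.hermForm X (L (h.toJ Y))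

/-- A derivation acts on the functional `⟨X, ·⟩` by minus the transpose of `L`, and skewness turns
this into the functional of `L X`. -/
theorem derivationExt_annihilation {L : h.MJ →ₗ[ℂ] h.MJ} (hL : IsSkew L) (X : M) (η : h.Spinor) :
    h.derivationExt L (h.annihilation X η) =
      h.annihilation X (h.derivationExt L η) + h.annihilation (h.toJ.symm (L (h.toJ X))) η := by
  induction η using h.spinor_induction with
  | one => simp [annihilation_one, derivationExt_one]
  | ι_mul Y η ih =>
    simp only [annihilation_ι_mul, derivationExt_mul, derivationExt_ι, map_add, map_sub, map_smul,
      ih, hL X Y]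
    rw [mul_add, neg_smul]
    abel
  | add η θ hη hθ => simp only [map_add, hη, hθ]; abel
  | smul z η hη => simp only [map_smul, hη, smul_add]

/-- `[L^S, κ(X)] = κ(L X)`. -/
theorem derivationExt_kappaVec {L : h.MJ →ₗ[ℂ] h.MJ} (hL : IsSkew L) (X : M) (η : h.Spinor) :
    h.derivationExt L (h.kappaVec X η) =
      h.kappaVec X (h.derivationExt L η) + h.kappaVec (h.toJ.symm (L (h.toJ X))) η := by
  have e : ∀ X η, h.kappaVec X η = Complex.I • (h.annihilation X η + h.ι (h.toJ X) * η) :=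
    fun _ _ => rfl
  rw [e, e, e, map_smul, map_add, h.derivationExt_annihilation hL, derivationExt_mul,
    derivationExt_ι, AddEquiv.apply_symm_apply]
  module

/-- Each vector peeled off `φ` becomes an annihilation operator on `ψ`, and the commutator of that
operator with the derivation accounts for the term in which `L` hits the vector. -/
theorem innerS_derivationExt {L : h.MJ →ₗ[ℂ] h.MJ} (hL : IsSkew L) (φ ψ : h.Spinor) :
    h.innerS (h.derivationExt L φ) ψ = -h.innerS φ (h.derivationExt L ψ) := by
  induction φ using h.spinor_induction generalizing ψ with
  | one => rw [derivationExt_one, innerS_one, scalarPart_derivationExt, innerS, map_zero]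
           exact (map_zero h.scalarPart).trans neg_zero.symm
  | ι_mul X η ih =>
    have := h.derivationExt_annihilation hL X ψ
    rw [derivationExt_mul, derivationExt_ι, innerS_add_left, innerS_ι_mul, innerS_ι_mul, ih,
      this, innerS_add_right, ← h.toJ.apply_symm_apply (L (h.toJ X)), innerS_ι_mul]
    simp
  | add η θ hη hθ => simp only [map_add, innerS_add_left, hη, hθ]; ring
  | smul z η hη => rw [map_smul, innerS_smul_left, hη, innerS_smul_left]; ring

/-- A real endomorphism that is skew for `g₀` is skew for the complex inner product. -/
theorem isSkew_of_g₀ (L : h.MJ →ₗ[ℂ] h.MJ)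
    (hL : ∀ X Y, h.g₀ (h.toJ.symm (L (h.toJ X))) Y = -h.g₀ X (h.toJ.symm (L (h.toJ Y)))) :
    IsSkew L := by
  intro X Y
  have hJ : ∀ X, h.toJ (h.J X) = Complex.I • h.toJ X := fun X => by simp [smul_toJ]
  obtain ⟨Z, hZ⟩ := h.toJ.surjective (L (h.toJ Y))
  obtain ⟨T, hT⟩ := h.toJ.surjective (L (h.toJ X))
  have h1 := hL X Y
  -- The imaginary part of the complex form is `g₀ (J X) Y`, so it is controlled by the hypothesis
  -- at `J X`.
  have h2 := hL (h.J X) Y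
  rw [hJ, map_smul, ← hT, ← hZ, ← hJ] at h2
  rw [← hT, ← hZ] at h1 ⊢
  simp only [AddEquiv.symm_apply_apply] at h1 h2 ⊢
  rw [hermForm_apply, hermForm_apply, h1, h2]
  push_cast; ring

/-- An isometry of `M_J` intertwines Clifford multiplications. -/
theorem mapExt_annihilation (A : h.MJ →ₗ[ℂ] h.MJ)
    (hA : ∀ X Y : M, h.hermForm (h.toJ.symm (A (h.toJ X))) (A (h.toJ Y)) = h.hermForm X (h.toJ Y))
    (X : M) (η : h.Spinor) :
    h.mapExt A (h.annihilation X η) =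
      h.annihilation (h.toJ.symm (A (h.toJ X))) (h.mapExt A η) := by
  have hι : ∀ Y, h.mapExt A (h.ι Y) = h.ι (A Y) := fun Y => ExteriorAlgebra.map_apply_ι A Y
  induction η using h.spinor_induction with
  | one => simp [annihilation_one]
  | ι_mul Y η ih =>
    simp only [annihilation_ι_mul, map_sub, map_smul, map_mul, hι, ih, hA]
  | add η θ hη hθ => simp only [map_add, hη, hθ]
  | smul z η hη => simp only [map_smul, hη]

theorem mapExt_kappaVec (A : h.MJ →ₗ[ℂ] h.MJ)
    (hA : ∀ X Y : M, h.hermForm (h.toJ.symm (A (h.toJ X))) (A (h.toJ Y)) = h.hermForm X (h.toJ Y))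
    (X : M) (η : h.Spinor) :
    h.mapExt A (h.kappaVec X η) = h.kappaVec (h.toJ.symm (A (h.toJ X))) (h.mapExt A η) := by
  have e : ∀ X η, h.kappaVec X η = Complex.I • (h.annihilation X η + h.ι (h.toJ X) * η) :=
    fun _ _ => rfl
  have hι : ∀ Y, h.mapExt A (h.ι Y) = h.ι (A Y) := fun Y => ExteriorAlgebra.map_apply_ι A Y
  rw [e, e, map_smul, map_add, h.mapExt_annihilation A hA, map_mul, hι,
    AddEquiv.apply_symm_apply]

theorem kappa_cliffordVec_eq (X : M) : h.kappa (h.cliffordVec X) = h.kappaVec X :=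
  h.kappa_cliffordVec X

/-- On the vacuum `1`, Clifford multiplication by `X` has square norm `g₀(X, X)`. -/
theorem innerS_kappaVec_vacuum (X : M) :
    h.innerS (h.kappaVec X 1) (h.kappaVec X 1) = (h.g₀ X X : ℂ) := by
  rw [innerS_kappaVec, ← Module.End.mul_apply, kappaVec_sq, Module.algebraMap_end_apply,
    ← Complex.coe_smul, innerS_smul_right, innerS_one, map_one]
  simp [cliffordForm]

end HermitianStructure

/-! ## Orthonormal bases for positive definite forms -/

section Forms

variable {V : Type*} [AddCommGroup V] [Module ℝ V]

/-- The inner product space structure given by a positive definite form. -/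
abbrev innerCore (b : LinearMap.BilinForm ℝ V) (hs : ∀ X Y, b X Y = b Y X)
    (hp : ∀ X, X ≠ 0 → 0 < b X X) : InnerProductSpace.Core ℝ V where
  inner X Y := b X Y
  conj_inner_symm X Y := hs Y X
  re_inner_nonneg X := by
    by_cases hX : X = 0
    · simp [hX]
    · exact (hp X hX).le
  add_left X Y Z := by simp
  smul_left X Y r := by simp
  definite X hX := by
    by_contra h
    exact (hp X h).ne' hX

/-- The inner product structure lives only inside the proof and the conclusion mentions only `b`, so
the result applies to spaces such as `𝔤` and `𝔪` that already carry a norm. -/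
theorem exists_orthonormal_basis_of_pos [FiniteDimensional ℝ V] (b : LinearMap.BilinForm ℝ V)
    (hs : ∀ X Y, b X Y = b Y X) (hp : ∀ X, X ≠ 0 → 0 < b X X) :
    ∃ e : Module.Basis (Fin (Module.finrank ℝ V)) ℝ V,
      ∀ i j, b (e i) (e j) = if i = j then 1 else 0 := by
  let core : InnerProductSpace.Core ℝ V := innerCore b hs hp
  let _ : NormedAddCommGroup V := core.toNormedAddCommGroup
  let _ : InnerProductSpace ℝ V := InnerProductSpace.ofCore _
  refine ⟨(stdOrthonormalBasis ℝ V).toBasis, fun i j => ?_⟩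
  have := orthonormal_iff_ite.1 (stdOrthonormalBasis ℝ V).orthonormal i j
  rw [OrthonormalBasis.coe_toBasis]
  exact this

variable {ι : Type*} [Fintype ι] [DecidableEq ι]

theorem orthonormal_apply_eq_repr {b : LinearMap.BilinForm ℝ V} (e : Module.Basis ι ℝ V)
    (he : ∀ i j, b (e i) (e j) = if i = j then 1 else 0) (i : ι) (X : V) :
    b (e i) X = e.repr X i := by
  conv_lhs => rw [← e.sum_repr X]
  rw [map_sum]
  simp only [map_smul, he, smul_eq_mul, mul_ite, mul_one, mul_zero]
  simp

theorem sum_orthonormal_smul {b : LinearMap.BilinForm ℝ V} (e : Module.Basis ι ℝ V)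
    (he : ∀ i j, b (e i) (e j) = if i = j then 1 else 0) (X : V) :
    ∑ i, b (e i) X • e i = X := by
  simp only [orthonormal_apply_eq_repr e he, e.sum_repr]

theorem trace_eq_sum_orthonormal {b : LinearMap.BilinForm ℝ V} (e : Module.Basis ι ℝ V)
    (he : ∀ i j, b (e i) (e j) = if i = j then 1 else 0) (T : V →ₗ[ℝ] V) :
    LinearMap.trace ℝ V T = ∑ i, b (e i) (T (e i)) := by
  rw [LinearMap.trace_eq_matrix_trace ℝ e, Matrix.trace]
  simp [LinearMap.toMatrix_apply, orthonormal_apply_eq_repr e he]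

end Forms

/-! ## Derivatives of maps of manifolds without boundary -/

section Der

variable {E₁ : Type*} [NormedAddCommGroup E₁] [NormedSpace ℝ E₁]
  {E₂ : Type*} [NormedAddCommGroup E₂] [NormedSpace ℝ E₂]
  {E₃ : Type*} [NormedAddCommGroup E₃] [NormedSpace ℝ E₃]
  {M₁ : Type*} [TopologicalSpace M₁] [ChartedSpace E₁ M₁]
  {M₂ : Type*} [TopologicalSpace M₂] [ChartedSpace E₂ M₂]
  {M₃ : Type*} [TopologicalSpace M₃] [ChartedSpace E₃ M₃]

/-- The derivative of a map of manifolds, as a map of the model spaces. -/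
def der (f : M₁ → M₂) (x : M₁) : E₁ →L[ℝ] E₂ := mfderiv 𝓘(ℝ, E₁) 𝓘(ℝ, E₂) f x

/-- The point `y` is kept apart from `f x` so that the base point can be simplified without
transport between tangent spaces. -/
theorem der_comp {g : M₂ → M₃} {f : M₁ → M₂} {x : M₁} {y : M₂}
    (hg : MDifferentiableAt 𝓘(ℝ, E₂) 𝓘(ℝ, E₃) g y)
    (hf : MDifferentiableAt 𝓘(ℝ, E₁) 𝓘(ℝ, E₂) f x) (hy : f x = y) :
    (der (fun z => g (f z)) x : E₁ →L[ℝ] E₃) =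
      (der g y : E₂ →L[ℝ] E₃).comp (der f x : E₁ →L[ℝ] E₂) := by
  subst hy; exact mfderiv_comp x hg hf

theorem der_eq_fderiv (f : E₁ → E₂) (x : E₁) : (der f x : E₁ →L[ℝ] E₂) = fderiv ℝ f x :=
  mfderiv_eq_fderiv

theorem hasDerivAt_comp_curve {f : M₁ → E₂} {γ : ℝ → M₁} {t : ℝ} {v : E₁}
    (hf : MDifferentiableAt 𝓘(ℝ, E₁) 𝓘(ℝ, E₂) f (γ t))
    (hγ : MDifferentiableAt 𝓘(ℝ, ℝ) 𝓘(ℝ, E₁) γ t) (hv : (der γ t : ℝ →L[ℝ] E₁) 1 = v) :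
    HasDerivAt (fun t => f (γ t)) ((der f (γ t) : E₁ →L[ℝ] E₂) v) t := by
  have h : HasFDerivAt (fun t => f (γ t)) (der (fun t => f (γ t)) t : ℝ →L[ℝ] E₂) t :=
    (hf.comp t hγ).hasMFDerivAt.hasFDerivAt
  rw [der_comp hf hγ rfl] at h
  simpa [hv] using h.hasDerivAt

end Der

/-! ## Derivatives along left-invariant vector fields -/

section LieDerivative

variable {E : Type*} [NormedAddCommGroup E] [NormedSpace ℝ E]
  {G : Type*} [TopologicalSpace G] [ChartedSpace E G] [Group G]
  {F : Type*} [NormedAddCommGroup F] [NormedSpace ℝ F]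
  {F' : Type*} [NormedAddCommGroup F'] [NormedSpace ℝ F']

/-- The left-invariant vector field of `X`, with values in the model space. -/
def leftField (X : LieAlg E G) (x : G) : E := mulInvariantVectorField X x

variable (E G) in
/-- The identity map of the Lie algebra to the model space. -/
def toModel : LieAlg E G ≃L[ℝ] E := ContinuousLinearEquiv.refl ℝ E

/-- The derivative of a function along the left-invariant vector field of `X`. -/
def lieDeriv (X : LieAlg E G) (f : G → F) (x : G) : F :=
  (der f x : E →L[ℝ] F) (leftField X x)

theorem leftField_add (X Y : LieAlg E G) (x : G) :
    leftField (X + Y) x =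
      leftField X x + leftField Y x :=
  map_add (der (fun y : G => x * y) 1 : E →L[ℝ] E) (toModel E G X) (toModel E G Y)

theorem leftField_smul (r : ℝ) (X : LieAlg E G) (x : G) :
    leftField (r • X) x = r • leftField X x :=
  map_smul (der (fun y : G => x * y) 1 : E →L[ℝ] E) r (toModel E G X)

/-- `lieDeriv` as a linear function of the vector. -/
def lieDerivₗ (f : G → F) (x : G) : LieAlg E G →ₗ[ℝ] F where
  toFun X := lieDeriv X f x
  map_add' X Y := by
    simp only [lieDeriv, leftField_add]; exact map_add _ _ _
  map_smul' r X := by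
    simp only [lieDeriv, leftField_smul]; exact map_smul _ _ _

theorem lieDerivₗ_apply (f : G → F) (x : G) (X : LieAlg E G) :
    lieDerivₗ f x X = lieDeriv X f x := rfl

theorem lieDeriv_add_left (X Y : LieAlg E G) (f : G → F) (x : G) :
    lieDeriv (X + Y) f x = lieDeriv X f x + lieDeriv Y f x := map_add (lieDerivₗ f x) X Y

theorem lieDeriv_sub_left (X Y : LieAlg E G) (f : G → F) (x : G) :
    lieDeriv (X - Y) f x = lieDeriv X f x - lieDeriv Y f x := map_sub (lieDerivₗ f x) X Y

variable [LieGroup 𝓘(ℝ, E) ∞ G]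

/-- Differentiate `(g y) x = g (y x)` at `x = 1`. -/
theorem der_lmul_leftField (g y : G) (X : LieAlg E G) :
    (der (fun x : G => g * x) y : E →L[ℝ] E)
      (leftField X y) = leftField X (g * y) := by
  have h1 : (fun x : G => g * y * x) = (fun x : G => g * (y * x)) := by
    ext x; simp [mul_assoc]
  have h2 := der_comp (E₁ := E) (E₂ := E) (E₃ := E) (mdifferentiableAt_lmul g y)
    (mdifferentiableAt_lmul y 1) (mul_one y)
  have h3 := congrArg (fun T : E →L[ℝ] E => T (toModel E G X)) h2
  rw [← h1] at h3
  exact h3.symm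

theorem isMIntegralCurveOn_lmul {X : LieAlg E G} {γ : ℝ → G} {s : Set ℝ} (x : G)
    (hγ : IsMIntegralCurveOn γ
      (mulInvariantVectorField X : (x : G) → TangentSpace 𝓘(ℝ, E) x) s) :
    IsMIntegralCurveOn (fun t => x * γ t)
      (mulInvariantVectorField X : (x : G) → TangentSpace 𝓘(ℝ, E) x) s := by
  intro t ht
  have h := (mdifferentiableAt_lmul (E := E) x (γ t)).hasMFDerivAt.comp_hasMFDerivWithinAt t
    (hγ t ht)
  have e : (ContinuousLinearMap.smulRight (1 : ℝ →L[ℝ] ℝ)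
        (leftField X (x * γ t)) : ℝ →L[ℝ] E) =
      ContinuousLinearMap.comp (der (fun y : G => x * y) (γ t) : E →L[ℝ] E)
        (ContinuousLinearMap.smulRight (1 : ℝ →L[ℝ] ℝ) (leftField X (γ t))) := by
    refine ContinuousLinearMap.ext fun r => ?_
    exact (congrArg (fun v : E => r • v) (der_lmul_leftField x (γ t) X)).symm.trans
      (map_smul (der (fun y : G => x * y) (γ t) : E →L[ℝ] E) r
        (leftField X (γ t))).symm
  exact e ▸ h

theorem contMDiff_one_mulInvariant [CompleteSpace E] (X : LieAlg E G) :
    ContMDiff 𝓘(ℝ, E) 𝓘(ℝ, E).tangent 1 (fun g : G =>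
      (⟨g, mulInvariantVectorField X g⟩ : TangentBundle 𝓘(ℝ, E) G)) :=
  (contMDiff_mulInvariantVectorField X).of_le (by
    rw [minSmoothness_of_isRCLikeNormedField]; norm_num)

/-- Left-invariant fields are complete: left translates of one local curve through `1` give curves
through all points on the same interval `(-ε, ε)`, and a uniform time of existence allows extension
to all of `ℝ`. -/
theorem exists_integralCurve [CompleteSpace E] [T2Space G] (X : LieAlg E G) :
    ∃ γ : ℝ → G, γ 0 = 1 ∧
      IsMIntegralCurve γ (mulInvariantVectorField X : (x : G) → TangentSpace 𝓘(ℝ, E) x) := by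
  obtain ⟨γ, h0, hγ⟩ := exists_isMIntegralCurveAt_of_contMDiffAt_boundaryless (I := 𝓘(ℝ, E)) 0
    ((contMDiff_one_mulInvariant X).contMDiffAt (x := (1 : G)))
  rw [isMIntegralCurveAt_iff'] at hγ
  obtain ⟨ε, hε, hγ⟩ := hγ
  rw [Real.ball_eq_Ioo, zero_sub, zero_add] at hγ
  exact exists_isMIntegralCurve_of_isMIntegralCurveOn (contMDiff_one_mulInvariant X) hε
    (fun x => ⟨fun t => x * γ t, by simp [h0], isMIntegralCurveOn_lmul x hγ⟩) 1

/-- With `γ` in the role of `t ↦ exp(t X)`, this reduces calculus on `G` to functions of one real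
variable. -/
theorem hasDerivAt_integralCurve {X : LieAlg E G} {γ : ℝ → G}
    (hγ : IsMIntegralCurve γ (mulInvariantVectorField X : (x : G) → TangentSpace 𝓘(ℝ, E) x))
    {f : G → F} (hf : MDifferentiable 𝓘(ℝ, E) 𝓘(ℝ, F) f) (x : G) (t : ℝ) :
    HasDerivAt (fun t => f (x * γ t)) (lieDeriv X f (x * γ t)) t := by
  have h := isMIntegralCurveOn_lmul (s := Set.univ) x (hγ.isMIntegralCurveOn _)
  rw [← isMIntegralCurve_iff_isMIntegralCurveOn] at h
  refine hasDerivAt_comp_curve (hf _) (h t).mdifferentiableAt ?_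
  have e : (der (fun t => x * γ t) t : ℝ →L[ℝ] E) = ContinuousLinearMap.smulRight
    (1 : ℝ →L[ℝ] ℝ) (leftField X (x * γ t)) := (h t).mfderiv
  rw [e]
  exact one_smul ℝ (leftField X (x * γ t))

end LieDerivative

/-! ### Smooth dependence of derivatives on a parameter -/

section Parameters

variable {E₁ : Type*} [NormedAddCommGroup E₁] [NormedSpace ℝ E₁]
  {E : Type*} [NormedAddCommGroup E] [NormedSpace ℝ E]
  {F : Type*} [NormedAddCommGroup F] [NormedSpace ℝ F]
  {H₁ : Type*} [TopologicalSpace H₁] {I₁ : ModelWithCorners ℝ E₁ H₁}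
  {N : Type*} [TopologicalSpace N] [ChartedSpace H₁ N] [IsManifold I₁ ∞ N]
  {M : Type*} [TopologicalSpace M] [ChartedSpace E M] [IsManifold 𝓘(ℝ, E) ∞ M]

/-- The derivative at a fixed point of a smooth family of functions is a smooth function of the
parameter. -/
theorem contMDiff_der_of_param {Φ : N → M → F} (p : M)
    (hΦ : ContMDiff (I₁.prod 𝓘(ℝ, E)) 𝓘(ℝ, F) ∞ (Function.uncurry Φ)) :
    ContMDiff I₁ 𝓘(ℝ, E →L[ℝ] F) ∞ (fun x => (der (Φ x) p : E →L[ℝ] F)) := by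
  intro x₀
  have h := ContMDiffAt.mfderiv (m := ∞) (x₀ := x₀) Φ (fun _ => p) hΦ.contMDiffAt
    contMDiffAt_const (by simp)
  refine h.congr_of_eventuallyEq (Filter.Eventually.of_forall fun x => ?_)
  -- The base point is always `p` and the target is a vector space, so both coordinate changes are
  -- identities.
  refine Eq.trans ?_ (inTangentCoordinates_eq (I := 𝓘(ℝ, E)) (I' := 𝓘(ℝ, F)) (fun _ : N => p)
    (fun x => Φ x p) (fun x => (der (Φ x) p : E →L[ℝ] F)) (x₀ := x₀) (x := x)
    (mem_chart_source E p) (mem_chart_source F (Φ x p))).symm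
  refine ContinuousLinearMap.ext fun v => ?_
  have h1 : (tangentBundleCore 𝓘(ℝ, E) M).coordChange (achart E p) (achart E p) p v = v :=
    (tangentBundleCore 𝓘(ℝ, E) M).coordChange_self (achart E p) p (mem_chart_source E p) v
  simp only [ContinuousLinearMap.comp_apply]
  rw [h1, tangentBundleCore_coordChange_model_space]
  rfl

end Parameters

/-! ### Translations, smoothness and commutators of left-invariant derivatives -/

section LieDerivative

variable {E : Type*} [NormedAddCommGroup E] [NormedSpace ℝ E]
  {G : Type*} [TopologicalSpace G] [ChartedSpace E G] [Group G]
  {F : Type*} [NormedAddCommGroup F] [NormedSpace ℝ F]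
  {F' : Type*} [NormedAddCommGroup F'] [NormedSpace ℝ F']

theorem lieDeriv_clm_comp (L : F →L[ℝ] F') {f : G → F} {x : G}
    (hf : MDifferentiableAt 𝓘(ℝ, E) 𝓘(ℝ, F) f x) (X : LieAlg E G) :
    lieDeriv X (fun y => L (f y)) x = L (lieDeriv X f x) := by
  rw [lieDeriv, der_comp (E₂ := F) (L.contMDiff.contMDiffAt.mdifferentiableAt one_ne_zero) hf
    rfl, der_eq_fderiv, L.fderiv]
  rfl

variable [LieGroup 𝓘(ℝ, E) ∞ G]

theorem contMDiff_mul_uncurry :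
    ContMDiff (𝓘(ℝ, E).prod 𝓘(ℝ, E)) 𝓘(ℝ, E) ∞ (fun p : G × G => p.1 * p.2) :=
  contMDiff_mul 𝓘(ℝ, E) ∞

theorem contMDiff_lmul (x : G) : ContMDiff 𝓘(ℝ, E) 𝓘(ℝ, E) ∞ (fun y : G => x * y) :=
  contMDiff_mul_left

/-- Moving the base point to `1` turns `x` into a parameter, so that `contMDiff_der_of_param` gives
smoothness in `x`. -/
theorem lieDeriv_eq_der_lmul {f : G → F} {x : G} (hf : MDifferentiableAt 𝓘(ℝ, E) 𝓘(ℝ, F) f x)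
    (X : LieAlg E G) : lieDeriv X f x = (der (fun y => f (x * y)) 1 : E →L[ℝ] F) (toModel E G X) := by
  rw [der_comp (E₂ := E) hf (mdifferentiableAt_lmul x 1) (mul_one x)]
  rfl

theorem contMDiff_lieDeriv {f : G → F} (hf : ContMDiff 𝓘(ℝ, E) 𝓘(ℝ, F) ∞ f) (X : LieAlg E G) :
    ContMDiff 𝓘(ℝ, E) 𝓘(ℝ, F) ∞ (lieDeriv X f) := by
  have : lieDeriv X f = fun x => (der (fun y => f (x * y)) 1 : E →L[ℝ] F) (toModel E G X) :=
    funext fun x => lieDeriv_eq_der_lmul (hf.mdifferentiableAt (by simp)) X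
  rw [this]
  have h := contMDiff_der_of_param (I₁ := 𝓘(ℝ, E)) (E := E) (Φ := fun x y : G => f (x * y)) 1
    (hf.comp contMDiff_mul_uncurry)
  exact h.clm_apply contMDiff_const

theorem lieDeriv_lmul {f : G → F} (hf : MDifferentiable 𝓘(ℝ, E) 𝓘(ℝ, F) f)
    (X : LieAlg E G) (g x : G) : lieDeriv X (fun y => f (g * y)) x = lieDeriv X f (g * x) := by
  rw [lieDeriv, der_comp (E₂ := E) (hf (g * x)) (mdifferentiableAt_lmul g x) rfl]
  exact congrArg _ (der_lmul_leftField g x X)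

theorem mdifferentiableAt_rmul (g x : G) :
    MDifferentiableAt 𝓘(ℝ, E) 𝓘(ℝ, E) (fun x : G => x * g) x :=
  (contMDiff_mul_right (I := 𝓘(ℝ, E)) (n := ∞)).mdifferentiableAt (by simp)

/-- Right translation by `s` is conjugation by `s⁻¹`, which produces `Ad s⁻¹`, followed by left
translation by `s`, which preserves the field. -/
theorem der_rmul_leftField (s x : G) (X : LieAlg E G) :
    (der (fun y : G => y * s) x : E →L[ℝ] E) (leftField X x) =
      (leftField (Ad s⁻¹ X) (x * s)) := by
  have h1 : (fun y : G => y * s) = fun y : G => s * (s⁻¹ * y * s⁻¹⁻¹) := by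
    ext y; simp [mul_assoc]
  have h2 := der_comp (E₁ := E) (E₂ := E) (E₃ := E) (mdifferentiableAt_lmul s (s⁻¹ * x * s⁻¹⁻¹))
    (mdifferentiableAt_conj s⁻¹ x) rfl
  rw [h1, h2]
  have h3 : (der (fun y : G => s⁻¹ * y * s⁻¹⁻¹) x : E →L[ℝ] E) (leftField X x) =
    (leftField (Ad s⁻¹ X) (s⁻¹ * x * s⁻¹⁻¹)) := mfderiv_conj_mulInvariant s⁻¹ x X
  rw [ContinuousLinearMap.comp_apply, h3, der_lmul_leftField]
  congr 1
  simp [mul_assoc]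

theorem lieDeriv_rmul {f : G → F} (hf : MDifferentiable 𝓘(ℝ, E) 𝓘(ℝ, F) f)
    (X : LieAlg E G) (s x : G) :
    lieDeriv X (fun y => f (y * s)) x = lieDeriv (Ad s⁻¹ X) f (x * s) := by
  rw [lieDeriv, der_comp (E₂ := E) (hf (x * s)) (mdifferentiableAt_rmul s x) rfl]
  exact congrArg _ (der_rmul_leftField s x X)

/-! ### The commutator of left-invariant vector fields -/

open VectorField in
-- In a chart around `x` the second derivative of `f` is symmetric and cancels in the commutator;
-- the first-order terms that remain form the bracket of the fields.
theorem lieDeriv_lie [CompleteSpace E] {f : G → F} (hf : ContMDiff 𝓘(ℝ, E) 𝓘(ℝ, F) ∞ f)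
    (X Y : LieAlg E G) (x : G) :
    lieDeriv ⁅X, Y⁆ f x = lieDeriv X (lieDeriv Y f) x - lieDeriv Y (lieDeriv X f) x := by
  set φ := extChartAt 𝓘(ℝ, E) x with hφ
  have htar : IsOpen φ.target := isOpen_extChartAt_target x
  have hu₀ : φ x ∈ φ.target := mem_extChartAt_target x
  have hsymm : ∀ u ∈ φ.target, MDifferentiableAt 𝓘(ℝ, E) 𝓘(ℝ, E) φ.symm u := fun u hu =>
    ((contMDiffOn_extChartAt_symm x).contMDiffAt (htar.mem_nhds hu) :
      ContMDiffAt 𝓘(ℝ, E) 𝓘(ℝ, E) ∞ φ.symm u).mdifferentiableAt (by simp)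
  let A : E → E →L[ℝ] E := fun u => der φ.symm u
  have hA : ∀ u, A u = mfderivWithin 𝓘(ℝ, E) 𝓘(ℝ, E) φ.symm (Set.range 𝓘(ℝ, E)) u := fun u => by
    simp only [modelWithCornersSelf_coe, Set.range_id, mfderivWithin_univ]; rfl
  have hAinv : ∀ u ∈ φ.target, (A u).IsInvertible := fun u hu => by
    rw [hA]; exact isInvertible_mfderivWithin_extChartAt_symm hu
  let P : LieAlg E G → E → E := fun X =>
    mpullbackWithin 𝓘(ℝ, E) 𝓘(ℝ, E) φ.symm (mulInvariantVectorField X) (Set.range 𝓘(ℝ, E))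
  have hP : ∀ X u, P X u = (A u).inverse (leftField X (φ.symm u)) := fun X u => by
    rw [hA]; rfl
  have hder : ∀ {k : G → F}, ContMDiff 𝓘(ℝ, E) 𝓘(ℝ, F) ∞ k → ∀ (X : LieAlg E G),
      ∀ u ∈ φ.target, lieDeriv X k (φ.symm u) = fderiv ℝ (fun u => k (φ.symm u)) u (P X u) := by
    intro k hk X u hu
    rw [hP, ← der_eq_fderiv, der_comp (E₂ := E) (hk.mdifferentiableAt (by simp)) (hsymm u hu) rfl,
      ContinuousLinearMap.comp_apply]
    exact congrArg _ ((hAinv u hu).self_apply_inverse _).symm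
  have hPd : ∀ X, DifferentiableAt ℝ (P X) (φ x) := fun X => by
    have h : DifferentiableWithinAt ℝ (P X) (φ.symm ⁻¹' Set.univ ∩ Set.range 𝓘(ℝ, E)) (φ x) :=
      ((mdifferentiableAt_mulInvariantVectorField (I := 𝓘(ℝ, E)) X
        (g := x)).mdifferentiableWithinAt (s := Set.univ))
        |>.differentiableWithinAt_mpullbackWithin_vectorField
    exact h.differentiableAt (by simp)
  -- The bracket of `𝔤` is that of left-invariant fields, and the bracket on a manifold is by
  -- definition that of the chart representatives `P X`, `P Y`, carried back.
  have hbr : leftField ⁅X, Y⁆ x = (der φ x : E →L[ℝ] E).inverse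
      (lieBracket ℝ (P X) (P Y) (φ x)) := by
    have h1 : leftField ⁅X, Y⁆ x = mlieBracketWithin 𝓘(ℝ, E) (mulInvariantVectorField X)
        (mulInvariantVectorField Y) Set.univ x :=
      congrFun (mulInvariantVector_mlieBracket (I := 𝓘(ℝ, E)) X Y) x
    have h2 : lieBracket ℝ (P X) (P Y) = lieBracketWithin ℝ (P X) (P Y)
        (φ.symm ⁻¹' Set.univ ∩ Set.range 𝓘(ℝ, E)) := by
      rw [Set.preimage_univ, Set.univ_inter, modelWithCornersSelf_coe, Set.range_id,
        lieBracketWithin_univ]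
    rw [h2]
    exact h1
  set k : E → F := fun u => f (φ.symm u) with hk
  have hkd : ContDiffAt ℝ ∞ k (φ x) := by
    have h := hf.contMDiffAt.comp (φ x)
      ((contMDiffOn_extChartAt_symm x).contMDiffAt (htar.mem_nhds hu₀) :
        ContMDiffAt 𝓘(ℝ, E) 𝓘(ℝ, E) ∞ φ.symm (φ x))
    exact h.contDiffAt
  have hφx : φ.symm (φ x) = x := extChartAt_to_inv x
  have hφd : MDifferentiableAt 𝓘(ℝ, E) 𝓘(ℝ, E) φ x :=
    (contMDiffAt_extChartAt (n := 1)).mdifferentiableAt one_ne_zero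
  have hleft : lieDeriv ⁅X, Y⁆ f x = fderiv ℝ k (φ x) (lieBracket ℝ (P X) (P Y) (φ x)) := by
    have hcongr : (der f x : E →L[ℝ] F) = der (fun y => k (φ y)) x := by
      refine Filter.EventuallyEq.mfderiv_eq ?_
      filter_upwards [extChartAt_source_mem_nhds (I := 𝓘(ℝ, E)) x] with y hy
      rw [hk]
      exact congrArg f (φ.left_inv hy).symm
    have hinv : (der φ x : E →L[ℝ] E).IsInvertible :=
      isInvertible_mfderiv_extChartAt (mem_extChartAt_source x)
    rw [lieDeriv, hbr, hcongr, der_comp (E₂ := E)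
      ((hkd.differentiableAt (by simp)).mdifferentiableAt) hφd rfl,
      ContinuousLinearMap.comp_apply, hinv.self_apply_inverse, der_eq_fderiv]
  have hright : ∀ X Y : LieAlg E G, lieDeriv X (lieDeriv Y f) x =
      fderiv ℝ (fderiv ℝ k) (φ x) (P X (φ x)) (P Y (φ x)) +
        fderiv ℝ k (φ x) (fderiv ℝ (P Y) (φ x) (P X (φ x))) := by
    intro X Y
    have h1 := hder (contMDiff_lieDeriv hf Y) X (φ x) hu₀
    rw [hφx] at h1
    have h2 : (fun u => lieDeriv Y f (φ.symm u)) =ᶠ[nhds (φ x)] fun u => fderiv ℝ k u (P Y u) := by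
      filter_upwards [htar.mem_nhds hu₀] with u hu
      exact hder hf Y u hu
    have hkd' : DifferentiableAt ℝ (fderiv ℝ k) (φ x) :=
      (hkd.fderiv_right (m := 1) (by norm_num; exact ENat.LEInfty.out)).differentiableAt one_ne_zero
    rw [h1, h2.fderiv_eq, fderiv_clm_apply hkd' (hPd Y)]
    simp [add_comm]
  have hsymm2 := (hkd.isSymmSndFDerivAt (by
    rw [minSmoothness_of_isRCLikeNormedField]; exact ENat.LEInfty.out)) (P X (φ x)) (P Y (φ x))
  rw [hleft, hright, hright, hsymm2, lieBracket_eq]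
  simp only [map_sub]
  abel

end LieDerivative

/-! ### Product rules for left-invariant derivatives -/

section Leibniz

variable {E : Type*} [NormedAddCommGroup E] [NormedSpace ℝ E] [CompleteSpace E]
  {G : Type*} [TopologicalSpace G] [ChartedSpace E G] [Group G] [LieGroup 𝓘(ℝ, E) ∞ G] [T2Space G]
  {F : Type*} [NormedAddCommGroup F] [NormedSpace ℝ F]
  {F' : Type*} [NormedAddCommGroup F'] [NormedSpace ℝ F']
  {F'' : Type*} [NormedAddCommGroup F''] [NormedSpace ℝ F'']

/-- The product rule in one variable, along the integral curve of `Z` through `x`. -/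
theorem lieDeriv_clm_apply {Λ : G → F →L[ℝ] F'} {c : G → F}
    (hΛ : MDifferentiable 𝓘(ℝ, E) 𝓘(ℝ, F →L[ℝ] F') Λ) (hc : MDifferentiable 𝓘(ℝ, E) 𝓘(ℝ, F) c)
    (Z : LieAlg E G) (x : G) :
    lieDeriv Z (fun s => Λ s (c s)) x = lieDeriv Z Λ x (c x) + Λ x (lieDeriv Z c x) := by
  obtain ⟨γ, h0, hγ⟩ := exists_integralCurve Z
  have h1 := hasDerivAt_integralCurve hγ hΛ x 0
  have h2 := hasDerivAt_integralCurve hγ hc x 0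
  have h3 := hasDerivAt_integralCurve (f := fun s => Λ s (c s)) hγ (fun x => (hΛ x).clm_apply (hc x)) x 0
  have h4 := h3.unique (h1.clm_apply h2)
  simpa [h0] using h4

theorem lieDeriv_bilin (B : F →L[ℝ] F' →L[ℝ] F'') {ψ : G → F} {φ : G → F'}
    (hψ : MDifferentiable 𝓘(ℝ, E) 𝓘(ℝ, F) ψ) (hφ : MDifferentiable 𝓘(ℝ, E) 𝓘(ℝ, F') φ)
    (Z : LieAlg E G) (x : G) :
    lieDeriv Z (fun s => B (ψ s) (φ s)) x = B (lieDeriv Z ψ x) (φ x) + B (ψ x) (lieDeriv Z φ x) := by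
  have hB : MDifferentiable 𝓘(ℝ, E) 𝓘(ℝ, F' →L[ℝ] F'') (fun s => B (ψ s)) := fun x =>
    (B.contMDiff.contMDiffAt.mdifferentiableAt one_ne_zero).comp x (hψ x)
  rw [lieDeriv_clm_apply hB hφ, lieDeriv_clm_comp B (hψ x)]

theorem lieDeriv_smul {a : G → ℝ} {φ : G → F}
    (ha : MDifferentiable 𝓘(ℝ, E) 𝓘(ℝ, ℝ) a) (hφ : MDifferentiable 𝓘(ℝ, E) 𝓘(ℝ, F) φ)
    (Z : LieAlg E G) (x : G) :
    lieDeriv Z (fun s => a s • φ s) x = lieDeriv Z a x • φ x + a x • lieDeriv Z φ x :=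
  lieDeriv_bilin (ContinuousLinearMap.lsmul ℝ ℝ) ha hφ Z x

/-- Derivative of the derivative along a variable left-invariant field. -/
theorem lieDeriv_lieDeriv_var {f : G → F} (hf : ContMDiff 𝓘(ℝ, E) 𝓘(ℝ, F) ∞ f)
    {c : G → E} (hc : MDifferentiable 𝓘(ℝ, E) 𝓘(ℝ, E) c) (Z : LieAlg E G) (x : G) :
    lieDeriv Z (fun s => lieDeriv ((toModel E G).symm (c s)) f s) x =
      lieDeriv ((toModel E G).symm (lieDeriv Z c x)) f x +
        lieDeriv Z (lieDeriv ((toModel E G).symm (c x)) f) x := by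
  let Λ : G → E →L[ℝ] F := fun x => der (fun y => f (x * y)) 1
  have hΛ : MDifferentiable 𝓘(ℝ, E) 𝓘(ℝ, E →L[ℝ] F) Λ := fun x =>
    (contMDiff_der_of_param (I₁ := 𝓘(ℝ, E)) (E := E) (Φ := fun x y : G => f (x * y)) 1
      (hf.comp contMDiff_mul_uncurry)).mdifferentiableAt (by simp)
  have key : ∀ (v : E) x, lieDeriv ((toModel E G).symm v) f x = Λ x v := fun X x =>
    lieDeriv_eq_der_lmul (hf.mdifferentiableAt (by simp)) _
  have h2 : lieDeriv Z (lieDeriv ((toModel E G).symm (c x)) f) x = lieDeriv Z Λ x (c x) := by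
    rw [show lieDeriv ((toModel E G).symm (c x)) f = fun s => Λ s (c x) from
      funext fun s => key _ s]
    exact lieDeriv_clm_comp (ContinuousLinearMap.apply ℝ F (c x)) (hΛ x) Z
  rw [h2, key]
  simp only [key]
  rw [lieDeriv_clm_apply hΛ hc, add_comm]

end Leibniz

/-! ### Symmetry of mixed partial derivatives -/

section MixedPartials

variable {F : Type*} [NormedAddCommGroup F] [NormedSpace ℝ F]

/-- The inner partial derivatives enter as given functions `p` and `q`, because in the application
they are Lie derivatives known by other means. -/
theorem mixed_partials_comm {H : ℝ × ℝ → F} (hH : ContDiffAt ℝ ∞ H (0, 0)) {p q : ℝ → F} {p' q' : F}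
    (hp : ∀ᶠ a in nhds 0, HasDerivAt (fun b => H (a, b)) (p a) 0)
    (hq : ∀ᶠ b in nhds 0, HasDerivAt (fun a => H (a, b)) (q b) 0)
    (hp' : HasDerivAt p p' 0) (hq' : HasDerivAt q q' 0) : p' = q' := by
  have hd : ∀ᶠ z in nhds ((0, 0) : ℝ × ℝ), DifferentiableAt ℝ H z := by
    filter_upwards [(hH.of_le (m := 1) ENat.LEInfty.out).eventually (by simp)] with z hz
    exact hz.differentiableAt one_ne_zero
  have hd2 : HasFDerivAt (fderiv ℝ H) (fderiv ℝ (fderiv ℝ H) (0, 0)) (0, 0) :=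
    ((hH.fderiv_right (m := 1) (by norm_num; exact ENat.LEInfty.out)).differentiableAt
      one_ne_zero).hasFDerivAt
  have e1 : HasDerivAt (fun a : ℝ => ((a, 0) : ℝ × ℝ)) (1, 0) 0 :=
    (hasDerivAt_id 0).prodMk (hasDerivAt_const 0 0)
  have e2 : HasDerivAt (fun b : ℝ => ((0, b) : ℝ × ℝ)) (0, 1) 0 :=
    (hasDerivAt_const 0 0).prodMk (hasDerivAt_id 0)
  have h1 : p =ᶠ[nhds 0] fun a => fderiv ℝ H (a, 0) (0, 1) := by
    filter_upwards [hp, e1.continuousAt.eventually hd] with a ha hda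
    exact ha.unique (hda.hasFDerivAt.comp_hasDerivAt (0 : ℝ)
      ((hasDerivAt_const 0 a).prodMk (hasDerivAt_id 0)))
  have h2 : q =ᶠ[nhds 0] fun b => fderiv ℝ H (0, b) (1, 0) := by
    filter_upwards [hq, e2.continuousAt.eventually hd] with b hb hdb
    exact hb.unique (hdb.hasFDerivAt.comp_hasDerivAt (0 : ℝ)
      ((hasDerivAt_id 0).prodMk (hasDerivAt_const 0 b)))
  have h3 : HasDerivAt p (fderiv ℝ (fderiv ℝ H) (0, 0) (1, 0) (0, 1)) 0 := by
    have := (hd2.comp_hasDerivAt (f := fun a : ℝ => ((a, 0) : ℝ × ℝ)) (0 : ℝ) e1).clm_apply (hasDerivAt_const (0 : ℝ) ((0, 1) : ℝ × ℝ))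
    simp only [map_zero, add_zero] at this
    exact this.congr_of_eventuallyEq h1
  have h4 : HasDerivAt q (fderiv ℝ (fderiv ℝ H) (0, 0) (0, 1) (1, 0)) 0 := by
    have := (hd2.comp_hasDerivAt (f := fun b : ℝ => ((0, b) : ℝ × ℝ)) (0 : ℝ) e2).clm_apply (hasDerivAt_const (0 : ℝ) ((1, 0) : ℝ × ℝ))
    simp only [map_zero, add_zero] at this
    exact this.congr_of_eventuallyEq h2
  rw [hp'.unique h3, hq'.unique h4]
  exact hH.isSymmSndFDerivAt (by
    rw [minSmoothness_of_isRCLikeNormedField]; exact ENat.LEInfty.out) _ _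

end MixedPartials

/-! ### Smoothness and derivative of the adjoint representation -/

section Adjoint

variable {E : Type*} [NormedAddCommGroup E] [NormedSpace ℝ E] [FiniteDimensional ℝ E]
  {G : Type*} [TopologicalSpace G] [ChartedSpace E G] [Group G] [LieGroup 𝓘(ℝ, E) ∞ G] [T2Space G]
  {F : Type*} [NormedAddCommGroup F] [NormedSpace ℝ F]

variable (E G) in
/-- There is a smooth function to the model space whose derivative at `1` is invertible. -/
theorem exists_contMDiff_der_isInvertible :
    ∃ f : G → E, ContMDiff 𝓘(ℝ, E) 𝓘(ℝ, E) ∞ f ∧ (der f 1 : E →L[ℝ] E).IsInvertible := by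
  -- The chart at `1`, cut off by a function that is `1` near the identity, is globally smooth and
  -- keeps its derivative there.
  let b : SmoothBumpFunction 𝓘(ℝ, E) (1 : G) := Classical.choice inferInstance
  refine ⟨fun x => b x • extChartAt 𝓘(ℝ, E) (1 : G) x, ?_, ?_⟩
  · exact b.contMDiff_smul contMDiffOn_extChartAt
  · have : (der (fun x => b x • extChartAt 𝓘(ℝ, E) (1 : G) x) 1 : E →L[ℝ] E) =
        der (extChartAt 𝓘(ℝ, E) (1 : G)) 1 := by
      refine Filter.EventuallyEq.mfderiv_eq ?_
      filter_upwards [b.eventuallyEq_one] with x hx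
      simp [hx]
    rw [this]
    exact isInvertible_mfderiv_extChartAt (mem_extChartAt_source 1)

omit [FiniteDimensional ℝ E] [T2Space G] in
/-- There is a smooth curve through `1` with a given velocity. -/
theorem exists_curve (X : LieAlg E G) : ∃ γ : ℝ → G, γ 0 = 1 ∧
    ContMDiffAt 𝓘(ℝ, ℝ) 𝓘(ℝ, E) ∞ γ 0 ∧ (der γ 0 : ℝ →L[ℝ] E) 1 = toModel E G X := by
  set φ := extChartAt 𝓘(ℝ, E) (1 : G) with hφ
  have htar : IsOpen φ.target := isOpen_extChartAt_target 1
  have hu₀ : φ 1 ∈ φ.target := mem_extChartAt_target 1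
  have hs : ContMDiffAt 𝓘(ℝ, E) 𝓘(ℝ, E) ∞ φ.symm (φ 1) :=
    (contMDiffOn_extChartAt_symm 1).contMDiffAt (htar.mem_nhds hu₀)
  have hinv : (der φ.symm (φ 1) : E →L[ℝ] E).IsInvertible := by
    have : (der φ.symm (φ 1) : E →L[ℝ] E) =
        mfderivWithin 𝓘(ℝ, E) 𝓘(ℝ, E) φ.symm (Set.range 𝓘(ℝ, E)) (φ 1) := by
      simp only [modelWithCornersSelf_coe, Set.range_id, mfderivWithin_univ]; rfl
    rw [this]
    exact isInvertible_mfderivWithin_extChartAt_symm hu₀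
  let v : E := (der φ.symm (φ 1) : E →L[ℝ] E).inverse (toModel E G X)
  have hl : ContDiff ℝ ∞ fun t : ℝ => φ 1 + t • v := by fun_prop
  have hl0 : φ 1 + (0 : ℝ) • v = φ 1 := by simp
  refine ⟨fun t => φ.symm (φ 1 + t • v), ?_, ?_, ?_⟩
  · simp only [zero_smul, add_zero]
    exact extChartAt_to_inv 1
  · exact hs.comp_of_eq (x := (0 : ℝ)) hl.contMDiff.contMDiffAt hl0
  · rw [der_comp (E₂ := E) (hs.mdifferentiableAt (by simp))
      (hl.contMDiff.contMDiffAt.mdifferentiableAt (by simp)) hl0, ContinuousLinearMap.comp_apply,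
      der_eq_fderiv]
    have hd : HasDerivAt (fun t : ℝ => φ 1 + t • v) v 0 := by
      simpa using ((hasDerivAt_id (0 : ℝ)).smul_const v).const_add (φ 1)
    have : fderiv ℝ (fun t : ℝ => φ 1 + t • v) 0 1 = v := hd.deriv
    rw [this]
    exact hinv.self_apply_inverse _

/-- The derivative of `y ↦ f (x y x⁻¹)` at `1` is `df₁ ∘ Ad x`. It depends smoothly on `x`, and the
fixed invertible map `df₁` can be removed. -/
theorem contMDiff_Ad (X : LieAlg E G) :
    ContMDiff 𝓘(ℝ, E) 𝓘(ℝ, E) ∞ (fun x : G => toModel E G (Ad x X)) := by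
  obtain ⟨f, hf, hinv⟩ := exists_contMDiff_der_isInvertible E G
  have h := contMDiff_der_of_param (I₁ := 𝓘(ℝ, E)) (E := E)
    (Φ := fun x y : G => f (x * y * x⁻¹)) 1 (by
      refine hf.comp ?_
      exact (contMDiff_mul_uncurry).mul (contMDiff_fst.inv))
  have hx : ∀ x : G, (der f 1 : E →L[ℝ] E).inverse
      ((der (fun y => f (x * y * x⁻¹)) 1 : E →L[ℝ] E) (toModel E G X)) =
      toModel E G (Ad x X) := fun x => by
    rw [der_comp (E₂ := E) (y := (1 : G)) (hf.mdifferentiableAt (by simp))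
      (mdifferentiableAt_conj x 1) (by simp), ContinuousLinearMap.comp_apply, hinv.inverse_apply_self]
    rfl
  simp only [← hx]
  exact ((der f 1 : E →L[ℝ] E).inverse).contMDiff.comp (h.clm_apply contMDiff_const)

theorem contMDiff_Ad_inv (X : LieAlg E G) :
    ContMDiff 𝓘(ℝ, E) 𝓘(ℝ, E) ∞ (fun x : G => toModel E G (Ad x⁻¹ X)) :=
  (contMDiff_Ad X).comp (contMDiff_inv 𝓘(ℝ, E) ∞)

omit [FiniteDimensional ℝ E] [LieGroup 𝓘(ℝ, E) ∞ G] [T2Space G] in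
theorem leftField_one (X : LieAlg E G) : leftField X (1 : G) = toModel E G X :=
  mulInvariant_one X

/-- The derivative of the adjoint action is the Lie bracket. -/
theorem lieDeriv_Ad_inv [CompleteSpace E] (X Z : LieAlg E G) :
    lieDeriv Z (fun s : G => toModel E G (Ad s⁻¹ X)) 1 = toModel E G ⁅X, Z⁆ := by
  obtain ⟨f, hf, hinv⟩ := exists_contMDiff_der_isInvertible E G
  obtain ⟨γ, hγ0, hγ, hγd⟩ := exists_curve X
  obtain ⟨η, hη0, hη, hηd⟩ := exists_curve Z
  have hc : MDifferentiable 𝓘(ℝ, E) 𝓘(ℝ, E) (fun s : G => toModel E G (Ad s⁻¹ X)) :=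
    (contMDiff_Ad_inv X).mdifferentiable (by simp)
  have hfd : MDifferentiable 𝓘(ℝ, E) 𝓘(ℝ, E) f := hf.mdifferentiable (by simp)
  have hline : ∀ {k : G → E}, MDifferentiableAt 𝓘(ℝ, E) 𝓘(ℝ, E) k 1 → ∀ {γ : ℝ → G} {X : LieAlg E G},
      γ 0 = 1 → ContMDiffAt 𝓘(ℝ, ℝ) 𝓘(ℝ, E) ∞ γ 0 → (der γ 0 : ℝ →L[ℝ] E) 1 = toModel E G X →
      HasDerivAt (fun t => k (γ t)) (lieDeriv X k 1) 0 := by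
    intro k hk γ X h0 h1 h2
    have := hasDerivAt_comp_curve (f := k) (by rwa [h0]) (h1.mdifferentiableAt (by simp)) h2
    rw [h0, ← leftField_one X] at this
    exact this
  have hq : ContMDiff 𝓘(ℝ, E) 𝓘(ℝ, E) ∞ fun s : G => lieDeriv (Ad s⁻¹ X) f s := by
    have h1 : ∀ s : G, lieDeriv (Ad s⁻¹ X) f s =
      (der (fun y => f (s * y)) 1 : E →L[ℝ] E) (toModel E G (Ad s⁻¹ X)) := fun s =>
      lieDeriv_eq_der_lmul (hfd s) _
    simp only [h1]
    exact (contMDiff_der_of_param (I₁ := 𝓘(ℝ, E)) (E := E) (Φ := fun x y : G => f (x * y)) 1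
      (hf.comp contMDiff_mul_uncurry)).clm_apply
      (contMDiff_Ad_inv X)
  -- Both sides are mixed derivatives of `f (γ a * η b)` at the origin. Varying the left factor
  -- first is differentiation along a right-invariant field, which at `s` is the left-invariant one
  -- of `Ad s⁻¹ X`.
  have h1 : lieDeriv X (lieDeriv Z f) 1 = lieDeriv Z (fun s => lieDeriv (Ad s⁻¹ X) f s) 1 := by
    refine mixed_partials_comm (H := fun p : ℝ × ℝ => f (γ p.1 * η p.2))
      (p := fun a => lieDeriv Z f (γ a)) (q := fun b => lieDeriv (Ad (η b)⁻¹ X) f (η b)) ?_ ?_ ?_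
      (hline ((contMDiff_lieDeriv hf Z).mdifferentiableAt (by simp)) hγ0 hγ hγd)
      (hline (k := fun s => lieDeriv (Ad s⁻¹ X) f s) (hq.mdifferentiableAt (by simp)) hη0 hη hηd)
    · have h1 : ContMDiffAt 𝓘(ℝ, ℝ × ℝ) 𝓘(ℝ, E) ∞ (fun p : ℝ × ℝ => γ p.1) (0, 0) :=
        ContMDiffAt.comp ((0, 0) : ℝ × ℝ) (g := γ) hγ contDiff_fst.contMDiff.contMDiffAt
      have h2 : ContMDiffAt 𝓘(ℝ, ℝ × ℝ) 𝓘(ℝ, E) ∞ (fun p : ℝ × ℝ => η p.2) (0, 0) :=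
        ContMDiffAt.comp ((0, 0) : ℝ × ℝ) (g := η) hη contDiff_snd.contMDiff.contMDiffAt
      exact (ContMDiffAt.comp ((0, 0) : ℝ × ℝ) hf.contMDiffAt (h1.mul h2)).contDiffAt
    · refine Filter.Eventually.of_forall fun a => ?_
      have := hline (k := fun y => f (γ a * y)) ((hfd.comp fun y => mdifferentiableAt_lmul (γ a) y) 1)
        hη0 hη hηd
      rw [lieDeriv_lmul hfd, mul_one] at this
      exact this
    · refine Filter.Eventually.of_forall fun b => ?_
      have := hline (k := fun y => f (y * η b)) ((hfd.comp fun y => mdifferentiableAt_rmul (η b) y) 1)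
        hγ0 hγ hγd
      rw [lieDeriv_rmul hfd, one_mul] at this
      exact this
  have h3 := lieDeriv_lieDeriv_var hf hc Z 1
  simp only [ContinuousLinearEquiv.symm_apply_apply] at h3
  -- By `h1` and `h3`, `X Z f - Z X f` at `1` is the derivative of `f` along the derivative of `Ad
  -- s⁻¹ X`; it is also that along `⁅X, Z⁆`, and `df₁` is injective.
  have h2 := lieDeriv_lie hf X Z 1
  rw [h3] at h1
  simp only [inv_one, Ad_one, LinearMap.id_coe, id_eq] at h1
  rw [h1, add_sub_cancel_right, lieDeriv, lieDeriv, leftField_one, leftField_one,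
    ContinuousLinearEquiv.apply_symm_apply] at h2
  exact (hinv.injective h2).symm

end Adjoint

/-! ### Averaging over `G`: invariant forms, the Killing form, integration by parts -/

section Haar

open MeasureTheory

/-- Haar measures on compact groups are right invariant. -/
theorem isMulRightInvariant_of_compact {G : Type*} [TopologicalSpace G] [Group G]
    [IsTopologicalGroup G] [CompactSpace G] [MeasurableSpace G] [BorelSpace G]
    (μ : Measure G) [μ.IsHaarMeasure] : μ.IsMulRightInvariant where
  map_mul_right_eq_self g := by
    have hfin : IsFiniteMeasure μ := inferInstance
    have : IsFiniteMeasure (μ.map (· * g)) := inferInstance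
    -- The translated measure is left invariant, hence a multiple of `μ`; the two total masses are
    -- equal, finite and nonzero, so the factor is `1`.
    have h := Measure.isMulInvariant_eq_smul_of_compactSpace (μ.map (· * g)) μ
    set c := Measure.haarScalarFactor (μ.map (· * g)) μ
    have hu : μ.map (· * g) Set.univ = μ Set.univ := by
      rw [Measure.map_apply (measurable_mul_const g) MeasurableSet.univ, Set.preimage_univ]
    rw [h, Measure.smul_apply] at hu
    have hc : c = 1 := by
      have h1 : (c : ENNReal) * μ Set.univ = 1 * μ Set.univ := by rw [one_mul]; exact hu
      have h2 := (ENNReal.mul_left_inj (NeZero.ne (μ Set.univ)) (measure_ne_top μ _)).1 h1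
      exact_mod_cast h2
    rw [h, hc, one_smul]

theorem integrable_of_continuous {S F : Type*} [TopologicalSpace S] [CompactSpace S]
    [MeasurableSpace S] [BorelSpace S] [NormedAddCommGroup F] (μ : Measure S)
    [IsFiniteMeasureOnCompacts μ] {f : S → F} (hf : Continuous f) : Integrable f μ :=
  hf.integrable_of_hasCompactSupport (HasCompactSupport.of_compactSpace f)

variable {E : Type*} [NormedAddCommGroup E] [NormedSpace ℝ E] [FiniteDimensional ℝ E]
  {G : Type*} [TopologicalSpace G] [ChartedSpace E G] [Group G] [LieGroup 𝓘(ℝ, E) ∞ G] [T2Space G]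
  [CompactSpace G] [MeasurableSpace G] [BorelSpace G] (μ : Measure G) [μ.IsHaarMeasure]
  {F : Type*} [NormedAddCommGroup F] [NormedSpace ℝ F]

include μ in
/-- There is an inner product on the Lie algebra for which all `ad Z` are skew. -/
theorem exists_invariant_form [CompleteSpace E] : ∃ b : LinearMap.BilinForm ℝ (LieAlg E G),
    (∀ X Y, b X Y = b Y X) ∧ (∀ X, X ≠ 0 → 0 < b X X) ∧
      ∀ X Y Z, b ⁅X, Z⁆ Y + b X ⁅Y, Z⁆ = 0 := by
  have : IsTopologicalGroup G := topologicalGroup_of_lieGroup 𝓘(ℝ, E) ∞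
  have := isMulRightInvariant_of_compact μ
  let e := Module.finBasis ℝ E
  let ξ : Fin (Module.finrank ℝ E) → E →L[ℝ] ℝ := fun i => LinearMap.toContinuousLinearMap (e.coord i)
  -- A Euclidean inner product on the model space, moved by `Ad x`; its average over `x` is the
  -- invariant form.
  let q : LieAlg E G → LieAlg E G → G → ℝ := fun X Y x =>
    ∑ i, ξ i (toModel E G (Ad x X)) * ξ i (toModel E G (Ad x Y))
  have hAdc : ∀ X : LieAlg E G, Continuous fun x : G => toModel E G (Ad x X) :=
    fun X => (contMDiff_Ad X).continuous
  have hqc : ∀ X Y, Continuous (q X Y) := fun X Y =>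
    continuous_finsetSum _ fun i _ => ((ξ i).continuous.comp (hAdc X)).mul
      ((ξ i).continuous.comp (hAdc Y))
  have hqi : ∀ X Y, Integrable (q X Y) μ := fun X Y => integrable_of_continuous μ (hqc X Y)
  let b : LinearMap.BilinForm ℝ (LieAlg E G) := LinearMap.mk₂ ℝ (fun X Y => ∫ x, q X Y x ∂μ)
    (fun X X' Y => by
      rw [← integral_add (hqi _ _) (hqi _ _)]
      simp only [q, map_add, add_mul, Finset.sum_add_distrib])
    (fun r X Y => by
      rw [smul_eq_mul, ← integral_const_mul]
      simp only [q, map_smul, smul_eq_mul, mul_assoc, Finset.mul_sum])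
    (fun X Y Y' => by
      rw [← integral_add (hqi _ _) (hqi _ _)]
      simp only [q, map_add, mul_add, Finset.sum_add_distrib])
    (fun r X Y => by
      rw [smul_eq_mul, ← integral_const_mul]
      simp only [q, map_smul, smul_eq_mul, mul_left_comm, Finset.mul_sum])
  have hb : ∀ X Y, b X Y = ∫ x, q X Y x ∂μ := fun X Y => rfl
  have hAd : ∀ (s : G) X Y, b (Ad s X) (Ad s Y) = b X Y := fun s X Y => by
    rw [hb, hb, ← integral_mul_right_eq_self (q X Y) s]
    simp only [q, Ad_mul, LinearMap.comp_apply]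
  refine ⟨b, fun X Y => ?_, fun X hX => ?_, fun X Y Z => ?_⟩
  · rw [hb, hb]; simp only [q, mul_comm]
  · refine (hqc X X).integral_pos_of_hasCompactSupport_nonneg_nonzero
      (HasCompactSupport.of_compactSpace _)
      (fun x => Finset.sum_nonneg fun i _ => mul_self_nonneg _) (x := 1) fun h0 => hX ?_
    rw [Finset.sum_eq_zero_iff_of_nonneg fun i _ => mul_self_nonneg _] at h0
    refine (toModel E G).injective ?_
    rw [map_zero]
    refine e.ext_elem fun i => ?_
    have := mul_self_eq_zero.1 (h0 i (Finset.mem_univ i))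
    rw [Ad_one] at this
    simpa [ξ] using this
  -- Invariance makes `s ↦ b (Ad s⁻¹ X) (Ad s⁻¹ Y)` constant; its derivative at `1` along `Z` is the
  -- claimed sum.
  · let B : E →L[ℝ] E →L[ℝ] ℝ := LinearMap.toContinuousLinearMap
      ((LinearMap.toContinuousLinearMap (𝕜 := ℝ) (E := E) (F' := ℝ)).toLinearMap ∘ₗ
        (b.compl₁₂ (toModel E G).symm.toLinearEquiv.toLinearMap
          (toModel E G).symm.toLinearEquiv.toLinearMap))
    have hB : ∀ X Y, B (toModel E G X) (toModel E G Y) = b X Y := fun X Y => rfl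
    have h1 := lieDeriv_bilin B ((contMDiff_Ad_inv X).mdifferentiable (by simp))
      ((contMDiff_Ad_inv Y).mdifferentiable (by simp)) Z (1 : G)
    simp only [lieDeriv_Ad_inv, hB, hAd, inv_one, Ad_one, LinearMap.id_coe, id_eq] at h1
    rw [← h1, lieDeriv]
    have : (der (fun _ : G => b X Y) 1 : E →L[ℝ] ℝ) = 0 := mfderiv_const
    rw [this]; rfl

include μ in
/-- The Killing form of a compact semisimple Lie group is negative definite. -/
theorem killingForm_neg [CompleteSpace E] [LieAlgebra.IsSemisimple ℝ (LieAlg E G)]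
    (X : LieAlg E G) (hX : X ≠ 0) : killingForm ℝ (LieAlg E G) X X < 0 := by
  obtain ⟨b, hs, hp, hb⟩ := exists_invariant_form (E := E) μ
  have : FiniteDimensional ℝ (LieAlg E G) := inferInstanceAs (FiniteDimensional ℝ E)
  obtain ⟨e, he⟩ := exists_orthonormal_basis_of_pos b hs hp
  -- The trace of `(ad X)²` in an orthonormal basis, with one `ad X` moved across by skewness.
  have hk : killingForm ℝ (LieAlg E G) X X = -∑ i, b ⁅X, e i⁆ ⁅X, e i⁆ := by
    rw [killingForm_apply_apply, trace_eq_sum_orthonormal e he, ← Finset.sum_neg_distrib]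
    refine Finset.sum_congr rfl fun i _ => ?_
    have := hb (e i) ⁅X, e i⁆ X
    rw [← lie_skew, ← lie_skew ⁅X, e i⁆ X] at this
    simp only [map_neg, LinearMap.neg_apply] at this
    simp only [LinearMap.comp_apply, LieAlgebra.ad_apply]
    linarith
  have hnn : ∀ Y, 0 ≤ b Y Y := fun Y => by
    by_cases hY : Y = 0
    · simp [hY]
    · exact (hp Y hY).le
  rw [hk, neg_lt_zero]
  -- If the sum vanishes then `ad X = 0`, so `X` is central, and the center of a semisimple algebra
  -- is zero.
  refine lt_of_le_of_ne (Finset.sum_nonneg fun i _ => hnn _) fun h0 => hX ?_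
  have h1 := (Finset.sum_eq_zero_iff_of_nonneg fun i _ => hnn _).1 h0.symm
  have h2 : ∀ i, ⁅X, e i⁆ = 0 := fun i => by
    by_contra hne
    exact (hp _ hne).ne' (h1 i (Finset.mem_univ i))
  have h3 : LieAlgebra.ad ℝ (LieAlg E G) X = 0 := e.ext fun i => h2 i
  have h4 : X ∈ LieAlgebra.center ℝ (LieAlg E G) := by
    refine (LieModule.mem_maxTrivSubmodule _ _ _ X).2 fun Y => ?_
    rw [← lie_skew, ← LieAlgebra.ad_apply (R := ℝ), h3, LinearMap.zero_apply, neg_zero]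
  rw [LieAlgebra.center_eq_bot] at h4
  simpa using h4

include μ in
omit [FiniteDimensional ℝ E] in
/-- The integral of a derivative along a left-invariant vector field is zero. -/
theorem integral_lieDeriv [CompleteSpace E] {f : G → F}
    (hf : ContMDiff 𝓘(ℝ, E) 𝓘(ℝ, F) ∞ f)
    (X : LieAlg E G) : ∫ x, lieDeriv X f x ∂μ = 0 := by
  have : IsTopologicalGroup G := topologicalGroup_of_lieGroup 𝓘(ℝ, E) ∞
  have := isMulRightInvariant_of_compact μ
  obtain ⟨γ, h0, hγ⟩ := exists_integralCurve X
  have hc : Continuous (lieDeriv X f) := (contMDiff_lieDeriv hf X).continuous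
  obtain ⟨C, hC⟩ := isCompact_univ.exists_bound_of_continuousOn hc.continuousOn
  have hcm : ∀ t, Continuous fun x => f (x * γ t) := fun t =>
    hf.continuous.comp (continuous_mul_const _)
  have h := (hasDerivAt_integral_of_dominated_loc_of_deriv_le (μ := μ) (𝕜 := ℝ)
    (F := fun t x => f (x * γ t)) (F' := fun t x => lieDeriv X f (x * γ t)) (x₀ := 0)
    (s := Set.univ) (bound := fun _ => C) Filter.univ_mem
    (Filter.Eventually.of_forall fun t => (integrable_of_continuous μ (hcm t)).aestronglyMeasurable)
    (integrable_of_continuous μ (hcm 0))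
    (integrable_of_continuous μ (hc.comp (continuous_mul_const _))).aestronglyMeasurable
    (Filter.Eventually.of_forall fun x t _ => hC _ (Set.mem_univ _))
    (integrable_of_continuous μ continuous_const)
    (Filter.Eventually.of_forall fun x t _ =>
      hasDerivAt_integralCurve hγ (hf.mdifferentiable (by simp)) x t)).2
  -- By right invariance the integral does not depend on `t`, while its derivative at `0` is the
  -- integral in question.
  have h2 : (fun t => ∫ x, f (x * γ t) ∂μ) = fun _ => ∫ x, f x ∂μ :=
    funext fun t => integral_mul_right_eq_self f (γ t)
  rw [h2] at h
  have h3 := h.unique (hasDerivAt_const (0 : ℝ) _)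
  simpa [h0] using h3

end Haar

/-! ### Smoothness of integrals that depend on a parameter -/

section ParametricIntegral

open MeasureTheory

variable {E : Type*} [NormedAddCommGroup E] [NormedSpace ℝ E] [FiniteDimensional ℝ E]
  {M : Type*} [TopologicalSpace M] [ChartedSpace E M] [IsManifold 𝓘(ℝ, E) ∞ M]
  {S : Type*} [TopologicalSpace S] [CompactSpace S] [MeasurableSpace S] [BorelSpace S]
  (ν : Measure S) [IsFiniteMeasure ν]

omit [FiniteDimensional ℝ E] in
theorem contMDiffOn_partial_fderiv {U : Set E} (hU : IsOpen U) {Φ : E × M → ℂ}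
    (hΦ : ContMDiffOn (𝓘(ℝ, E).prod 𝓘(ℝ, E)) 𝓘(ℝ, ℂ) ∞ Φ (U ×ˢ Set.univ)) :
    ContMDiffOn (𝓘(ℝ, E).prod 𝓘(ℝ, E)) 𝓘(ℝ, E →L[ℝ] ℂ) ∞
      (fun p => fderiv ℝ (fun u => Φ (u, p.2)) p.1) (U ×ˢ Set.univ) := by
  intro p hp
  refine ContMDiffAt.contMDiffWithinAt ?_
  have hΦp : ContMDiffAt (𝓘(ℝ, E).prod 𝓘(ℝ, E)) 𝓘(ℝ, ℂ) ∞ Φ p :=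
    hΦ.contMDiffAt ((hU.prod isOpen_univ).mem_nhds hp)
  have h1 : ContMDiffAt ((𝓘(ℝ, E).prod 𝓘(ℝ, E)).prod 𝓘(ℝ, E)) 𝓘(ℝ, ℂ) ∞
      (Function.uncurry fun (q : E × M) (u : E) => Φ (u, q.2)) (p, p.1) :=
    ContMDiffAt.comp_of_eq (g := Φ) (f := fun z : (E × M) × E => (z.2, z.1.2)) hΦp
      (contMDiffAt_snd.prodMk (contMDiffAt_snd.comp _ contMDiffAt_fst)) rfl
  have h := ContMDiffAt.mfderiv (m := ∞) (fun (q : E × M) (u : E) => Φ (u, q.2)) Prod.fst h1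
    contMDiffAt_fst (by simp)
  refine h.congr_of_eventuallyEq (Filter.Eventually.of_forall fun q => ?_)
  exact (der_eq_fderiv (fun u => Φ (u, q.2)) q.1).symm.trans
    (congrFun (inTangentCoordinates_model_space (I := 𝓘(ℝ, E)) (I' := 𝓘(ℝ, ℂ)) Prod.fst
      (fun q : E × M => Φ (q.1, q.2)) (fun q => (der (fun u => Φ (u, q.2)) q.1 : E →L[ℝ] ℂ)) p)
      q).symm

/-- A closed ball around `u` is compact, as is `S`, so a constant dominates the derivative of the
integrand. -/
theorem hasFDerivAt_integral_param {U : Set E} (hU : IsOpen U) {i : S → M} (hi : Continuous i)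
    {w : S → ℂ} (hw : Continuous w) {Φ : E × M → ℂ}
    (hΦ : ContMDiffOn (𝓘(ℝ, E).prod 𝓘(ℝ, E)) 𝓘(ℝ, ℂ) ∞ Φ (U ×ˢ Set.univ)) {u : E} (hu : u ∈ U) :
    HasFDerivAt (fun u => ∫ s, w s * Φ (u, i s) ∂ν)
      (∫ s, w s • fderiv ℝ (fun u => Φ (u, i s)) u ∂ν) u := by
  obtain ⟨r, hr, hrU⟩ := Metric.nhds_basis_closedBall.mem_iff.1 (hU.mem_nhds hu)
  have hD := (contMDiffOn_partial_fderiv hU hΦ).continuousOn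
  have hc1 : ∀ v ∈ U, Continuous fun s => w s * Φ (v, i s) := fun v hv =>
    hw.mul (hΦ.continuousOn.comp_continuous (continuous_const.prodMk hi) fun s => ⟨hv, trivial⟩)
  have hc2 : ∀ v ∈ U, Continuous fun s => w s • fderiv ℝ (fun u => Φ (u, i s)) v := fun v hv =>
    hw.smul (hD.comp_continuous (f := fun s => (v, i s)) (continuous_const.prodMk hi)
      fun s => ⟨hv, trivial⟩)
  have hc3 : ContinuousOn (fun p : E × S => w p.2 • fderiv ℝ (fun u => Φ (u, i p.2)) p.1)
      (Metric.closedBall u r ×ˢ Set.univ) :=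
    (hw.comp continuous_snd).continuousOn.smul (hD.comp (f := fun p : E × S => (p.1, i p.2))
      (continuous_fst.prodMk (hi.comp continuous_snd)).continuousOn
      fun p hp => ⟨hrU hp.1, trivial⟩)
  obtain ⟨C, hC⟩ := ((isCompact_closedBall u r).prod isCompact_univ).exists_bound_of_continuousOn hc3
  refine hasFDerivAt_integral_of_dominated_of_fderiv_le (𝕜 := ℝ) (bound := fun _ => C)
    (F := fun u s => w s * Φ (u, i s))
    (F' := fun v s => w s • fderiv ℝ (fun u => Φ (u, i s)) v)
    (Metric.closedBall_mem_nhds u hr) ?_ (integrable_of_continuous ν (hc1 u hu))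
    (integrable_of_continuous ν (hc2 u hu)).aestronglyMeasurable ?_
    (integrable_of_continuous ν continuous_const) ?_
  · filter_upwards [hU.mem_nhds hu] with v hv
    exact (integrable_of_continuous ν (hc1 v hv)).aestronglyMeasurable
  · exact Filter.Eventually.of_forall fun s v hv => hC (v, s) ⟨hv, trivial⟩
  · refine Filter.Eventually.of_forall fun s v hv => ?_
    have hd : DifferentiableAt ℝ (fun u => Φ (u, i s)) v := by
      have h1 : ContMDiffAt (𝓘(ℝ, E).prod 𝓘(ℝ, E)) 𝓘(ℝ, ℂ) ∞ Φ (v, i s) :=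
        hΦ.contMDiffAt ((hU.prod isOpen_univ).mem_nhds ⟨hrU hv, trivial⟩)
      have h2 : ContMDiffAt 𝓘(ℝ, E) 𝓘(ℝ, ℂ) ∞ (fun u => Φ (u, i s)) v :=
        ContMDiffAt.comp_of_eq (g := Φ) h1 (contMDiffAt_id.prodMk contMDiffAt_const) rfl
      exact h2.contDiffAt.differentiableAt (by simp)
    exact hd.hasFDerivAt.const_smul (w s)

/-- Each directional derivative is again an integral of the same shape with values in `ℂ`, which is
why the induction runs over all `Φ`. In the variable `s` continuity suffices. -/
theorem contDiffOn_integral_param {U : Set E} (hU : IsOpen U) {i : S → M} (hi : Continuous i)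
    {w : S → ℂ} (hw : Continuous w) (n : ℕ) {Φ : E × M → ℂ}
    (hΦ : ContMDiffOn (𝓘(ℝ, E).prod 𝓘(ℝ, E)) 𝓘(ℝ, ℂ) ∞ Φ (U ×ˢ Set.univ)) :
    ContDiffOn ℝ n (fun u => ∫ s, w s * Φ (u, i s) ∂ν) U := by
  induction n generalizing Φ with
  | zero =>
    exact contDiffOn_zero.2 fun u hu =>
      (hasFDerivAt_integral_param ν hU hi hw hΦ hu).continuousAt.continuousWithinAt
  | succ n ih =>
    have hD := contMDiffOn_partial_fderiv hU hΦ
    push_cast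
    rw [contDiffOn_succ_iff_fderiv_of_isOpen hU]
    refine ⟨fun u hu => (hasFDerivAt_integral_param ν hU hi hw
      hΦ hu).differentiableAt.differentiableWithinAt, by simp, contDiffOn_clm_apply.2 fun v => ?_⟩
    have hv : ContMDiffOn (𝓘(ℝ, E).prod 𝓘(ℝ, E)) 𝓘(ℝ, ℂ) ∞
        (fun p : E × M => fderiv ℝ (fun u => Φ (u, p.2)) p.1 v) (U ×ˢ Set.univ) :=
      hD.clm_apply contMDiffOn_const
    refine (ih hv).congr fun u hu => ?_
    rw [(hasFDerivAt_integral_param ν hU hi hw hΦ hu).fderiv, ContinuousLinearMap.integral_apply]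
    · simp
    · exact integrable_of_continuous ν (hw.smul (hD.continuousOn.comp_continuous
        (f := fun s => (u, i s)) (continuous_const.prodMk hi) fun s => ⟨hu, trivial⟩))

end ParametricIntegral

/-! ### Averages over `K` -/

section Average

open MeasureTheory

variable {E : Type*} [NormedAddCommGroup E] [NormedSpace ℝ E] [FiniteDimensional ℝ E]
  {G : Type*} [TopologicalSpace G] [ChartedSpace E G] [Group G] [LieGroup 𝓘(ℝ, E) ∞ G]
  {K : Subgroup G} [CompactSpace K] [MeasurableSpace K] [BorelSpace K] (ν : Measure K)

/-- A chart is used only in `x`; the subgroup enters through its continuous inclusion in `G`, so it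
needs no manifold structure. -/
theorem contMDiff_average [IsFiniteMeasure ν] {w : K → ℂ} (hw : Continuous w) {f : G → ℂ}
    (hf : ContMDiff 𝓘(ℝ, E) 𝓘(ℝ, ℂ) ∞ f) :
    ContMDiff 𝓘(ℝ, E) 𝓘(ℝ, ℂ) ∞ (fun x => ∫ s : K, w s * f (x * s) ∂ν) := by
  intro x
  set φ := extChartAt 𝓘(ℝ, E) x with hφ
  have htar : IsOpen φ.target := isOpen_extChartAt_target x
  have hsymm : ContMDiffOn 𝓘(ℝ, E) 𝓘(ℝ, E) ∞ φ.symm φ.target := contMDiffOn_extChartAt_symm x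
  have h1 : ContMDiffOn (𝓘(ℝ, E).prod 𝓘(ℝ, E)) 𝓘(ℝ, ℂ) ∞
      (fun p : E × G => f (φ.symm p.1 * p.2)) (φ.target ×ˢ Set.univ) := by
    refine hf.comp_contMDiffOn (ContMDiffOn.mul ?_ contMDiffOn_snd)
    exact hsymm.comp contMDiffOn_fst fun p hp => hp.1
  have h2 : ContDiffOn ℝ ∞ (fun u => ∫ s : K, w s * f (φ.symm u * s) ∂ν) φ.target :=
    contDiffOn_infty.2 fun n =>
      contDiffOn_integral_param ν htar (i := fun s : K => (s : G)) continuous_subtype_val hw n h1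
  have h3 := (h2.contDiffAt (htar.mem_nhds (mem_extChartAt_target x))).contMDiffAt.comp x
    (contMDiffAt_extChartAt (n := ∞))
  refine h3.congr_of_eventuallyEq ?_
  filter_upwards [extChartAt_source_mem_nhds (I := 𝓘(ℝ, E)) x] with y hy
  simp only [Function.comp_apply]
  rw [show φ.symm (extChartAt 𝓘(ℝ, E) x y) = y from φ.left_inv hy]

end Average

/-! ### Equivariant functions and the Lie algebra of `K` -/

section Equivariant

open MeasureTheory

variable {E : Type*} [NormedAddCommGroup E] [NormedSpace ℝ E]
  {G : Type*} [TopologicalSpace G] [ChartedSpace E G] [Group G] [LieGroup 𝓘(ℝ, E) ∞ G]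
  {K : Subgroup G}

theorem average_mul [MeasurableSpace K] [MeasurableMul K] (ν : Measure K)
    [ν.IsMulLeftInvariant] (χ : K →ₜ* Circle) (f : G → ℂ) (x : G) (t : K) :
    ∫ s : K, (χ s : ℂ) * f (x * t * s) ∂ν =
      starRingEnd ℂ (χ t) * ∫ s : K, (χ s : ℂ) * f (x * s) ∂ν := by
  rw [← integral_mul_left_eq_self (fun s : K => (χ s : ℂ) * f (x * s)) t, ← integral_const_mul]
  congr 1
  funext s
  have h : starRingEnd ℂ (χ t : ℂ) * (χ t : ℂ) = 1 := by
    rw [← Complex.normSq_eq_conj_mul_self, Circle.normSq_coe, Complex.ofReal_one]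
  simp only [map_mul, Circle.coe_mul, Subgroup.coe_mul]
  rw [← mul_assoc x, ← mul_assoc, ← mul_assoc, h, one_mul]

theorem translate_mem_functionAlgebra {f : G → ℝ} (hf : f ∈ FunctionAlgebra E K) (y : G) :
    (fun x => f (y * x)) ∈ FunctionAlgebra E K :=
  ⟨hf.1.comp (contMDiff_lmul y), fun x s => by
    change f (y * (x * s)) = f (y * x)
    rw [← mul_assoc]; exact hf.2 _ s⟩

variable [FiniteDimensional ℝ E] [T2Space G] [CompactSpace G]

/-- There is a smooth function that transforms under `K` by a character and does not vanish
at `1`. -/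
theorem exists_character_function (hK : IsClosed (K : Set G)) (χ : K →ₜ* Circle) :
    ∃ c : G → ℂ, ContMDiff 𝓘(ℝ, E) 𝓘(ℝ, ℂ) ∞ c ∧
      (∀ (x : G) (s : K), c (x * s) = starRingEnd ℂ (χ s) * c x) ∧ c 1 ≠ 0 := by
  have : IsTopologicalGroup G := topologicalGroup_of_lieGroup 𝓘(ℝ, E) ∞
  let : MeasurableSpace K := borel K
  have : BorelSpace K := ⟨rfl⟩
  have : CompactSpace K := isCompact_iff_compactSpace.1 hK.isCompact
  let ν : Measure K := Measure.haar
  have hχc : Continuous fun s : K => (χ s : ℂ) := continuous_subtype_val.comp χ.continuous_toFun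
  have hre : Continuous fun s : K => (χ s : ℂ).re := Complex.continuous_re.comp hχc
  -- A bump function `f` at `1` that vanishes off `U` sees only those `s ∈ K` with `Re χ(s) > 0`.
  -- The integrand for `c 1` then has nonnegative real part, positive at `s = 1`.
  obtain ⟨U, hU, hUK⟩ := isOpen_induced_iff.1 (isOpen_lt continuous_const hre :
    IsOpen {s : K | 0 < (χ s : ℂ).re})
  have h1U : (1 : G) ∈ U := by
    have : (1 : K) ∈ ((↑) : K → G) ⁻¹' U := by rw [hUK]; simp
    exact this
  obtain ⟨f, hf0, hf1, hf⟩ := exists_contMDiffMap_zero_one_of_isClosed (n := ⊤) 𝓘(ℝ, E)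
    hU.isClosed_compl (isClosed_singleton (x := (1 : G)))
    (Set.disjoint_singleton_right.2 fun h => h h1U)
  have hfs : ContMDiff 𝓘(ℝ, E) 𝓘(ℝ, ℂ) ∞ (fun x => (f x : ℂ)) :=
    Complex.ofRealCLM.contMDiff.comp f.contMDiff
  refine ⟨fun x => ∫ s : K, (χ s : ℂ) * (f (x * s) : ℂ) ∂ν, contMDiff_average ν hχc hfs,
    fun x s => average_mul ν χ (fun x => (f x : ℂ)) x s, fun h0 => ?_⟩
  have hc : Continuous fun s : K => (χ s : ℂ) * (f (1 * s) : ℂ) :=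
    hχc.mul (hfs.continuous.comp (continuous_const.mul continuous_subtype_val))
  have hpos : 0 < ∫ s : K, ((χ s : ℂ) * (f (1 * s) : ℂ)).re ∂ν := by
    refine Continuous.integral_pos_of_hasCompactSupport_nonneg_nonzero (x := 1)
      (Complex.continuous_re.comp hc) (HasCompactSupport.of_compactSpace _) (fun s => ?_) ?_
    · rw [Complex.re_mul_ofReal, one_mul]
      by_cases hs : (s : G) ∈ U
      · have : s ∈ {s : K | 0 < (χ s : ℂ).re} := by rw [← hUK]; exact hs
        exact mul_nonneg this.le (hf _).1
      · rw [show f (s : G) = 0 from hf0 hs, mul_zero]; rfl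
    · have : f (1 : G) = 1 := hf1 rfl
      simp [this]
  have h := Complex.reCLM.integral_comp_comm (integrable_of_continuous ν hc)
  simp only [Complex.reCLM_apply] at h
  rw [h] at hpos
  exact hpos.ne' (congrArg Complex.re h0)

/-- Functions on `G / K` separate `K` from the other points. -/
theorem exists_functionAlgebra_ne (hK : IsClosed (K : Set G)) {y : G} (hy : y ∉ K) :
    ∃ f ∈ FunctionAlgebra E K, f 1 ≠ f y := by
  have : IsTopologicalGroup G := topologicalGroup_of_lieGroup 𝓘(ℝ, E) ∞
  let : MeasurableSpace K := borel K
  have : BorelSpace K := ⟨rfl⟩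
  have : CompactSpace K := isCompact_iff_compactSpace.1 hK.isCompact
  let ν : Measure K := Measure.haar
  have hyK : IsClosed ((fun x => y * x) '' (K : Set G)) :=
    (Homeomorph.mulLeft y).isClosedMap _ hK
  -- The cosets `K` and `y K` are disjoint and closed. A function that is `0` on one and `1` on the
  -- other keeps distinct values at `1` and `y` after averaging.
  obtain ⟨f, hf0, hf1, hf⟩ := exists_contMDiffMap_zero_one_of_isClosed (n := ⊤) 𝓘(ℝ, E) hK hyK
    (Set.disjoint_left.2 (by
      rintro z hz ⟨k, hk, rfl⟩
      exact hy ((K.mul_mem_cancel_right hk).1 hz)))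
  have hfs : ContMDiff 𝓘(ℝ, E) 𝓘(ℝ, ℂ) ∞ (fun x => (f x : ℂ)) :=
    Complex.ofRealCLM.contMDiff.comp f.contMDiff
  have hsm := contMDiff_average ν (w := fun _ => 1) continuous_const hfs
  refine ⟨fun x => (∫ s : K, 1 * (f (x * s) : ℂ) ∂ν).re,
    ⟨Complex.reCLM.contMDiff.comp hsm, fun x t => ?_⟩, ?_⟩
  · have := integral_mul_left_eq_self (μ := ν) (fun s : K => 1 * (f (x * s) : ℂ)) t
    simp only [Subgroup.coe_mul, ← mul_assoc] at this
    simp only [this]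
  · have h1 : ∀ s : K, f (1 * (s : G)) = 0 := fun s => by rw [one_mul]; exact hf0 s.2
    have h2 : ∀ s : K, f (y * (s : G)) = 1 := fun s => hf1 ⟨s, s.2, rfl⟩
    simp only [h1, h2]
    simp only [Complex.ofReal_zero, mul_zero, integral_zero, Complex.zero_re, Complex.ofReal_one,
      mul_one, integral_const, Complex.real_smul]
    have : 0 < ν.real Set.univ := measureReal_univ_pos
    simpa using this.ne

/-- If `X` kills `A`, every `f ∈ A` is constant along the integral curve from `1`, which cannot
leave `K` since `A` separates `K` from the other points. The criterion is visibly linear in `X`,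
unlike the definition. -/
theorem mem_lieAlgebraOf_iff [CompleteSpace E] (hK : IsClosed (K : Set G)) (X : LieAlg E G) :
    X ∈ lieAlgebraOf E K ↔ ∀ f ∈ FunctionAlgebra E K, ∀ x, lieDeriv X f x = 0 := by
  constructor
  · rintro ⟨γ, h0, hγ, hγK⟩ f hf x
    have h := hasDerivAt_integralCurve hγ (hf.1.mdifferentiable (by simp)) x 0
    have h2 : (fun t => f (x * γ t)) = fun _ => f x := funext fun t => hf.2 x ⟨γ t, hγK t⟩
    rw [h2, h0, mul_one] at h
    exact h.unique (hasDerivAt_const _ _)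
  · intro h
    obtain ⟨γ, h0, hγ⟩ := exists_integralCurve X
    refine ⟨γ, h0, hγ, fun t => ?_⟩
    by_contra ht
    obtain ⟨f, hf, hne⟩ := exists_functionAlgebra_ne (E := E) hK ht
    have hd : ∀ t, HasDerivAt (fun t => f (1 * γ t)) 0 t := fun t => by
      rw [← h f hf (1 * γ t)]
      exact hasDerivAt_integralCurve hγ (hf.1.mdifferentiable (by simp)) 1 t
    have hc := is_const_of_deriv_eq_zero (fun t => (hd t).differentiableAt)
      (fun t => (hd t).deriv) 0 t
    simp only [h0, one_mul] at hc
    exact hne hc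

/-- One point suffices because `A` is stable under left translation. -/
theorem mem_lieAlgebraOf_of_at [CompleteSpace E] (hK : IsClosed (K : Set G)) {X : LieAlg E G}
    (x : G) (h : ∀ f ∈ FunctionAlgebra E K, lieDeriv X f x = 0) : X ∈ lieAlgebraOf E K := by
  refine (mem_lieAlgebraOf_iff hK X).2 fun f hf y => ?_
  have := h _ (translate_mem_functionAlgebra hf (y * x⁻¹))
  rw [lieDeriv_lmul (hf.1.mdifferentiable (by simp))] at this
  simpa using this

/-- The Lie algebra of `K` as a subspace. -/
def isotropySubspace [CompleteSpace E] (hK : IsClosed (K : Set G)) :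
    Submodule ℝ (LieAlg E G) where
  carrier := lieAlgebraOf E K
  add_mem' {X Y} hX hY := by
    rw [mem_lieAlgebraOf_iff hK] at *
    intro f hf x
    rw [lieDeriv_add_left, hX f hf, hY f hf, add_zero]
  zero_mem' := (mem_lieAlgebraOf_iff hK _).2 fun f _ x => map_zero (lieDerivₗ f x)
  smul_mem' r X hX := by
    rw [mem_lieAlgebraOf_iff hK] at *
    intro f hf x
    rw [← lieDerivₗ_apply, map_smul, lieDerivₗ_apply, hX f hf, smul_zero]

end Equivariant

/-! ### Comparison of two inner products -/

section Forms

variable {V : Type*} [AddCommGroup V] [Module ℝ V] [FiniteDimensional ℝ V]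

/-- Simultaneous diagonalization of two positive definite forms. -/
theorem exists_orthonormal_eigenbasis (b : LinearMap.BilinForm ℝ V) (hs : ∀ X Y, b X Y = b Y X)
    (hp : ∀ X, X ≠ 0 → 0 < b X X) (T : V →ₗ[ℝ] V) (hT : ∀ X Y, b (T X) Y = b X (T Y)) :
    ∃ (u : Module.Basis (Fin (Module.finrank ℝ V)) ℝ V) (l : Fin (Module.finrank ℝ V) → ℝ),
      (∀ i j, b (u i) (u j) = if i = j then 1 else 0) ∧ ∀ i, T (u i) = l i • u i := by
  let core : InnerProductSpace.Core ℝ V := innerCore b hs hp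
  let _ : NormedAddCommGroup V := core.toNormedAddCommGroup
  let _ : InnerProductSpace ℝ V := InnerProductSpace.ofCore _
  have hsym : T.IsSymmetric := hT
  refine ⟨(hsym.eigenvectorBasis rfl).toBasis, hsym.eigenvalues rfl, fun i j => ?_, fun i => ?_⟩
  · have := orthonormal_iff_ite.1 (hsym.eigenvectorBasis rfl).orthonormal i j
    rw [OrthonormalBasis.coe_toBasis]
    exact this
  · rw [OrthonormalBasis.coe_toBasis]
    exact hsym.apply_eigenvectorBasis rfl i

/-- Two inner products are related by an isomorphism that commutes with all isometries of both. -/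
theorem exists_equivariant_isometry (b g : LinearMap.BilinForm ℝ V)
    (hbs : ∀ X Y, b X Y = b Y X) (hbp : ∀ X, X ≠ 0 → 0 < b X X)
    (hgs : ∀ X Y, g X Y = g Y X) (hgp : ∀ X, X ≠ 0 → 0 < g X X) :
    ∃ R : V →ₗ[ℝ] V, Function.Surjective R ∧ (∀ X Y, g (R X) (R Y) = b X Y) ∧
      ∀ A : V →ₗ[ℝ] V, (∀ X Y, b (A X) (A Y) = b X Y) → (∀ X Y, g (A X) (A Y) = g X Y) →
        ∀ X, A (R X) = R (A X) := by
  obtain ⟨e, he⟩ := exists_orthonormal_basis_of_pos b hbs hbp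
  -- The operator with `b (T X) Y = g X Y`; it is selfadjoint for `b`, and `R` below is `T^(-1/2)`.
  let T : V →ₗ[ℝ] V := ∑ i, (g (e i)).smulRight (e i)
  have hT : ∀ X Y, b (T X) Y = g X Y := fun X Y => by
    conv_rhs => rw [← sum_orthonormal_smul e he Y]
    simp only [T, LinearMap.sum_apply, LinearMap.smulRight_apply, map_sum, map_smul,
      LinearMap.smul_apply, smul_eq_mul, hgs X, mul_comm]
  obtain ⟨u, l, hu, hl⟩ := exists_orthonormal_eigenbasis b hbs hbp T
    (fun X Y => by rw [hT, hbs, hT, hgs])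
  have hgu : ∀ i j, g (u i) (u j) = if i = j then l i else 0 := fun i j => by
    rw [← hT, hl, map_smul, LinearMap.smul_apply, hu]; simp
  have hlpos : ∀ i, 0 < l i := fun i => by
    have := hgp (u i) (u.ne_zero i)
    rwa [hgu, if_pos rfl] at this
  let R : V →ₗ[ℝ] V := u.constr ℝ fun i => (√(l i))⁻¹ • u i
  have hR : ∀ i, R (u i) = (√(l i))⁻¹ • u i := fun i => u.constr_basis ℝ _ i
  have hRg : ∀ X Y, g (R X) (R Y) = b X Y := by
    have : g.compl₁₂ R R = b := by
      refine LinearMap.ext_basis u u fun i j => ?_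
      simp only [LinearMap.compl₁₂_apply, hR, map_smul, LinearMap.smul_apply, hgu, hu, smul_eq_mul]
      split_ifs with hij
      · subst hij
        have h1 := Real.mul_self_sqrt (hlpos i).le
        have h2 := (Real.sqrt_pos.2 (hlpos i)).ne'
        field_simp
        rw [sq, h1]
      · simp
    intro X Y
    rw [← this]; rfl
  -- `R` is a scalar on each whole eigenspace of `T`, not only on the chosen basis. A common
  -- isometry `A` commutes with `T`, preserves its eigenspaces, and so commutes with `R`.
  have hReig : ∀ (c : ℝ) (Y : V), T Y = c • Y → R Y = (√c)⁻¹ • Y := fun c Y hY => by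
    have hrep : ∀ i, u.repr Y i * l i = u.repr Y i * c := fun i => by
      have h1 : b (T Y) (u i) = b (c • Y) (u i) := by rw [hY]
      rw [hT, hgs, ← hT, hl, map_smul, map_smul, LinearMap.smul_apply, LinearMap.smul_apply,
        hbs Y, orthonormal_apply_eq_repr u hu] at h1
      simpa [mul_comm] using h1
    conv_lhs => rw [← u.sum_repr Y]
    conv_rhs => rw [← u.sum_repr Y]
    rw [map_sum, Finset.smul_sum]
    refine Finset.sum_congr rfl fun i _ => ?_
    rw [map_smul, hR, smul_comm]
    by_cases h0 : u.repr Y i = 0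
    · simp [h0]
    · rw [mul_left_cancel₀ h0 (hrep i)]
  have hRinj : Function.Injective R := by
    refine (injective_iff_map_eq_zero R).2 fun X hX => ?_
    by_contra h0
    have := hbp X h0
    rw [← hRg, hX, map_zero] at this
    exact this.ne' rfl
  refine ⟨R, LinearMap.injective_iff_surjective.1 hRinj, hRg, fun A hAb hAg X => ?_⟩
  have hAinj : Function.Injective A := by
    refine (injective_iff_map_eq_zero A).2 fun X hX => ?_
    by_contra h0
    have := hbp X h0
    rw [← hAb, hX, map_zero] at this
    exact this.ne' rfl
  have hAT : ∀ X, T (A X) = A (T X) := fun X => by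
    have h0 : ∀ Z, b (T (A X) - A (T X)) Z = 0 := fun Z => by
      obtain ⟨Y, rfl⟩ := LinearMap.injective_iff_surjective.1 hAinj Z
      rw [map_sub, LinearMap.sub_apply, hT, hAg, hAb, hT, sub_self]
    by_contra hne
    exact (hbp _ (sub_ne_zero.2 hne)).ne' (h0 _)
  have : A ∘ₗ R = R ∘ₗ A := by
    refine u.ext fun i => ?_
    rw [LinearMap.comp_apply, LinearMap.comp_apply, hR, map_smul,
      hReig (l i) (A (u i)) (by rw [hAT, hl, map_smul])]
  exact LinearMap.congr_fun this X

end Forms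

/-! ### The decomposition `𝔤 = 𝔨 ⊕ 𝔪` and standard frames -/

section Reductive

open MeasureTheory

variable {E : Type*} [NormedAddCommGroup E] [NormedSpace ℝ E] [CompleteSpace E]
  {G : Type*} [TopologicalSpace G] [ChartedSpace E G] [Group G] [LieGroup 𝓘(ℝ, E) ∞ G]
  {K : Subgroup G}

theorem incl_AdM (s : K) (Y : TangentModel E K) : incl K (AdM s Y) = Ad (s : G) (incl K Y) := rfl

theorem incl_injective : Function.Injective (incl (E := E) K) := Subtype.val_injective

theorem killingForm_incl {X : LieAlg E G} (hX : X ∈ lieAlgebraOf E K) (Y : TangentModel E K) :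
    killingForm ℝ (LieAlg E G) X (incl K Y) = 0 := Y.2 X hX

theorem killingForm_symm (X Y : LieAlg E G) :
    killingForm ℝ (LieAlg E G) X Y = killingForm ℝ (LieAlg E G) Y X :=
  LieModule.traceForm_comm ℝ _ _ X Y

theorem AdM_mul (s t : K) (Y : TangentModel E K) : AdM (s * t) Y = AdM s (AdM t Y) := by
  apply incl_injective
  rw [incl_AdM, incl_AdM, incl_AdM, Subgroup.coe_mul, Ad_mul]; rfl

theorem AdM_one (Y : TangentModel E K) : AdM (1 : K) Y = Y := by
  apply incl_injective
  rw [incl_AdM, Subgroup.coe_one, Ad_one]; rfl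

theorem AdM_comp_inv (s : K) (Y : TangentModel E K) : AdM s (AdM s⁻¹ Y) = Y := by
  rw [← AdM_mul, mul_inv_cancel, AdM_one]

variable (E G) in
/-- The negative of the Killing form. -/
def negKilling : LinearMap.BilinForm ℝ (LieAlg E G) := -killingForm ℝ (LieAlg E G)

theorem negKilling_apply (X Y : LieAlg E G) :
    negKilling E G X Y = -killingForm ℝ (LieAlg E G) X Y := rfl

theorem negKilling_symm (X Y : LieAlg E G) : negKilling E G X Y = negKilling E G Y X := by
  rw [negKilling_apply, negKilling_apply, killingForm_symm]

omit [CompleteSpace E] in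
theorem contMDiff_linear_Ad_inv {F : Type*} [NormedAddCommGroup F] [NormedSpace ℝ F]
    [FiniteDimensional ℝ E] [T2Space G] (L : LieAlg E G →ₗ[ℝ] F) (X : LieAlg E G) :
    ContMDiff 𝓘(ℝ, E) 𝓘(ℝ, F) ∞ (fun x : G => L (Ad x⁻¹ X)) := by
  let L' : E →L[ℝ] F := LinearMap.toContinuousLinearMap
    (L ∘ₗ ((toModel E G).symm.toLinearEquiv : E →ₗ[ℝ] LieAlg E G))
  exact L'.contMDiff.comp (contMDiff_Ad_inv X)

/-- `P` is the projection of `𝔤 = 𝔨 ⊕ 𝔪` onto `𝔪`. -/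
structure IsTangentProjection (P : LieAlg E G →ₗ[ℝ] TangentModel E K) : Prop where
  apply_incl : ∀ Y, P (incl K Y) = Y
  sub_mem : ∀ X, X - incl K (P X) ∈ lieAlgebraOf E K

variable [FiniteDimensional ℝ E] [T2Space G] [CompactSpace G] [MeasurableSpace G] [BorelSpace G]
  [LieAlgebra.IsSemisimple ℝ (LieAlg E G)]

/-- Such a vector is orthogonal to itself for a definite form. -/
theorem incl_eq_zero_of_mem (μ : Measure G) [μ.IsHaarMeasure] {Y : TangentModel E K}
    (hY : incl K Y ∈ lieAlgebraOf E K) : Y = 0 := by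
  by_contra h0
  refine (killingForm_neg μ (incl K Y) fun h => h0 (incl_injective (h.trans (map_zero _).symm))).ne
    (killingForm_incl hY Y)

theorem exists_tangentProjection (μ : Measure G) [μ.IsHaarMeasure] (hK : IsClosed (K : Set G)) :
    ∃ P : LieAlg E G →ₗ[ℝ] TangentModel E K, IsTangentProjection P := by
  have : FiniteDimensional ℝ (LieAlg E G) := inferInstanceAs (FiniteDimensional ℝ E)
  have hrefl : (killingForm ℝ (LieAlg E G)).IsRefl := fun X Y h => by rwa [killingForm_symm]
  have heq : LinearMap.BilinForm.orthogonal (killingForm ℝ (LieAlg E G)) (isotropySubspace hK) =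
      tangentSubspace E K := rfl
  have hc := (LinearMap.BilinForm.isCompl_orthogonal_iff_disjoint
    (W := isotropySubspace hK) hrefl).2 (by
      rw [heq, Submodule.disjoint_def]
      intro X hX hX'
      exact congrArg (incl K) (incl_eq_zero_of_mem μ (Y := (⟨X, hX'⟩ : TangentModel E K)) hX))
  rw [heq] at hc
  refine ⟨(tangentSubspace E K).projectionOnto (isotropySubspace hK) hc.symm, ⟨fun Y =>
    Submodule.projectionOnto_apply_left hc.symm Y, fun X => ?_⟩⟩
  change _ ∈ isotropySubspace hK
  rw [← Submodule.projectionOnto_apply_eq_zero_iff hc.symm, map_sub]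
  exact sub_eq_zero.2 (Submodule.projectionOnto_apply_left hc.symm _).symm

namespace IsTangentProjection

variable {P : LieAlg E G →ₗ[ℝ] TangentModel E K} (hP : IsTangentProjection P)
include hP

omit [FiniteDimensional ℝ E] [T2Space G] [CompactSpace G] [MeasurableSpace G] [BorelSpace G]
  [LieAlgebra.IsSemisimple ℝ (LieAlg E G)] in
theorem killingForm_incl (X : LieAlg E G) (Y : TangentModel E K) :
    killingForm ℝ (LieAlg E G) (incl K (P X)) (incl K Y) =
      killingForm ℝ (LieAlg E G) X (incl K Y) := by
  have := HomDirac.killingForm_incl (hP.sub_mem X) Y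
  rw [map_sub, LinearMap.sub_apply, sub_eq_zero] at this
  exact this.symm

theorem eq_of_sub_mem (μ : Measure G) [μ.IsHaarMeasure] (hK : IsClosed (K : Set G))
    {X : LieAlg E G} {Y : TangentModel E K}
    (h : X - incl K Y ∈ lieAlgebraOf E K) : P X = Y := by
  rw [← sub_eq_zero]
  refine incl_eq_zero_of_mem μ ?_
  have : incl K (P X - Y) = (X - incl K Y) - (X - incl K (P X)) := by rw [map_sub]; abel
  rw [this]
  exact (isotropySubspace hK).sub_mem h (hP.sub_mem X)

/-- For `s ∈ K`, `Ad s` preserves both summands. -/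
theorem apply_Ad (μ : Measure G) [μ.IsHaarMeasure] (hK : IsClosed (K : Set G)) (s : K)
    (X : LieAlg E G) : P (Ad (s : G) X) = AdM s (P X) := by
  refine hP.eq_of_sub_mem μ hK ?_
  rw [incl_AdM, ← map_sub]
  exact Ad_mem_lieAlgebraOf s.2 (hP.sub_mem X)

end IsTangentProjection

theorem negKilling_pos (μ : Measure G) [μ.IsHaarMeasure] (X : LieAlg E G) (hX : X ≠ 0) :
    0 < negKilling E G X X := neg_pos.2 (killingForm_neg μ X hX)

/-- Standard module frames exist. -/
theorem exists_standardFrame (μ : Measure G) [μ.IsHaarMeasure] (hK : IsClosed (K : Set G))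
    (h : AlmostHermitian E K) :
    ∃ (n : ℕ) (W : Fin n → TangentModule E K), ∀ (X : TangentModel E K) (x : G),
      ∑ j, h.g₀ (W j x) X • W j x = X := by
  have : FiniteDimensional ℝ (LieAlg E G) := inferInstanceAs (FiniteDimensional ℝ E)
  obtain ⟨P, hP⟩ := exists_tangentProjection (E := E) μ hK
  let b : LinearMap.BilinForm ℝ (TangentModel E K) :=
    (negKilling E G).compl₁₂ (incl K) (incl K)
  have hb : ∀ X Y, b X Y = negKilling E G (incl K X) (incl K Y) := fun _ _ => rfl
  obtain ⟨R, hRs, hR, hRA⟩ := exists_equivariant_isometry b h.g₀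
    (fun X Y => negKilling_symm _ _)
    (fun X hX => negKilling_pos μ _ fun h0 => hX (incl_injective (h0.trans (map_zero _).symm)))
    h.g₀_symm h.g₀_pos
  obtain ⟨e, he⟩ := exists_orthonormal_basis_of_pos (negKilling E G) negKilling_symm
    (negKilling_pos μ)
  -- `Ad x⁻¹` carries the orthonormal basis `e` of `𝔤` to another one, whose projection to `𝔪`
  -- reproduces vectors by means of the Killing metric `b`. The isometry `R` from `b` to `g₀`
  -- commutes with `AdM`, so it yields equivariant fields that form a frame for `g₀`.
  refine ⟨_, fun i => ⟨fun x => R (P (Ad x⁻¹ (e i))),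
    contMDiff_linear_Ad_inv (R ∘ₗ P) (e i), fun x s => ?_⟩, fun X x => ?_⟩
  · change R (P (Ad (x * s)⁻¹ (e i))) = AdM s⁻¹ (R (P (Ad x⁻¹ (e i))))
    rw [hRA (AdM s⁻¹) (fun X Y => by
      rw [hb, hb, incl_AdM, incl_AdM, negKilling_apply, killingForm_Ad]; rfl) (h.g₀_Ad s⁻¹),
      ← hP.apply_Ad μ hK, mul_inv_rev, Ad_mul]
    rfl
  · obtain ⟨Y, rfl⟩ := hRs X
    change ∑ j, h.g₀ (R (P (Ad x⁻¹ (e j)))) (R Y) • R (P (Ad x⁻¹ (e j))) = R Y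
    have h1 : ∀ j, h.g₀ (R (P (Ad x⁻¹ (e j)))) (R Y) = negKilling E G (e j) (Ad x (incl K Y)) := by
      intro j
      rw [hR, hb, negKilling_apply, hP.killingForm_incl, ← killingForm_Ad x, Ad_comp_inv]
      rfl
    simp only [h1, ← map_smul, ← map_sum]
    rw [sum_orthonormal_smul e he, Ad_inv_comp, hP.apply_incl]

end Reductive

/-! ### Sums over frames do not depend on the frame -/

section Tight

variable {V : Type*} [AddCommGroup V] [Module ℝ V]

/-- A finite family that reproduces every vector by means of the form `g`. -/
def IsTight {n : ℕ} (g : LinearMap.BilinForm ℝ V) (w : Fin n → V) : Prop :=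
  ∀ X, ∑ j, g (w j) X • w j = X

/-- Expanding `u j` in the family `w`, or `w k` in the family `u`, leads to the same double sum.
This is what lets a frame of fields be replaced by constant vectors. -/
theorem IsTight.sum_eq {F : Type*} [AddCommGroup F] [Module ℝ F] {g : LinearMap.BilinForm ℝ V}
    (hg : ∀ X Y, g X Y = g Y X) {n m : ℕ} {u : Fin n → V} {w : Fin m → V} (hu : IsTight g u)
    (hw : IsTight g w) (B : V →ₗ[ℝ] V →ₗ[ℝ] F) : ∑ j, B (u j) (u j) = ∑ k, B (w k) (w k) := by
  have h1 : ∀ j, B (u j) (u j) = ∑ k, g (w k) (u j) • B (w k) (u j) := fun j => by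
    have := congrArg (fun X => B X (u j)) (hw (u j))
    simpa only [map_sum, map_smul, LinearMap.sum_apply, LinearMap.smul_apply] using this.symm
  have h2 : ∀ k, B (w k) (w k) = ∑ j, g (w k) (u j) • B (w k) (u j) := fun k => by
    have := congrArg (B (w k)) (hu (w k))
    simpa only [map_sum, map_smul, hg (u _) (w k)] using this.symm
  simp only [h1, h2]
  exact Finset.sum_comm

theorem IsTight.sum_eq_trace [FiniteDimensional ℝ V] {g : LinearMap.BilinForm ℝ V}
    (hg : ∀ X Y, g X Y = g Y X) (hp : ∀ X, X ≠ 0 → 0 < g X X) {n : ℕ} {u : Fin n → V}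
    (hu : IsTight g u) (T : V →ₗ[ℝ] V) : ∑ j, g (T (u j)) (u j) = LinearMap.trace ℝ V T := by
  obtain ⟨e, he⟩ := exists_orthonormal_basis_of_pos g hg hp
  rw [trace_eq_sum_orthonormal e he]
  refine (hu.sum_eq hg (fun X => sum_orthonormal_smul e he X) (g ∘ₗ T)).trans ?_
  exact Finset.sum_congr rfl fun i _ => hg _ _

end Tight

/-! ### Vector fields on `G / K` and their Lie bracket -/

section Fields

open MeasureTheory

variable {E : Type*} [NormedAddCommGroup E] [NormedSpace ℝ E] [CompleteSpace E]
  {G : Type*} [TopologicalSpace G] [ChartedSpace E G] [Group G] [LieGroup 𝓘(ℝ, E) ∞ G]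
  {K : Subgroup G} {F : Type*} [NormedAddCommGroup F] [NormedSpace ℝ F]

theorem along_eq_lieDeriv (V : TangentModule E K) (f : G → F) (x : G) :
    along V f x = lieDeriv (incl K (V x)) f x := rfl

theorem mdifferentiable_field (V : TangentModule E K) :
    MDifferentiable 𝓘(ℝ, E) 𝓘(ℝ, TangentModel E K) V := V.2.1.mdifferentiable (by simp)

/-- The projection of the bracket of `𝔤` to `𝔪`. -/
def tangentBracket (P : LieAlg E G →ₗ[ℝ] TangentModel E K) :
    TangentModel E K →ₗ[ℝ] TangentModel E K →ₗ[ℝ] TangentModel E K :=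
  LinearMap.mk₂ ℝ (fun X Y => P ⁅incl K X, incl K Y⁆) (by simp) (by simp) (by simp) (by simp)

theorem tangentBracket_apply (P : LieAlg E G →ₗ[ℝ] TangentModel E K) (X Y : TangentModel E K) :
    tangentBracket P X Y = P ⁅incl K X, incl K Y⁆ := rfl

theorem along_mul_of_equivariant (V : TangentModule E K) {f : G → F}
    (hf : MDifferentiable 𝓘(ℝ, E) 𝓘(ℝ, F) f) (L : F →L[ℝ] F) (s : K)
    (hs : ∀ x : G, f (x * s) = L (f x)) (x : G) : along V f (x * s) = L (along V f x) := by
  rw [along_eq_lieDeriv, V.2.2, incl_AdM, Subgroup.coe_inv, ← lieDeriv_rmul hf]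
  simp only [hs]
  exact lieDeriv_clm_comp L (hf x) _

variable [FiniteDimensional ℝ E]

theorem contMDiff_along (V : TangentModule E K) {f : G → F}
    (hf : ContMDiff 𝓘(ℝ, E) 𝓘(ℝ, F) ∞ f) : ContMDiff 𝓘(ℝ, E) 𝓘(ℝ, F) ∞ (along V f) := by
  have h1 : along V f = fun x => (der (fun y => f (x * y)) 1 : E →L[ℝ] F)
      (LinearMap.toContinuousLinearMap (inclModel K) (V x)) :=
    funext fun x => lieDeriv_eq_der_lmul (hf.mdifferentiableAt (by simp)) _
  rw [h1]
  have h := contMDiff_der_of_param (I₁ := 𝓘(ℝ, E)) (E := E) (Φ := fun x y : G => f (x * y)) 1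
    (hf.comp contMDiff_mul_uncurry)
  exact h.clm_apply ((LinearMap.toContinuousLinearMap (inclModel K)).contMDiff.comp V.2.1)

/-- The canonical connection on vector fields. -/
def alongField (V W : TangentModule E K) : TangentModule E K :=
  ⟨along V W, contMDiff_along V W.2.1, fun x s =>
    along_mul_of_equivariant V (mdifferentiable_field W) (LinearMap.toContinuousLinearMap (AdM s⁻¹)) s
      (fun x => W.2.2 x s) x⟩

/-- The first term differentiates the coefficient `W`, the second has both vectors frozen at `x`.
Antisymmetrizing the second produces the bracket of `𝔤`. -/
theorem along_along [T2Space G] (V W : TangentModule E K) {f : G → F}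
    (hf : ContMDiff 𝓘(ℝ, E) 𝓘(ℝ, F) ∞ f) (x : G) :
    along V (along W f) x = lieDeriv (incl K (along V W x)) f x +
      lieDeriv (incl K (V x)) (lieDeriv (incl K (W x)) f) x := by
  let L : TangentModel E K →L[ℝ] E := LinearMap.toContinuousLinearMap (inclModel K)
  have hL : MDifferentiable 𝓘(ℝ, E) 𝓘(ℝ, E) (fun y => L (W y)) :=
    (L.contMDiff.comp W.2.1).mdifferentiable (by simp : (∞ : WithTop ℕ∞) ≠ 0)
  have h := lieDeriv_lieDeriv_var hf hL (incl K (V x)) x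
  rw [lieDeriv_clm_comp L (mdifferentiable_field W x)] at h
  exact h

variable [T2Space G] [CompactSpace G] [MeasurableSpace G] [BorelSpace G]
  [LieAlgebra.IsSemisimple ℝ (LieAlg E G)]

/-- The bracket of vector fields as a vector field. -/
def bracketField (μ : Measure G) [μ.IsHaarMeasure] (hK : IsClosed (K : Set G))
    {P : LieAlg E G →ₗ[ℝ] TangentModel E K} (hP : IsTangentProjection P)
    (V W : TangentModule E K) : TangentModule E K :=
  alongField V W - alongField W V +
    ⟨fun x => tangentBracket P (V x) (W x),
      ((tangentBracket P).toContinuousBilinearMap.contMDiff.comp V.2.1).clm_apply W.2.1, fun x s => by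
        beta_reduce
        rw [V.2.2, W.2.2, tangentBracket_apply, tangentBracket_apply, incl_AdM, incl_AdM,
          ← Ad_lie, hP.apply_Ad μ hK]⟩

theorem bracketField_apply (μ : Measure G) [μ.IsHaarMeasure] (hK : IsClosed (K : Set G))
    {P : LieAlg E G →ₗ[ℝ] TangentModel E K} (hP : IsTangentProjection P)
    (V W : TangentModule E K) (x : G) :
    bracketField μ hK hP V W x =
      along V W x - along W V x + P ⁅incl K (V x), incl K (W x)⁆ := rfl

/-- The `𝔨`-component of `⁅V x, W x⁆` kills `A`, so only its projection to `𝔪` matters. -/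
theorem isBracket_bracketField (μ : Measure G) [μ.IsHaarMeasure] (hK : IsClosed (K : Set G))
    {P : LieAlg E G →ₗ[ℝ] TangentModel E K} (hP : IsTangentProjection P)
    (V W : TangentModule E K) : IsBracket V W (bracketField μ hK hP V W) := by
  intro f x
  have h1 := (mem_lieAlgebraOf_iff hK _).1 (hP.sub_mem ⁅incl K (V x), incl K (W x)⁆) f.1 f.2 x
  rw [lieDeriv_sub_left, lieDeriv_lie f.2.1, sub_eq_zero] at h1
  rw [along_along V W f.2.1, along_along W V f.2.1, along_eq_lieDeriv, bracketField_apply, map_add,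
    map_sub, lieDeriv_add_left, lieDeriv_sub_left, ← h1]
  ring

/-- At each point the difference lies in `𝔪` and kills `A`, hence lies in `𝔨 ∩ 𝔪 = 0`. -/
theorem IsBracket.unique (μ : Measure G) [μ.IsHaarMeasure] (hK : IsClosed (K : Set G))
    {V W Z Z' : TangentModule E K} (h : IsBracket V W Z) (h' : IsBracket V W Z') : Z = Z' := by
  refine Subtype.ext (funext fun x => ?_)
  rw [← sub_eq_zero]
  refine incl_eq_zero_of_mem μ (mem_lieAlgebraOf_of_at hK x fun f hf => ?_)
  rw [map_sub, lieDeriv_sub_left]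
  exact sub_eq_zero.2 ((h ⟨f, hf⟩ x).trans (h' ⟨f, hf⟩ x).symm)

theorem bracket_eq (μ : Measure G) [μ.IsHaarMeasure] (hK : IsClosed (K : Set G))
    {P : LieAlg E G →ₗ[ℝ] TangentModel E K} (hP : IsTangentProjection P)
    (V W : TangentModule E K) : bracket V W = bracketField μ hK hP V W :=
  IsBracket.unique μ hK (Classical.epsilon_spec ⟨_, isBracket_bracketField μ hK hP V W⟩)
    (isBracket_bracketField μ hK hP V W)

end Fields

/-! ### The constant tensor of an invariant connection -/

section ConnectionTensor

variable {E : Type*} [NormedAddCommGroup E] [NormedSpace ℝ E] [CompleteSpace E]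
  {G : Type*} [TopologicalSpace G] [ChartedSpace E G] [Group G] [LieGroup 𝓘(ℝ, E) ∞ G]
  {K : Subgroup G}

/-- Evaluation of vector fields at a point. -/
def evalAt (x : G) : TangentModule E K →+ TangentModel E K where
  toFun V := V x
  map_zero' := rfl
  map_add' _ _ := rfl

theorem sum_field_apply {n : ℕ} (V : Fin n → TangentModule E K) (x : G) :
    (∑ j, V j) x = ∑ j, V j x := map_sum (evalAt x) V Finset.univ

/-- A combination of the frame with constant coefficients works. -/
theorem exists_field_eq {g : LinearMap.BilinForm ℝ (TangentModel E K)} {n : ℕ}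
    {W : Fin n → TangentModule E K} {x : G} (hW : IsTight g fun j => W j x)
    (X : TangentModel E K) : ∃ V : TangentModule E K, V x = X := by
  refine ⟨∑ j, algebraMap ℝ (FunctionAlgebra E K) (g (W j x) X) • W j, ?_⟩
  rw [sum_field_apply]
  exact hW X

namespace Connection

variable (D : Connection E K)

theorem sum_left {n : ℕ} (V : Fin n → TangentModule E K) (W : TangentModule E K) :
    D (∑ j, V j) W = ∑ j, D (V j) W :=
  map_sum (AddMonoidHom.mk' (fun V => D V W) fun V V' => D.add_left V V' W) V Finset.univ

theorem sum_right {n : ℕ} (V : TangentModule E K) (W : Fin n → TangentModule E K) :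
    D V (∑ j, W j) = ∑ j, D V (W j) :=
  map_sum (AddMonoidHom.mk' (fun W => D V W) fun W W' => D.add_right V W W') W Finset.univ

end Connection

theorem along_sum [T2Space G] {n : ℕ} (V : TangentModule E K) (W : Fin n → TangentModule E K) (x : G) :
    along V (fun y => (∑ j, W j) y) x = ∑ j, along V (W j) x := by
  obtain ⟨γ, h0, hγ⟩ := exists_integralCurve (incl K (V x))
  have h1 := hasDerivAt_integralCurve hγ (mdifferentiable_field (∑ j, W j)) x 0
  have h2 := HasDerivAt.fun_sum (u := Finset.univ) fun j _ =>
    hasDerivAt_integralCurve hγ (mdifferentiable_field (W j)) x 0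
  simp only [h0, mul_one] at h1 h2
  simp only [← sum_field_apply] at h2
  exact h1.unique h2

theorem along_smul [T2Space G] (V : TangentModule E K) (f : FunctionAlgebra E K) (W : TangentModule E K)
    (x : G) : along V (fun y => (f • W) y) x = f.1 x • along V W x + along V f.1 x • W x := by
  rw [add_comm]
  exact lieDeriv_smul (f.2.1.mdifferentiable (by simp)) (mdifferentiable_field W) _ x

theorem along_translateField (V W : TangentModule E K) (y x : G) :
    along (translateField y V) (fun z => translateField y W z) x = along V W (y⁻¹ * x) :=
  lieDeriv_lmul (mdifferentiable_field W) _ y⁻¹ x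

variable [FiniteDimensional ℝ E]

namespace AlmostHermitian

variable (h : AlmostHermitian E K)

/-- The coefficient `g₀(W, V)` as an element of the function algebra. -/
def coeff (W V : TangentModule E K) : FunctionAlgebra E K :=
  ⟨fun x => h.g₀ (W x) (V x),
    (h.g₀.toContinuousBilinearMap.contMDiff.comp W.2.1).clm_apply V.2.1, fun x s => by
      beta_reduce
      rw [W.2.2, V.2.2, h.g₀_Ad]⟩

theorem IsStandardFrame.eq_sum {h : AlmostHermitian E K} {n : ℕ} {W : Fin n → TangentModule E K}
    (hW : h.IsStandardFrame W) (V : TangentModule E K) : V = ∑ j, h.coeff (W j) V • W j := by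
  refine Subtype.ext (funext fun x => ?_)
  rw [sum_field_apply]
  exact hW V x

variable {h} {n : ℕ} {W₀ : Fin n → TangentModule E K} (hW₀ : h.IsStandardFrame W₀)
  (D : Connection E K)

include hW₀ in
-- Both connections obey the same Leibniz rule, so the derivatives of the frame coefficients cancel
-- and only the values of `V` and `W` at `x` enter.
theorem difference_eq_sum [T2Space G] (V W : TangentModule E K) (x : G) :
    D V W x - along V W x = ∑ j, ∑ k, h.g₀ (W₀ j x) (V x) • h.g₀ (W₀ k x) (W x) •
      (D (W₀ j) (W₀ k) x - along (W₀ j) (W₀ k) x) := by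
  have h1 : ∀ U, D U W x - along U W x = ∑ k, h.g₀ (W₀ k x) (W x) •
      (D U (W₀ k) x - along U (W₀ k) x) := fun U => by
    have hW := hW₀.eq_sum W
    have e1 := congrArg (fun Z : TangentModule E K => D U Z x - along U Z x) hW
    beta_reduce at e1
    rw [e1, D.sum_right, sum_field_apply, along_sum, ← Finset.sum_sub_distrib]
    refine Finset.sum_congr rfl fun k _ => ?_
    rw [D.leibniz, along_smul, add_sub_add_right_eq_sub, ← smul_sub]
    rfl
  have h2 : ∀ U, D V U x - along V U x = ∑ j, h.g₀ (W₀ j x) (V x) •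
      (D (W₀ j) U x - along (W₀ j) U x) := fun U => by
    have hV := hW₀.eq_sum V
    have e1 : D V U x = ∑ j, h.g₀ (W₀ j x) (V x) • D (W₀ j) U x := by
      have := congrArg (fun Z : TangentModule E K => D Z U x) hV
      beta_reduce at this
      rw [this, D.sum_left, sum_field_apply]
      refine Finset.sum_congr rfl fun j _ => ?_
      rw [D.smul_left]
      rfl
    have e2 : along V U x = ∑ j, h.g₀ (W₀ j x) (V x) • along (W₀ j) U x := by
      have := congrArg (fun X => lieDerivₗ U.1 x (incl K X)) (hW₀ V x)
      beta_reduce at this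
      rw [map_sum, map_sum] at this
      simp only [map_smul] at this
      exact this
    rw [e1, e2, ← Finset.sum_sub_distrib]
    exact Finset.sum_congr rfl fun j _ => (smul_sub _ _ _).symm
  rw [h2 W]
  refine Finset.sum_congr rfl fun j _ => ?_
  rw [h1 (W₀ j), Finset.smul_sum]

include hW₀ in
/-- The difference of an invariant connection and the canonical one is a constant tensor. -/
theorem exists_connectionTensor [T2Space G] (hinv : D.IsInvariant) :
    ∃ Λ : TangentModel E K →ₗ[ℝ] TangentModel E K →ₗ[ℝ] TangentModel E K,
      ∀ (V W : TangentModule E K) (x : G), D V W x - along V W x = Λ (V x) (W x) := by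
  refine ⟨∑ j, ∑ k, (h.g₀ (W₀ j 1)).smulRight ((h.g₀ (W₀ k 1)).smulRight
    (D (W₀ j) (W₀ k) 1 - along (W₀ j) (W₀ k) 1)), fun V W x => ?_⟩
  -- Translation by `x⁻¹` moves the point to `1`, so the tensor at `1` serves everywhere.
  have h1 : D V W x - along V W x = D (translateField x⁻¹ V) (translateField x⁻¹ W) 1 -
      along (translateField x⁻¹ V) (translateField x⁻¹ W) 1 := by
    rw [along_translateField, ← hinv]
    change _ = D V W (x⁻¹⁻¹ * 1) - _
    rw [inv_inv, mul_one]
  have hx : ∀ U : TangentModule E K, translateField x⁻¹ U 1 = U x := fun U => by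
    change U (x⁻¹⁻¹ * 1) = U x
    rw [inv_inv, mul_one]
  rw [h1, difference_eq_sum hW₀ D, hx, hx]
  simp only [LinearMap.sum_apply, LinearMap.smulRight_apply, LinearMap.smul_apply]

end AlmostHermitian

section Tensor

variable {h : AlmostHermitian E K} {D : Connection E K}
  {Λ : TangentModel E K →ₗ[ℝ] TangentModel E K →ₗ[ℝ] TangentModel E K}
  (hΛ : ∀ (V W : TangentModule E K) (x : G), D V W x - along V W x = Λ (V x) (W x))
  (hval : ∀ (X : TangentModel E K) (x : G), ∃ V : TangentModule E K, V x = X)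

include hΛ hval

theorem connectionTensor_J (hJ : D.CommutesWithJ h) (X Y : TangentModel E K) :
    Λ X (h.J Y) = h.J (Λ X Y) := by
  obtain ⟨V, rfl⟩ := hval X 1
  obtain ⟨W, rfl⟩ := hval Y 1
  have h1 := hΛ V (h.mapJ W) 1
  have h2 : along V (fun y => h.mapJ W y) 1 = h.J (along V W 1) :=
    lieDeriv_clm_comp (LinearMap.toContinuousLinearMap h.J) (mdifferentiable_field W 1) _
  rw [hJ V W] at h1
  rw [← hΛ V W 1, map_sub, ← h2]
  exact h1.symm

theorem connectionTensor_skew [T2Space G] (hcomp : D.IsCompatible h) (X Y Z : TangentModel E K) :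
    h.g₀ (Λ X Y) Z = -h.g₀ Y (Λ X Z) := by
  obtain ⟨U, rfl⟩ := hval X 1
  obtain ⟨V, rfl⟩ := hval Y 1
  obtain ⟨W, rfl⟩ := hval Z 1
  have h1 := hcomp U V W 1
  have h2 : along U (fun y => h.g₀ (V y) (W y)) 1 =
      h.g₀ (along U V 1) (W 1) + h.g₀ (V 1) (along U W 1) :=
    lieDeriv_bilin h.g₀.toContinuousBilinearMap (mdifferentiable_field V)
      (mdifferentiable_field W) _ 1
  rw [← hΛ, ← hΛ, map_sub, map_sub, LinearMap.sub_apply]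
  linarith

/-- The covariant derivatives are themselves vector fields, so the value of their difference at
`s⁻¹` is `AdM s` applied to its value at `1`. -/
theorem connectionTensor_AdM (s : K) (X Y : TangentModel E K) :
    Λ (AdM s X) (AdM s Y) = AdM s (Λ X Y) := by
  obtain ⟨V, rfl⟩ := hval X 1
  obtain ⟨W, rfl⟩ := hval Y 1
  have h1 : ∀ U : TangentModule E K, AdM s (U 1) = U (1 * (s⁻¹ : K)) := fun U => by
    rw [U.2.2, inv_inv]
  have h2 : along V W (1 * (s⁻¹ : K)) = AdM s (along V W 1) := (h1 (alongField V W)).symm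
  rw [h1 V, h1 W, ← hΛ, ← hΛ, map_sub, h1, h2]

omit [FiniteDimensional ℝ E] in
theorem isConnectionForm_iff (hΛJ : ∀ X Y, Λ X (h.J Y) = h.J (Λ X Y)) (V : TangentModule E K)
    (x : G) (L : h.MJ →ₗ[ℂ] h.MJ) :
    h.IsConnectionForm D V x L ↔ L = h.liftJ (Λ (V x)) (hΛJ (V x)) := by
  constructor
  · intro hL
    ext Y
    obtain ⟨Y, rfl⟩ := h.toJ.surjective Y
    obtain ⟨W, rfl⟩ := hval Y x
    rw [← hL W, hΛ]
    rfl
  · rintro rfl W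
    rw [hΛ]
    rfl

omit [FiniteDimensional ℝ E] in
theorem connectionForm_eq (hΛJ : ∀ X Y, Λ X (h.J Y) = h.J (Λ X Y)) (V : TangentModule E K)
    (x : G) : h.connectionForm D V x = h.liftJ (Λ (V x)) (hΛJ (V x)) :=
  (isConnectionForm_iff hΛ hval hΛJ V x _).1
    (Classical.epsilon_spec (p := h.IsConnectionForm D V x)
      ⟨_, (isConnectionForm_iff hΛ hval hΛJ V x _).2 rfl⟩)

end Tensor

end ConnectionTensor

/-! ### The action of the connection tensor on spinors -/

namespace HermitianStructure

variable {M : Type*} [AddCommGroup M] [Module ℝ M] (h : HermitianStructure M)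

theorem derivationExt_add (L L' : h.MJ →ₗ[ℂ] h.MJ) :
    h.derivationExt (L + L') = h.derivationExt L + h.derivationExt L' := by
  ext η
  induction η using h.spinor_induction with
  | one => simp [derivationExt_one]
  | ι_mul Y η ih =>
    rw [LinearMap.add_apply] at ih ⊢
    simp only [derivationExt_mul, derivationExt_ι, ih, LinearMap.add_apply, map_add, add_mul,
      mul_add]
    abel
  | add η θ hη hθ => rw [map_add, map_add, hη, hθ]
  | smul z η hη => rw [map_smul, map_smul, hη]

theorem derivationExt_smul (c : ℂ) (L : h.MJ →ₗ[ℂ] h.MJ) :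
    h.derivationExt (c • L) = c • h.derivationExt L := by
  ext η
  induction η using h.spinor_induction with
  | one => simp [derivationExt_one]
  | ι_mul Y η ih =>
    rw [LinearMap.smul_apply] at ih ⊢
    simp only [derivationExt_mul, derivationExt_ι, ih, LinearMap.smul_apply, map_smul, smul_add,
      smul_mul_assoc, mul_smul_comm]
  | add η θ hη hθ => rw [map_add, map_add, hη, hθ]
  | smul z η hη => rw [map_smul, map_smul, hη]

/-- The action on spinors of a linear family of complex endomorphisms of `M_J`. -/
def spinTensor (Λ : M →ₗ[ℝ] M →ₗ[ℝ] M) (hΛ : ∀ X Y, Λ X (h.J Y) = h.J (Λ X Y)) :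
    M →ₗ[ℝ] Module.End ℂ h.Spinor where
  toFun X := h.derivationExt (h.liftJ (Λ X) (hΛ X))
  map_add' X Y := by
    rw [← derivationExt_add]
    congr 1
    ext Z
    simp [liftJ]
  map_smul' r X := by
    have : h.liftJ (Λ (r • X)) (hΛ (r • X)) = (r : ℂ) • h.liftJ (Λ X) (hΛ X) := by
      ext Z
      simp [liftJ, toJ_smul]
    rw [this, derivationExt_smul]
    rfl

section

variable {Λ : M →ₗ[ℝ] M →ₗ[ℝ] M} (hΛ : ∀ X Y, Λ X (h.J Y) = h.J (Λ X Y))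
  (hskew : ∀ X Y Z, h.g₀ (Λ X Y) Z = -h.g₀ Y (Λ X Z))
include hskew

/-- Both factors are skew-adjoint, so the adjoint of their product is the product in reverse order;
restoring the order costs the commutator `κ(Λ X X)`. -/
theorem innerS_kappaVec_spinTensor (X : M) (φ ψ : h.Spinor) :
    h.innerS (h.kappaVec X (h.spinTensor Λ hΛ X φ)) ψ =
      h.innerS φ (h.kappaVec X (h.spinTensor Λ hΛ X ψ)) + h.innerS φ (h.kappaVec (Λ X X) ψ) := by
  have hs : IsSkew (h.liftJ (Λ X) (hΛ X)) := h.isSkew_of_g₀ _ fun Y Z => hskew X Y Z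
  rw [innerS_kappaVec]
  change -h.innerS (h.derivationExt (h.liftJ (Λ X) (hΛ X)) φ) (h.kappaVec X ψ) = _
  rw [h.innerS_derivationExt hs, h.derivationExt_kappaVec hs, innerS_add_right, neg_neg]
  rfl

end

section norm

variable [FiniteDimensional ℝ M]

/-- The inner product of spinors as a continuous real bilinear map. -/
def innerCLM : h.Spinor →L[ℝ] h.Spinor →L[ℝ] ℂ :=
  (LinearMap.mk₂ ℝ h.innerS (fun _ _ _ => h.innerS_add_left _ _ _)
    (fun r φ ψ => by rw [← Complex.coe_smul, innerS_smul_left, Complex.conj_ofReal]; simp)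
    (fun _ _ _ => h.innerS_add_right _ _ _)
    (fun r φ ψ => by rw [← Complex.coe_smul, innerS_smul_right]; simp)).toContinuousBilinearMap

theorem innerCLM_apply (φ ψ : h.Spinor) : h.innerCLM φ ψ = h.innerS φ ψ := rfl

/-- A complex endomorphism of the space of spinors as a continuous real linear map. -/
def endCLM (A : Module.End ℂ h.Spinor) : h.Spinor →L[ℝ] h.Spinor :=
  LinearMap.toContinuousLinearMap (A.restrictScalars ℝ)

theorem endCLM_apply (A : Module.End ℂ h.Spinor) (φ : h.Spinor) : h.endCLM A φ = A φ := rfl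

end norm

end HermitianStructure

/-! ### The Dirac operator in a constant frame and its Green formula -/

section Dirac

open MeasureTheory

variable {E : Type*} [NormedAddCommGroup E] [NormedSpace ℝ E] [CompleteSpace E]
  [FiniteDimensional ℝ E]
  {G : Type*} [TopologicalSpace G] [ChartedSpace E G] [Group G] [LieGroup 𝓘(ℝ, E) ∞ G]
  {K : Subgroup G}

section Tensor

variable {h : AlmostHermitian E K} {D : Connection E K}
  {Λ : TangentModel E K →ₗ[ℝ] TangentModel E K →ₗ[ℝ] TangentModel E K}
  (hΛ : ∀ (V W : TangentModule E K) (x : G), D V W x - along V W x = Λ (V x) (W x))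
  (hval : ∀ (X : TangentModel E K) (x : G), ∃ V : TangentModule E K, V x = X)

include hval in
omit [FiniteDimensional ℝ E] in
theorem isTight_of_isStandardFrame {n : ℕ} {W : Fin n → TangentModule E K}
    (hW : h.IsStandardFrame W) (x : G) : IsTight h.g₀ fun j => W j x := by
  intro X
  obtain ⟨V, rfl⟩ := hval X x
  exact (hW V x).symm

/-- The Dirac operator in terms of a constant family of vectors. -/
def constDirac (h : AlmostHermitian E K) (hΛJ : ∀ X Y, Λ X (h.J Y) = h.J (Λ X Y)) {n : ℕ}
    (u : Fin n → TangentModel E K) (ψ : G → h.Spinor) (x : G) : h.Spinor :=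
  ∑ j, h.kappaVec (u j) (lieDeriv (incl K (u j)) ψ x + h.spinTensor Λ hΛJ (u j) (ψ x))

include hΛ hval in
-- At each `x` the summand is a bilinear expression in two copies of `W j x`, so any tight family
-- may be substituted. The vectors `u j` need not come from vector fields, and single terms of the
-- new sum need not be sections; they are functions on `G`.
theorem dirac_eq_constDirac (hΛJ : ∀ X Y, Λ X (h.J Y) = h.J (Λ X Y)) {n m : ℕ}
    {W : Fin n → TangentModule E K} (hW : h.IsStandardFrame W) {u : Fin m → TangentModel E K}
    (hu : IsTight h.g₀ u) (ψ : G → h.Spinor) : h.dirac D W ψ = constDirac h hΛJ u ψ := by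
  funext x
  let S : TangentModel E K →ₗ[ℝ] h.Spinor :=
    lieDerivₗ ψ x ∘ₗ incl K + (LinearMap.applyₗ (ψ x)).restrictScalars ℝ ∘ₗ h.spinTensor Λ hΛJ
  let B : TangentModel E K →ₗ[ℝ] TangentModel E K →ₗ[ℝ] h.Spinor :=
    LinearMap.mk₂ ℝ (fun X Y => h.kappaVec X (S Y))
      (fun X X' Y => by rw [map_add, LinearMap.add_apply])
      (fun r X Y => by rw [map_smul, LinearMap.smul_apply])
      (fun X Y Y' => by rw [map_add, map_add])
      (fun r X Y => by rw [map_smul, ← Complex.coe_smul, map_smul, Complex.coe_smul])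
  refine Eq.trans ?_ ((isTight_of_isStandardFrame hval hW x).sum_eq h.g₀_symm hu B)
  refine Finset.sum_congr rfl fun j _ => ?_
  rw [h.kappa_cliffordVec_eq, AlmostHermitian.spinConnection, connectionForm_eq hΛ hval hΛJ]
  rfl

theorem contMDiff_constDirac (hΛJ : ∀ X Y, Λ X (h.J Y) = h.J (Λ X Y)) {n : ℕ}
    (u : Fin n → TangentModel E K) {ψ : G → h.Spinor}
    (hψ : ContMDiff 𝓘(ℝ, E) 𝓘(ℝ, h.Spinor) ∞ ψ) :
    ContMDiff 𝓘(ℝ, E) 𝓘(ℝ, h.Spinor) ∞ (constDirac h hΛJ u ψ) := by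
  refine contMDiff_finsetSum fun j _ => ?_
  exact (h.endCLM (h.kappaVec (u j))).contMDiff.comp ((contMDiff_lieDeriv hψ _).add
    ((h.endCLM (h.spinTensor Λ hΛJ (u j))).contMDiff.comp hψ))

variable [T2Space G]

/-- The derivative terms combine to a divergence by skewness of `κ`; the tensor terms leave their
commutators. -/
theorem innerS_constDirac_sub (hΛJ : ∀ X Y, Λ X (h.J Y) = h.J (Λ X Y))
    (hskew : ∀ X Y Z, h.g₀ (Λ X Y) Z = -h.g₀ Y (Λ X Z)) {n : ℕ}
    (u : Fin n → TangentModel E K) {ψ φ : G → h.Spinor}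
    (hψ : ContMDiff 𝓘(ℝ, E) 𝓘(ℝ, h.Spinor) ∞ ψ) (hφ : ContMDiff 𝓘(ℝ, E) 𝓘(ℝ, h.Spinor) ∞ φ)
    (x : G) :
    h.innerS (constDirac h hΛJ u ψ x) (φ x) - h.innerS (ψ x) (constDirac h hΛJ u φ x) =
      h.innerS (ψ x) (h.kappaVec (∑ j, Λ (u j) (u j)) (φ x)) -
        ∑ j, lieDeriv (incl K (u j))
          (fun y => h.innerCLM (ψ y) (h.endCLM (h.kappaVec (u j)) (φ y))) x := by
  have hL : ∀ η : h.Spinor, h.innerS (constDirac h hΛJ u ψ x) η =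
      ∑ j, h.innerS (h.kappaVec (u j)
        (lieDeriv (incl K (u j)) ψ x + h.spinTensor Λ hΛJ (u j) (ψ x))) η := fun η => by
    have := congrArg (fun T => T η) (map_sum h.innerCLM (fun j => h.kappaVec (u j)
        (lieDeriv (incl K (u j)) ψ x + h.spinTensor Λ hΛJ (u j) (ψ x))) Finset.univ)
    simp only [sum_apply] at this
    exact this
  rw [hL, constDirac, h.innerS_sum_right, map_sum, LinearMap.sum_apply, h.innerS_sum_right,
    ← Finset.sum_sub_distrib, ← Finset.sum_sub_distrib]
  refine Finset.sum_congr rfl fun j _ => ?_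
  have hφ' := hφ.mdifferentiable (by simp : (∞ : WithTop ℕ∞) ≠ 0)
  have hκ : MDifferentiable 𝓘(ℝ, E) 𝓘(ℝ, h.Spinor)
      (fun y => h.endCLM (h.kappaVec (u j)) (φ y)) :=
    ((h.endCLM (h.kappaVec (u j))).contMDiff.comp hφ).mdifferentiable
      (by simp : (∞ : WithTop ℕ∞) ≠ 0)
  rw [lieDeriv_bilin h.innerCLM (hψ.mdifferentiable (by simp)) hκ,
    lieDeriv_clm_comp _ (hφ' x), h.innerCLM_apply, h.innerCLM_apply, h.endCLM_apply,
    h.endCLM_apply, map_add, map_add, h.innerS_add_left, h.innerS_add_right,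
    h.innerS_kappaVec_spinTensor hΛJ hskew, h.innerS_kappaVec]
  ring

variable [CompactSpace G] [MeasurableSpace G] [BorelSpace G]

theorem integral_constDirac (μ : Measure G) [μ.IsHaarMeasure]
    (hΛJ : ∀ X Y, Λ X (h.J Y) = h.J (Λ X Y))
    (hskew : ∀ X Y Z, h.g₀ (Λ X Y) Z = -h.g₀ Y (Λ X Z)) {n : ℕ}
    (u : Fin n → TangentModel E K) {ψ φ : G → h.Spinor}
    (hψ : ContMDiff 𝓘(ℝ, E) 𝓘(ℝ, h.Spinor) ∞ ψ) (hφ : ContMDiff 𝓘(ℝ, E) 𝓘(ℝ, h.Spinor) ∞ φ) :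
    ∫ x, h.innerS (constDirac h hΛJ u ψ x) (φ x) ∂μ -
        ∫ x, h.innerS (ψ x) (constDirac h hΛJ u φ x) ∂μ =
      ∫ x, h.innerS (ψ x) (h.kappaVec (∑ j, Λ (u j) (u j)) (φ x)) ∂μ := by
  have hin : ∀ {α β : G → h.Spinor}, ContMDiff 𝓘(ℝ, E) 𝓘(ℝ, h.Spinor) ∞ α →
      ContMDiff 𝓘(ℝ, E) 𝓘(ℝ, h.Spinor) ∞ β →
      ContMDiff 𝓘(ℝ, E) 𝓘(ℝ, ℂ) ∞ (fun x => h.innerCLM (α x) (β x)) := fun hα hβ =>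
    (h.innerCLM.contMDiff.comp hα).clm_apply hβ
  have hκ : ∀ X, ContMDiff 𝓘(ℝ, E) 𝓘(ℝ, h.Spinor) ∞ (fun x => h.endCLM (h.kappaVec X) (φ x)) :=
    fun X => (h.endCLM (h.kappaVec X)).contMDiff.comp hφ
  have hint : ∀ {f : G → ℂ}, ContMDiff 𝓘(ℝ, E) 𝓘(ℝ, ℂ) ∞ f → Integrable f μ := fun hf =>
    integrable_of_continuous μ hf.continuous
  have h1 : Integrable (fun x => h.innerS (constDirac h hΛJ u ψ x) (φ x)) μ :=
    hint (hin (contMDiff_constDirac hΛJ u hψ) hφ)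
  have h2 : Integrable (fun x => h.innerS (ψ x) (constDirac h hΛJ u φ x)) μ :=
    hint (hin hψ (contMDiff_constDirac hΛJ u hφ))
  have h3 : Integrable (fun x => h.innerS (ψ x) (h.kappaVec (∑ j, Λ (u j) (u j)) (φ x))) μ :=
    hint (hin hψ (hκ _))
  rw [← integral_sub h1 h2]
  simp only [innerS_constDirac_sub hΛJ hskew u hψ hφ]
  rw [integral_sub h3
    (integrable_finsetSum _ fun j _ => hint (contMDiff_lieDeriv (hin hψ (hκ _)) _)),
    integral_finsetSum _ fun j _ => hint (contMDiff_lieDeriv (hin hψ (hκ _)) _)]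
  simp only [integral_lieDeriv μ (hin hψ (hκ _)), Finset.sum_const_zero, sub_zero]

end Tensor

end Dirac

/-! ### The trace of the torsion and the test spinors -/

section SelfAdjoint

open MeasureTheory

variable {E : Type*} [NormedAddCommGroup E] [NormedSpace ℝ E] [CompleteSpace E]
  [FiniteDimensional ℝ E]
  {G : Type*} [TopologicalSpace G] [ChartedSpace E G] [Group G] [LieGroup 𝓘(ℝ, E) ∞ G]
  [T2Space G] [CompactSpace G] [MeasurableSpace G] [BorelSpace G]
  {K : Subgroup G} {h : AlmostHermitian E K}

/-- In a basis orthonormal for the negative Killing form `B`, each diagonal entry is `B([X, e], e) =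
B(X, [e, e]) = 0`. -/
theorem trace_tangentBracket [LieAlgebra.IsSemisimple ℝ (LieAlg E G)] (μ : Measure G)
    [μ.IsHaarMeasure] {P : LieAlg E G →ₗ[ℝ] TangentModel E K} (hP : IsTangentProjection P)
    (X : TangentModel E K) : LinearMap.trace ℝ _ (tangentBracket P X) = 0 := by
  let b : LinearMap.BilinForm ℝ (TangentModel E K) :=
    (negKilling E G).compl₁₂ (incl K) (incl K)
  have hb : ∀ X Y, b X Y = negKilling E G (incl K X) (incl K Y) := fun _ _ => rfl
  obtain ⟨e, he⟩ := exists_orthonormal_basis_of_pos b (fun X Y => negKilling_symm _ _)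
    (fun X hX => negKilling_pos μ _ fun h0 => hX (incl_injective (h0.trans (map_zero _).symm)))
  rw [trace_eq_sum_orthonormal e he]
  refine Finset.sum_eq_zero fun i _ => ?_
  rw [hb, negKilling_symm, negKilling_apply, tangentBracket_apply, hP.killingForm_incl]
  have h1 : killingForm ℝ (LieAlg E G) ⁅incl K X, incl K (e i)⁆ (incl K (e i)) =
      killingForm ℝ (LieAlg E G) (incl K X) ⁅incl K (e i), incl K (e i)⁆ :=
    LieModule.traceForm_apply_lie_apply ℝ _ _ _ _ _
  rw [h1, lie_self, map_zero, neg_zero]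

variable {D : Connection E K}
  {Λ : TangentModel E K →ₗ[ℝ] TangentModel E K →ₗ[ℝ] TangentModel E K}

/-- The derivatives in the bracket of fields cancel those in the connection, so the torsion is `Λ U
V - Λ V U - [U, V]_𝔪`. Only the middle term has a trace, and skewness moves `Λ (W j)` from `U` to `W
j`. -/
theorem traceTorsion_eq [LieAlgebra.IsSemisimple ℝ (LieAlg E G)] (μ : Measure G)
    [μ.IsHaarMeasure] (hK : IsClosed (K : Set G))
    (hΛ : ∀ (V W : TangentModule E K) (x : G), D V W x - along V W x = Λ (V x) (W x))
    (hskew : ∀ X Y Z, h.g₀ (Λ X Y) Z = -h.g₀ Y (Λ X Z)) {n m : ℕ}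
    {W : Fin n → TangentModule E K} {x : G} (hW : IsTight h.g₀ fun j => W j x)
    {u : Fin m → TangentModel E K} (hu : IsTight h.g₀ u) (U : TangentModule E K) :
    h.traceTorsion D W U x = h.g₀ (U x) (∑ j, Λ (u j) (u j)) := by
  obtain ⟨P, hP⟩ := exists_tangentProjection (E := E) μ hK
  have ht : ∀ V : TangentModule E K, D.torsion U V x =
      Λ (U x) (V x) - Λ (V x) (U x) - tangentBracket P (U x) (V x) := fun V => by
    rw [← hΛ, ← hΛ]
    change D U V x - D V U x - bracket U V x = _
    rw [bracket_eq μ hK hP, bracketField_apply, tangentBracket_apply]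
    abel
  have hself : ∀ X Y, h.g₀ (Λ X Y) Y = 0 := fun X Y => by
    have := hskew X Y Y
    rw [h.g₀_symm Y] at this
    linarith
  rw [← hW.sum_eq h.g₀_symm hu Λ, map_sum]
  have hB := (hW.sum_eq_trace h.g₀_symm h.g₀_pos (tangentBracket P (U x))).trans
    (trace_tangentBracket μ hP (U x))
  simp only [AlmostHermitian.traceTorsion, ht, map_sub, LinearMap.sub_apply,
    Finset.sum_sub_distrib, hself, hB, hskew (W _ x) (U x)]
  simp

omit [FiniteDimensional ℝ E] [T2Space G] [CompactSpace G] [MeasurableSpace G] [BorelSpace G] in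
-- `AdM s` is unitary on `𝔪_J`. For a `K`-fixed vector this says that `κ` preserves the spinor
-- module.
theorem spinAction_kappaVec (s : K) (X : TangentModel E K) (η : h.Spinor) :
    h.spinAction s (h.kappaVec X η) = h.kappaVec (AdM s X) (h.spinAction s η) := by
  refine h.mapExt_kappaVec _ (fun X Y => ?_) X η
  change h.hermForm (AdM s X) (h.toJ (AdM s Y)) = _
  rw [h.hermForm_apply, h.hermForm_apply, h.g₀_Ad, ← h.J_Ad, h.g₀_Ad]

/-- The vacuum `1` is fixed by the action of `K` on spinors, so `c · 1` is a section as soon as `c`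
has the type of `χ`. Pairing `κ(τ)(c · 1)` with itself gives `g₀(τ, τ) ∫ |c|²`. -/
theorem eq_zero_of_integral_eq_zero (μ : Measure G) [μ.IsHaarMeasure] (hK : IsClosed (K : Set G))
    (χ : K →ₜ* Circle) {τ : TangentModel E K} (hτ : ∀ s : K, AdM s τ = τ)
    (hint : ∀ ψ ∈ h.SpinorModule χ, ∀ φ ∈ h.SpinorModule χ,
      ∫ x, h.innerS (ψ x) (h.kappaVec τ (φ x)) ∂μ = 0) : τ = 0 := by
  obtain ⟨c, hc, hcχ, hc1⟩ := exists_character_function (E := E) hK χ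
  let φ : G → h.Spinor := fun x => c x • (1 : h.Spinor)
  have hφ : φ ∈ h.SpinorModule χ := by
    refine ⟨?_, fun x s => ?_⟩
    · exact (ContinuousLinearMap.toSpanSingleton ℂ (1 : h.Spinor)).restrictScalars ℝ
        |>.contMDiff.comp hc
    · simp only [φ, hcχ, map_smul, map_one, mul_smul]
  have hψ : (fun x => h.kappaVec τ (φ x)) ∈ h.SpinorModule χ := by
    refine ⟨(h.endCLM (h.kappaVec τ)).contMDiff.comp hφ.1, fun x s => ?_⟩
    beta_reduce
    rw [hφ.2, spinAction_kappaVec, hτ, map_smul]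
  have h1 := hint _ hψ φ hφ
  have h2 : ∀ x, h.innerS (h.kappaVec τ (φ x)) (h.kappaVec τ (φ x)) =
      ((‖c x‖ ^ 2 * h.g₀ τ τ : ℝ) : ℂ) := fun x => by
    simp only [φ, map_smul]
    rw [h.innerS_smul_left, h.innerS_smul_right, h.innerS_kappaVec_vacuum, ← mul_assoc,
      Complex.conj_mul']
    simp
  simp only [h2] at h1
  rw [integral_complex_ofReal, integral_mul_const, Complex.ofReal_eq_zero, mul_eq_zero] at h1
  have hpos : 0 < ∫ x, ‖c x‖ ^ 2 ∂μ :=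
    Continuous.integral_pos_of_hasCompactSupport_nonneg_nonzero (x := 1)
      (hc.continuous.norm.pow 2) (HasCompactSupport.of_compactSpace _)
      (fun x => by positivity) (by simpa using hc1)
  by_contra h0
  exact (h.g₀_pos τ h0).ne' (h1.resolve_left hpos.ne')

end SelfAdjoint

end HomDirac

end

theorem theorem7p1
    {E : Type*} [NormedAddCommGroup E] [NormedSpace ℝ E] [FiniteDimensional ℝ E] [CompleteSpace E]
    {G : Type*} [TopologicalSpace G] [ChartedSpace E G] [Group G] [LieGroup 𝓘(ℝ, E) ∞ G]
    [CompactSpace G] [T2Space G] [LieAlgebra.IsSemisimple ℝ (LieAlg E G)]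
    [MeasurableSpace G] [BorelSpace G] (μ : MeasureTheory.Measure G) [μ.IsHaarMeasure]
    (K : Subgroup G) (hK : IsClosed (K : Set G))
    (h : AlmostHermitian E K) (χ : K →ₜ* Circle)
    (D : Connection E K) (hinv : D.IsInvariant) (hcomp : D.IsCompatible h)
    (hJ : D.CommutesWithJ h) :
    -- the objects in terms of which the claim is stated are well defined
    (∃ (n : ℕ) (W : Fin n → TangentModule E K), h.IsStandardFrame W) ∧
    (∀ V W : TangentModule E K, ∃! Z : TangentModule E K, IsBracket V W Z) ∧
    (∀ (V : TangentModule E K) (x : G), ∃! L : h.MJ →ₗ[ℂ] h.MJ, h.IsConnectionForm D V x L) ∧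
    -- the claim, for every choice of the frames
    ∀ (n : ℕ) (W : Fin n → TangentModule E K), h.IsStandardFrame W →
    ∀ (m : ℕ) (W' : Fin m → TangentModule E K), h.IsStandardFrame W' →
      (h.FormallySelfAdjoint μ χ (h.dirac D W) ↔
        ∀ (U : TangentModule E K) (x : G), h.traceTorsion D W' U x = 0) := by
  obtain ⟨n₀, W₀, hW₀⟩ := exists_standardFrame μ hK h
  have hW₀' : h.IsStandardFrame W₀ := fun V x => (hW₀ (V x) x).symm
  have hval : ∀ (X : TangentModel E K) (x : G), ∃ V : TangentModule E K, V x = X := fun X x =>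
    exists_field_eq (g := h.g₀) (W := W₀) (fun Y => hW₀ Y x) X
  obtain ⟨P, hP⟩ := exists_tangentProjection (E := E) μ hK
  obtain ⟨Λ, hΛ⟩ := AlmostHermitian.exists_connectionTensor hW₀' D hinv
  have hΛJ := connectionTensor_J hΛ hval hJ
  have hskew := connectionTensor_skew hΛ hval hcomp
  -- The values of a frame at `1` are the constant family used throughout.
  have hu : IsTight h.g₀ fun j => W₀ j 1 := fun X => hW₀ X 1
  -- The isometry `AdM s` carries a tight family to a tight family, and the sum does not depend on
  -- the family.
  have hτ : ∀ s : K, AdM s (∑ j, Λ (W₀ j 1) (W₀ j 1)) = ∑ j, Λ (W₀ j 1) (W₀ j 1) := fun s => by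
    have hs : IsTight h.g₀ fun j => AdM s (W₀ j 1) := fun X => by
      have := congrArg (AdM s) (hu (AdM s⁻¹ X))
      rw [map_sum, AdM_comp_inv] at this
      conv_rhs => rw [← this]
      refine Finset.sum_congr rfl fun j _ => ?_
      rw [map_smul, ← h.g₀_Ad s _ (AdM s⁻¹ X), AdM_comp_inv]
    rw [map_sum, ← hs.sum_eq h.g₀_symm hu Λ]
    exact Finset.sum_congr rfl fun j _ => (connectionTensor_AdM hΛ hval s _ _).symm
  refine ⟨⟨n₀, W₀, hW₀'⟩, fun V W => ⟨_, isBracket_bracketField μ hK hP V W, fun Z hZ =>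
    hZ.unique μ hK (isBracket_bracketField μ hK hP V W)⟩, fun V x =>
    ⟨_, (isConnectionForm_iff hΛ hval hΛJ V x _).2 rfl, fun L hL =>
      (isConnectionForm_iff hΛ hval hΛJ V x L).1 hL⟩, fun n W hW m W' hW' => ?_⟩
  have htrace : ∀ (U : TangentModule E K) (x : G), h.traceTorsion D W' U x =
      h.g₀ (U x) (∑ j, Λ (W₀ j 1) (W₀ j 1)) := fun U x =>
    traceTorsion_eq μ hK hΛ hskew (isTight_of_isStandardFrame hval hW' x) hu U
  simp only [AlmostHermitian.FormallySelfAdjoint, dirac_eq_constDirac hΛ hval hΛJ hW hu, htrace]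
  constructor
  · intro hsa U x
    rw [eq_zero_of_integral_eq_zero μ hK χ hτ fun ψ hψ φ hφ => by
      rw [← integral_constDirac μ hΛJ hskew _ hψ.1 hφ.1, hsa ψ hψ φ hφ, sub_self], map_zero]
  · intro ht ψ hψ φ hφ
    -- A field with value `τ` at `1` turns the hypothesis into `g₀(τ, τ) = 0`.
    obtain ⟨U, hU⟩ := hval (∑ j, Λ (W₀ j 1) (W₀ j 1)) 1
    have h0 : ∑ j, Λ (W₀ j 1) (W₀ j 1) = 0 := by
      by_contra hne
      have := ht U 1
      rw [hU] at this
      exact (h.g₀_pos _ hne).ne' this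
    have hint := integral_constDirac μ hΛJ hskew (fun j => W₀ j 1) hψ.1 hφ.1
    have hz : ∀ η θ : h.Spinor, h.innerS η ((0 : Module.End ℂ h.Spinor) θ) = 0 := fun η θ => by
      have := h.innerS_smul_right 0 η θ
      rwa [zero_smul, zero_mul] at this
    rw [h0, map_zero] at hint
    simp only [hz, MeasureTheory.integral_zero] at hint
    exact sub_eq_zero.1 hint
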